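/- **Setting.** Let $\mathcal F=\bigoplus_N\mathcal F_N$ be the fermionic Fock space over $\mathbb C$ with basis $|\lambda;N\rangle=e_{\ell_1}\wedge e_{\ell_2}\wedge\cdots$, $\ell_i=\lambda_i-i+N$, vacuum $|0\rangle=e_{-1}\wedge e_{-2}\wedge\cdots$, $\psi_i=e_i\wedge$, $\psi_i^*=i_{\tilde e^i}$, $\psi(z)=\sum_{i\in\mathbb Z}\psi_iz^i$, $\psi^*(w)=\sum_{i\in\mathbb Z}\psi^*_iw^{-i-1}$. Put $J_k=\sum_j{:}\psi_j\psi^*_{j+k}{:}$ and, for $\mathbf t=(t_1,t_2,\dots)$, $\hat\gamma_+(\mathbf t)=e^{\sum_{k\ge1}t_kJ_k}$ and $\xi(\mathbf t,z)=\sum_{k\ge1}t_kz^k$. For $\mathbf z=(z_1,\dots,z_n)$ let $[\mathbf z^{-1}]$ be the sequence with $k$-th term $\frac1k\sum_jz_j^{-k}$. Let $\hat g$ be a linear map from $\mathcal F$ to its completion (formal infinite combinations of basis vectors), and let $\tau_g(\mathbf t)=\langle0|\hat\gamma_+(\mathbf t)\hat g|0\rangle$ and $$\tilde K^g_{2n}(\mathbf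 z,\mathbf w,\mathbf t)=\langle0|\hat\gamma_+(\mathbf t)\prod_{i=1}^n\big(\psi(z_i)\psi^*(w_i)\big)\hat g|0\rangle ,$$ both read as sums over the basis states inserted in front of $\hat g|0\rangle$. Call $\hat g$ group-like if $[\sum_i\psi_i\otimes\psi_i^*,\hat g\otimes\hat g]=0$. Products of the fields are radially ordered: factors are arranged by decreasing modulus of the argument, with the sign of the permutation (so the product is the literal one if $|z_1|>|w_1|>|z_2|>|w_2|>\dots>|w_n|$). Where some $|z_i|=|w_j|$, the product is defined by continuity. **Theorem.** (0) For every lower triangular matrix $A=(A_{ij})_{i,j\in\mathbb Z}$ ($A_{ij}=0$ for $j>i$), the Clifford representation $\hat g=\exp\sum A_{ij}{:}\psi_i\psi_j^*{:}$ of $g=e^A$ is group-like, and $\langle0|\hat g|0\rangle=1$. Let $n\ge0$ and let $z_1,\dots,z_n,w_1,\dots,w_n$ be nonzero complex numbers with $z_i\neq w_j$ for all $i,j$. (1) As covectors on $\mathcal F$, $$\langle0|\prod_{i=1}^n\big(\psi(z_i)\psi^*(w_i)\big)=\det\Big(\frac1{z_i-w_j}\Big)_{1\le i,j\le n}\,\langle0|\hat\gamma_+([\mathbf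 w^{-1}]-[\mathbf z^{-1}]),$$ where on each basis vector the multiple series of the left side, in any radial order, converges absolutely, and the extension by continuity exists. Let moreover $\mathbf t$ be such that $\xi(\mathbf t,\cdot)$ converges absolutely on a disc $|x|\le r$ with $r>|z_i|,|w_i|$ for all $i$. Then the covector $\langle0|\hat\gamma_+(\mathbf t)\prod_{i}(\psi(z_i)\psi^*(w_i))$ is well defined in the same sense, and the following hold. (2) For every $\hat g$ for which the series of $\tau_g$ at $\mathbf t-[\mathbf z^{-1}]+[\mathbf w^{-1}]$ converges absolutely, the series of $\tilde K^g_{2n}(\mathbf z,\mathbf w,\mathbf t)$ converges absolutely and $$\tilde K^g_{2n}(\mathbf z,\mathbf w,\mathbf t)=\prod_{j=1}^ne^{\xi(\mathbf t,z_j)-\xi(\mathbf t,w_j)}\;\tau_g\big(\mathbf t-[\mathbf z^{-1}]+[\mathbf w^{-1}]\big)\,\det\Big(\frac1{z_i-w_j}\Big)_{1\le i,j\le n}.$$ (3) For every group-like $\hat g$ and $n\ge1$, if the series of $\tau_g$ converges absolutely at $\mathbf t$, at $\mathbf t-[\mathbf z^{-1}]+[\mathbf w^{-1}]$ and at all $\mathbf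 t-[z_i^{-1}]+[w_j^{-1}]$, then $$\tau_g(\mathbf t)^{\,n-1}\,\tilde K^g_{2n}(\mathbf z,\mathbf w,\mathbf t)=\det\big(\tilde K^g_2(z_i,w_j,\mathbf t)\big)_{1\le i,j\le n}=\det\left(\frac{e^{\xi(\mathbf t,z_i)-\xi(\mathbf t,w_j)}\,\tau_g(\mathbf t-[z_i^{-1}]+[w_j^{-1}])}{z_i-w_j}\right)_{1\le i,j\le n}.$$ (If $\langle0|\hat g|0\rangle=1$, as in (0), the factor $\tau_g(\mathbf t)^{n-1}$ equals $1$ at $\mathbf t=\mathbf 0$.) -/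

import Mathlib

open Filter Topology
open scoped Nat

namespace FermionicFock

noncomputable section

/-- Maya diagrams: subsets `S ⊆ ℤ` containing finitely many integers `≥ 0` and all but finitely
many integers `< 0`.  They label the standard basis
`|λ; N⟩ = e_{ℓ₁} ∧ e_{ℓ₂} ∧ ⋯` of the semi-infinite wedge space through
`S = {ℓ₁ > ℓ₂ > ⋯}`, `ℓ_i = λ_i - i + N`. -/
def Maya : Type :=
  {S : Set ℤ // {i | i ∈ S ∧ 0 ≤ i}.Finite ∧ {i | i ∉ S ∧ i < 0}.Finite}

/-- The Dirac sea `{-1, -2, -3, …}`. -/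
def vac : Maya :=
  ⟨{i | i < 0}, by
    constructor
    · convert Set.finite_empty (α := ℤ)
      ext i; simp
    · convert Set.finite_empty (α := ℤ)
      ext i; simp⟩

/-- The site `i` becomes occupied. -/
def Maya.insert (S : Maya) (i : ℤ) : Maya :=
  ⟨Insert.insert i S.1, by
    constructor
    · refine (S.2.1.union (Set.finite_singleton i)).subset ?_
      rintro k ⟨hk, h0⟩
      rcases hk with rfl | hk
      · exact Or.inr rfl
      · exact Or.inl ⟨hk, h0⟩
    · refine S.2.2.subset ?_
      rintro k ⟨hk, h0⟩
      exact ⟨fun h => hk (Or.inr h), h0⟩⟩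

/-- The site `i` becomes empty. -/
def Maya.erase (S : Maya) (i : ℤ) : Maya :=
  ⟨S.1 \ {i}, by
    constructor
    · refine S.2.1.subset ?_
      rintro k ⟨hk, h0⟩
      exact ⟨hk.1, h0⟩
    · refine (S.2.2.union (Set.finite_singleton i)).subset ?_
      rintro k ⟨hk, h0⟩
      by_cases h : k = i
      · exact Or.inr h
      · exact Or.inl ⟨fun hS => hk ⟨hS, h⟩, h0⟩⟩

/-- The fermionic Fock space `ℱ = ⨁_N ℱ_N`: finite linear combinations of basis states. -/
abbrev Fock : Type := Maya →₀ ℂ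

/-- The completed Fock space: arbitrary formal linear combinations `∑_S v_S |S⟩`. -/
abbrev FockHat : Type := Maya → ℂ

/-- The basis state `|S⟩`. -/
def ket (S : Maya) : Fock := Finsupp.single S 1

/-- The covector `⟨0|`. -/
def bra0 : Module.Dual ℂ Fock := Finsupp.lapply vac

/-- `(-1)` to the number of occupied sites above `i`: the sign of moving `e_i` to its place. -/
def wedgeSign (i : ℤ) (S : Maya) : ℂ := (-1) ^ Set.ncard {k | k ∈ S.1 ∧ i < k}

open Classical in
/-- `ψ_i = e_i ∧`. -/
def psi (i : ℤ) : Module.End ℂ Fock :=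
  Finsupp.linearCombination ℂ fun S =>
    if i ∈ S.1 then 0 else wedgeSign i S • ket (S.insert i)

open Classical in
/-- `ψ*_i`: interior multiplication by the dual basis vector `ẽ^i`. -/
def psiStar (i : ℤ) : Module.End ℂ Fock :=
  Finsupp.linearCombination ℂ fun S =>
    if i ∈ S.1 then wedgeSign i S • ket (S.erase i) else 0

/-- The normal ordered product `:ψ_i ψ*_j:`. -/
def normalOrd (i j : ℤ) : Module.End ℂ Fock :=
  if 0 ≤ j then psi i * psiStar j else -(psiStar j * psi i)

/-- The current components `J_k = ∑_j :ψ_j ψ*_{j+k}:`; only finitely many summands are nonzero on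
a given basis state. -/
def current (k : ℤ) : Module.End ℂ Fock :=
  Finsupp.linearCombination ℂ fun S => ∑ᶠ j : ℤ, normalOrd j (j + k) (ket S)

/-- `∑_{k ≥ 1} t_k J_k`; only finitely many summands are nonzero on a given basis state. -/
def flowGen (t : ℕ+ → ℂ) : Module.End ℂ Fock :=
  Finsupp.linearCombination ℂ fun S => ∑ᶠ k : ℕ+, t k • current (k : ℤ) (ket S)

/-- `γ̂₊(t) = exp (∑_{k ≥ 1} t_k J_k)`.  The exponent lowers the energy, so that the exponential
series has finitely many nonzero terms on a given basis state. -/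
def gammaPlus (t : ℕ+ → ℂ) : Module.End ℂ Fock :=
  Finsupp.linearCombination ℂ fun S => ∑ᶠ m : ℕ, ((m ! : ℂ)⁻¹) • (flowGen t ^ m) (ket S)

/-- The extension to the completed Fock space of an operator whose matrix has finitely many
nonzero entries in each row. -/
def hat (X : Module.End ℂ Fock) (v : FockHat) : FockHat :=
  fun T => ∑ᶠ S : Maya, X (ket S) T * v S

/-- The operator `∑_{i,j} A_{ij} :ψ_i ψ*_j:` on the completed Fock space.  For lower triangular
`A` (that is, `A_{ij} = 0` for `i < j`) each coefficient is a finite sum. -/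
def cliffordGen (A : ℤ → ℤ → ℂ) (v : FockHat) : FockHat :=
  fun T => ∑ᶠ p : ℤ × ℤ, A p.1 p.2 * hat (normalOrd p.1 p.2) v T

/-- The Clifford representation `ĝ = exp (∑_{i,j} A_{ij} :ψ_i ψ*_j:)` of the group element
`g = e^A`, as a map from the Fock space to its completion; the exponential series is summed
coefficient by coefficient. -/
def cliffordExp (A : ℤ → ℤ → ℂ) : Fock →ₗ[ℂ] FockHat :=
  Finsupp.linearCombination ℂ fun S : Maya => (fun T : Maya =>
    ∑' m : ℕ, ((m ! : ℂ)⁻¹) * ((cliffordGen A)^[m] (ket S : Maya → ℂ)) T : FockHat)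

/-- Group-like elements: `[∑_i ψ_i ⊗ ψ*_i, ĝ ⊗ ĝ] = 0`, written out in matrix elements between
basis states; all the sums are finite. -/
def IsGroupLike (g : Fock →ₗ[ℂ] FockHat) : Prop :=
  ∀ S₁ S₂ T₁ T₂ : Maya,
    ∑ᶠ i : ℤ, hat (psi i) (g (ket S₁)) T₁ * hat (psiStar i) (g (ket S₂)) T₂ =
      ∑ᶠ i : ℤ, g (psi i (ket S₁)) T₁ * g (psiStar i (ket S₂)) T₂

/-- The terms of `⟨0| γ̂₊(t) ĝ |0⟩ = ∑_S ⟨0| γ̂₊(t) |S⟩ ⟨S| ĝ |0⟩`. -/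
def tauTerm (g : Fock →ₗ[ℂ] FockHat) (t : ℕ+ → ℂ) (S : Maya) : ℂ :=
  bra0 (gammaPlus t (ket S)) * g (ket vac) S

/-- `τ_g(t) = ⟨0| γ̂₊(t) ĝ |0⟩`. -/
def tau (g : Fock →ₗ[ℂ] FockHat) (t : ℕ+ → ℂ) : ℂ := ∑' S : Maya, tauTerm g t S

/-- `ξ(t, z) = ∑_{k ≥ 1} t_k z^k`. -/
def xi (t : ℕ+ → ℂ) (z : ℂ) : ℂ := ∑' k : ℕ+, t k * z ^ (k : ℕ)

/-- `[𝐳⁻¹]_k = (1/k) ∑_j z_j^{-k}`. -/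
def invPowerSums {n : ℕ} (z : Fin n → ℂ) : ℕ+ → ℂ :=
  fun k => (1 / (k : ℂ)) * ∑ j, 1 / (z j) ^ (k : ℕ)

/-! The `2n` factors of `∏_{i=1}^n ψ(z_i) ψ*(w_i)` are numbered from left to right by
`a : Fin (n * 2)`; number `a = 2i` is `ψ(z_i)`, number `a = 2i + 1` is `ψ*(w_i)`. -/

/-- The argument of the factor number `a`. -/
def fieldArg {n : ℕ} (z w : Fin n → ℂ) (a : Fin (n * 2)) : ℂ :=
  if a.modNat = 0 then z a.divNat else w a.divNat

/-- The operator in the `k`-th mode of the factor number `a`. -/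
def fieldMode {n : ℕ} (a : Fin (n * 2)) (k : ℤ) : Module.End ℂ Fock :=
  if a.modNat = 0 then psi k else psiStar k

/-- The scalar coefficient of the `k`-th mode of the factor number `a`:
`ψ(z) = ∑_k ψ_k z^k`, `ψ*(w) = ∑_k ψ*_k w^{-k-1}`. -/
def fieldCoeff {n : ℕ} (z w : Fin n → ℂ) (a : Fin (n * 2)) (k : ℤ) : ℂ :=
  if a.modNat = 0 then z a.divNat ^ k else w a.divNat ^ (-k - 1)

/-- The terms (indexed by the modes `k`) of the multiple series
`sgn(σ) ⟨ℓ| φ_{σ(1)} φ_{σ(2)} ⋯ φ_{σ(2n)} |S⟩`, where `φ_1 ⋯ φ_{2n} = ∏_i ψ(z_i) ψ*(w_i)`. -/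
def productTerm {n : ℕ} (l : Module.Dual ℂ Fock) (z w : Fin n → ℂ)
    (σ : Equiv.Perm (Fin (n * 2))) (S : Maya) (k : Fin (n * 2) → ℤ) : ℂ :=
  ((Equiv.Perm.sign σ : ℤ) : ℂ) * (∏ a, fieldCoeff z w a (k a)) *
    l ((List.ofFn fun p => fieldMode (σ p) (k (σ p))).prod (ket S))

/-- The order `φ_{σ(1)} ⋯ φ_{σ(2n)}` is radial: whenever a `ψ` and a `ψ*` occur, the one
with the argument of larger modulus stands to the left.  (Two `ψ`s, and two `ψ*`s, anticommute, so
their relative order does not matter.)  For `σ = 1` this says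
`|z_1| > |w_1| > |z_2| > |w_2| > ⋯ > |w_n|`. -/
def IsRadial {n : ℕ} (z w : Fin n → ℂ) (σ : Equiv.Perm (Fin (n * 2))) : Prop :=
  ∀ p q, p < q → (σ p).modNat ≠ (σ q).modNat → ‖fieldArg z w (σ q)‖ < ‖fieldArg z w (σ p)‖

/-- A permutation sorting the `2n` factors by decreasing modulus. -/
def radialPerm {n : ℕ} (z w : Fin n → ℂ) : Equiv.Perm (Fin (n * 2)) :=
  Tuple.sort fun a => -‖fieldArg z w a‖

/-- The configurations in which every `|z_i|` differs from every `|w_j|`. -/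
def radialDomain (n : ℕ) : Set ((Fin n → ℂ) × (Fin n → ℂ)) :=
  {x | ∀ i j, ‖x.1 i‖ ≠ ‖x.2 j‖}

/-- The matrix element `⟨ℓ| ∏_i ψ(z_i) ψ*(w_i) |S⟩` of the radially ordered product, for
`(z, w)` in `radialDomain n`. -/
def radialProduct {n : ℕ} (l : Module.Dual ℂ Fock) (S : Maya)
    (x : (Fin n → ℂ) × (Fin n → ℂ)) : ℂ :=
  ∑' k, productTerm l x.1 x.2 (radialPerm x.1 x.2) S k

/-- The matrix element `⟨ℓ| ∏_i ψ(z_i) ψ*(w_i) |S⟩` for all `z, w`: the radially ordered product,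
extended by continuity to configurations in which some `|z_i| = |w_j|`. -/
def pairCovector {n : ℕ} (l : Module.Dual ℂ Fock) (z w : Fin n → ℂ) (S : Maya) : ℂ :=
  extendFrom (radialDomain n) (radialProduct l S) (z, w)

/-- `⟨ℓ| ∏_i ψ(z_i) ψ*(w_i)` is well defined at `(z, w)`: the limit in the definition of
`pairCovector` exists, and for every radial order of the factors the multiple series
converges (absolutely) to it. -/
def PairCovectorConverges {n : ℕ} (l : Module.Dual ℂ Fock) (z w : Fin n → ℂ) : Prop :=
  ∀ S : Maya,
    Tendsto (radialProduct l S) (𝓝[radialDomain n] (z, w)) (𝓝 (pairCovector l z w S)) ∧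
    ∀ σ, IsRadial z w σ → HasSum (productTerm l z w σ S) (pairCovector l z w S)

/-- The covector `⟨0| γ̂₊(t)`. -/
def flowBra (t : ℕ+ → ℂ) : Module.Dual ℂ Fock := bra0 ∘ₗ gammaPlus t

/-- The terms of `⟨0| γ̂₊(t) ∏_i (ψ(z_i) ψ*(w_i)) ĝ |0⟩` as a sum over basis states `|S⟩`. -/
def correlatorTerm {n : ℕ} (g : Fock →ₗ[ℂ] FockHat) (t : ℕ+ → ℂ) (z w : Fin n → ℂ)
    (S : Maya) : ℂ :=
  pairCovector (flowBra t) z w S * g (ket vac) S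

/-- The time dependent `n`-pair correlator
`K̃_{2n}^g(z, w, t) = ⟨0| γ̂₊(t) ∏_i (ψ(z_i) ψ*(w_i)) ĝ |0⟩`. -/
def correlator {n : ℕ} (g : Fock →ₗ[ℂ] FockHat) (t : ℕ+ → ℂ) (z w : Fin n → ℂ) : ℂ :=
  ∑' S : Maya, correlatorTerm g t z w S

/-- `ξ(t, ·)` converges absolutely on a disc whose interior contains all the `z_i` and `w_i`. -/
def FlowConverges {n : ℕ} (t : ℕ+ → ℂ) (z w : Fin n → ℂ) : Prop :=
  ∃ r : ℝ, (∀ i, ‖z i‖ < r ∧ ‖w i‖ < r) ∧ Summable fun k : ℕ+ => ‖t k‖ * r ^ (k : ℕ)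

/-- The matrix `(1 / (z_i - w_j))_{i,j}`. -/
def cauchyMatrix {n : ℕ} (z w : Fin n → ℂ) : Matrix (Fin n) (Fin n) ℂ :=
  Matrix.of fun i j => 1 / (z i - w j)

end

end FermionicFock

open FermionicFock

/-!
The proof separates what the flow operator `γ̂₊(t)` does to a single field from what the vacuum
covectors do.

* *Conjugation by the flow.*  Since `[J_k, φ_m] = ± φ_{m-k}` for a mode `φ_m` of `ψ` or `ψ*`,
  moving `γ̂₊(t)` past a field multiplies the generating function of its modes by
  `exp (± ξ(t, x))`, that is, replaces a mode by its combination with the coefficients of the power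
  series `hSeries` (`gammaPlus_field`).
* *Bosonization of one field.*  The covector `⟨N| φ(x)` is a monomial in `x` times
  `⟨N ∓ 1| γ̂₊(∓[x⁻¹])` (`hasSum_bra_field`): both covectors vanish on the same creation modes and
  agree on the vacuum, and such a covector is unique (`dual_eq_zero`).
* *Products of fields.*  Iterating, a product of fields between a vacuum covector and a vector is a
  product of the contractions `(x_p - x_q)^{± 1}` times a flow operator (`hasSum_fieldProd`).  At
  each step the fields to the right are moved through a flow operator inside an absolutely convergent
  multiple series; the geometric series met there converge by radial ordering.  For `n` pairs the
  contractions form the product side of Cauchy's determinant (`orderedFactor_pairs`,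
  `det_cauchyMatrix`), a function continuous in the arguments.  This gives the covectors of the
  theorem, and with them the correlator in terms of the tau-function.
* *The determinant formula.*  For group-like `ĝ` the vector `ĝ|0⟩ ⊗ ĝ|0⟩` is annihilated by
  `∑ ψ_i ⊗ ψ*_i` (`IsGroupLike.plucker`).  Between `⟨1|γ̂₊(t₁)` and `⟨-1|γ̂₊(t₂)` this operator is
  governed by the coefficients of `hSeries (t₁ - t₂)`; if that series is a rational function, its
  partial fractions turn the operator into a combination of products of two tau-functions with
  shifted times (`finsum_bra_psi_mul_bra_psiStar`, `IsGroupLike.fay`).  With the minors of the Cauchy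
  determinant as coefficients this is the expansion of the determinant along the first row.  The
  double sums over basis states need not converge, so all these identities are proved between power
  series graded by the energy, where every coefficient is a finite sum (`tauSeries`), and are
  evaluated only at the end, where the absolute convergence of the tau-functions suffices.
* *Lower triangular matrices.*  Given finitely many basis states, only finitely many sites are not
  frozen, and for a lower triangular `A` the rows of the generator stay inside the finite block of
  states which agree on the frozen sites.  There `ĝ` is a matrix exponential `e^G`, and
  `G ⊗ 1 + 1 ⊗ G` commutes with `∑ ψ_i ⊗ ψ*_i`, hence so does `e^G ⊗ e^G`
  (`isGroupLike_cliffordExp`).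
-/

namespace FermionicFock

noncomputable section

/-! ### Basis states, Clifford relations and energy -/

theorem Maya.ext_mem {S T : Maya} (h : ∀ k, k ∈ S.1 ↔ k ∈ T.1) : S = T :=
  Subtype.ext (Set.ext h)

@[simp] theorem Maya.mem_insert_iff {S : Maya} {i k : ℤ} :
    k ∈ (S.insert i).1 ↔ k = i ∨ k ∈ S.1 := Iff.rfl

@[simp] theorem Maya.mem_erase_iff {S : Maya} {i k : ℤ} :
    k ∈ (S.erase i).1 ↔ k ∈ S.1 ∧ k ≠ i := Iff.rfl

theorem Maya.erase_insert {S : Maya} {i : ℤ} (h : i ∉ S.1) : (S.insert i).erase i = S :=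
  Maya.ext_mem fun k => by
    simp only [mem_erase_iff, mem_insert_iff]
    constructor
    · rintro ⟨h1 | h1, h2⟩
      · exact absurd h1 h2
      · exact h1
    · exact fun h1 => ⟨Or.inr h1, fun h2 => h (h2 ▸ h1)⟩

theorem Maya.insert_erase {S : Maya} {i : ℤ} (h : i ∈ S.1) : (S.erase i).insert i = S :=
  Maya.ext_mem fun k => by
    simp only [mem_erase_iff, mem_insert_iff]
    constructor
    · rintro (h1 | h1)
      · exact h1 ▸ h
      · exact h1.1
    · intro h1
      by_cases h2 : k = i
      · exact Or.inl h2
      · exact Or.inr ⟨h1, h2⟩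

theorem Maya.insert_comm (S : Maya) (i j : ℤ) : (S.insert i).insert j = (S.insert j).insert i :=
  Maya.ext_mem fun k => by simp only [mem_insert_iff]; tauto

theorem Maya.erase_comm (S : Maya) (i j : ℤ) : (S.erase i).erase j = (S.erase j).erase i :=
  Maya.ext_mem fun k => by simp only [mem_erase_iff]; tauto

theorem Maya.insert_erase_comm (S : Maya) {i j : ℤ} (h : i ≠ j) :
    (S.insert i).erase j = (S.erase j).insert i :=
  Maya.ext_mem fun k => by
    simp only [mem_erase_iff, mem_insert_iff]
    constructor
    · tauto
    · rintro (rfl | h1)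
      · exact ⟨Or.inl rfl, h⟩
      · tauto

theorem Maya.finite_above (S : Maya) (i : ℤ) : {k | k ∈ S.1 ∧ i < k}.Finite := by
  refine (S.2.1.union (Set.finite_Ioo i 0)).subset ?_
  rintro k ⟨hk, h⟩
  by_cases h0 : 0 ≤ k
  · exact Or.inl ⟨hk, h0⟩
  · exact Or.inr ⟨h, not_le.1 h0⟩

theorem wedgeSign_mul_self (i : ℤ) (S : Maya) : wedgeSign i S * wedgeSign i S = 1 := by
  rw [wedgeSign, ← mul_pow]; simp

theorem wedgeSign_ne_zero (i : ℤ) (S : Maya) : wedgeSign i S ≠ 0 := by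
  simp [wedgeSign]

theorem wedgeSign_insert {i j : ℤ} {S : Maya} (hj : j ∉ S.1) :
    wedgeSign i (S.insert j) = if i < j then -wedgeSign i S else wedgeSign i S := by
  unfold wedgeSign
  split_ifs with h
  · have : {k | k ∈ (S.insert j).1 ∧ i < k} = Insert.insert j {k | k ∈ S.1 ∧ i < k} := by
      ext k
      simp only [Maya.mem_insert_iff, Set.mem_ofPred_eq, Set.mem_insert_iff]
      constructor
      · tauto
      · rintro (rfl | h1)
        · exact ⟨Or.inl rfl, h⟩
        · tauto
    rw [this, Set.ncard_insert_of_notMem (fun h => hj h.1) (S.finite_above i), pow_succ]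
    ring
  · congr 2
    ext k
    simp only [Maya.mem_insert_iff, Set.mem_ofPred_eq]
    constructor
    · rintro ⟨rfl | h1, h2⟩
      · exact absurd h2 h
      · exact ⟨h1, h2⟩
    · tauto

theorem wedgeSign_insert_self (i : ℤ) (S : Maya) : wedgeSign i (S.insert i) = wedgeSign i S := by
  unfold wedgeSign
  congr 2
  ext k
  simp only [Maya.mem_insert_iff, Set.mem_ofPred_eq]
  constructor
  · rintro ⟨rfl | h1, h2⟩
    · exact absurd h2 (lt_irrefl _)
    · exact ⟨h1, h2⟩
  · tauto

theorem wedgeSign_erase {i j : ℤ} {S : Maya} (hj : j ∈ S.1) :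
    wedgeSign i (S.erase j) = if i < j then -wedgeSign i S else wedgeSign i S := by
  have h := wedgeSign_insert (i := i) (j := j) (S := S.erase j) (fun h => h.2 rfl)
  rw [Maya.insert_erase hj] at h
  rw [h]
  split_ifs <;> simp

theorem wedgeSign_erase_self (i : ℤ) (S : Maya) : wedgeSign i (S.erase i) = wedgeSign i S := by
  unfold wedgeSign
  congr 2
  ext k
  simp only [Maya.mem_erase_iff, Set.mem_ofPred_eq]
  constructor
  · tauto
  · rintro ⟨h1, h2⟩
    exact ⟨⟨h1, h2.ne'⟩, h2⟩

theorem psi_ket_of_mem {i : ℤ} {S : Maya} (h : i ∈ S.1) : psi i (ket S) = 0 := by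
  simp [psi, ket, h]

theorem psi_ket_of_notMem {i : ℤ} {S : Maya} (h : i ∉ S.1) :
    psi i (ket S) = wedgeSign i S • ket (S.insert i) := by
  simp [psi, ket, h]

theorem psiStar_ket_of_mem {i : ℤ} {S : Maya} (h : i ∈ S.1) :
    psiStar i (ket S) = wedgeSign i S • ket (S.erase i) := by
  simp [psiStar, ket, h]

theorem psiStar_ket_of_notMem {i : ℤ} {S : Maya} (h : i ∉ S.1) : psiStar i (ket S) = 0 := by
  simp [psiStar, ket, h]

theorem ket_ext {M : Type*} [AddCommMonoid M] [Module ℂ M] {X Y : Fock →ₗ[ℂ] M}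
    (h : ∀ S, X (ket S) = Y (ket S)) : X = Y :=
  Finsupp.lhom_ext' fun S => LinearMap.ext_ring (h S)

theorem single_eq_smul_ket (S : Maya) (a : ℂ) : (Finsupp.single S a : Fock) = a • ket S := by
  simp [ket]

theorem Fock.induction {p : Fock → Prop} (h0 : p 0) (hadd : ∀ u v, p u → p v → p (u + v))
    (hket : ∀ (a : ℂ) S, p (a • ket S)) (v : Fock) : p v :=
  Finsupp.induction_linear v h0 (fun u v => hadd u v)
    fun S a => by rw [single_eq_smul_ket]; exact hket a S

theorem psi_anticomm (i j : ℤ) : psi i * psi j + psi j * psi i = 0 := by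
  refine ket_ext fun S => ?_
  simp only [LinearMap.add_apply, Module.End.mul_apply, LinearMap.zero_apply]
  by_cases hi : i ∈ S.1
  · rw [psi_ket_of_mem hi, map_zero, add_zero]
    by_cases hj : j ∈ S.1
    · rw [psi_ket_of_mem hj, map_zero]
    · rw [psi_ket_of_notMem hj, map_smul, psi_ket_of_mem (by simp [hi]), smul_zero]
  by_cases hj : j ∈ S.1
  · rw [psi_ket_of_mem hj, psi_ket_of_notMem hi, map_smul, psi_ket_of_mem (by simp [hj])]
    simp
  rw [psi_ket_of_notMem hj, psi_ket_of_notMem hi, map_smul, map_smul]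
  by_cases hij : i = j
  · subst hij
    rw [psi_ket_of_mem (by simp)]; simp
  rw [psi_ket_of_notMem (by simp [hi, hij]), psi_ket_of_notMem (by simp [hj, Ne.symm hij]),
    S.insert_comm i j, wedgeSign_insert hi, wedgeSign_insert hj, smul_smul, smul_smul, ← add_smul]
  rcases lt_or_gt_of_ne hij with h | h
  · rw [if_pos h, if_neg h.not_gt]; simp [mul_comm]
  · rw [if_neg h.not_gt, if_pos h]; simp [mul_comm]

theorem psiStar_anticomm (i j : ℤ) : psiStar i * psiStar j + psiStar j * psiStar i = 0 := by
  refine ket_ext fun S => ?_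
  simp only [LinearMap.add_apply, Module.End.mul_apply, LinearMap.zero_apply]
  by_cases hi : i ∈ S.1
  swap
  · rw [psiStar_ket_of_notMem hi, map_zero, add_zero]
    by_cases hj : j ∈ S.1
    · rw [psiStar_ket_of_mem hj, map_smul, psiStar_ket_of_notMem (by simp [hi]), smul_zero]
    · rw [psiStar_ket_of_notMem hj, map_zero]
  by_cases hj : j ∈ S.1
  swap
  · rw [psiStar_ket_of_notMem hj, psiStar_ket_of_mem hi, map_smul,
      psiStar_ket_of_notMem (by simp [hj])]
    simp
  rw [psiStar_ket_of_mem hj, psiStar_ket_of_mem hi, map_smul, map_smul]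
  by_cases hij : i = j
  · subst hij
    rw [psiStar_ket_of_notMem (by simp)]; simp
  rw [psiStar_ket_of_mem (by simp [hi, hij]), psiStar_ket_of_mem (by simp [hj, Ne.symm hij]),
    S.erase_comm i j, wedgeSign_erase hi, wedgeSign_erase hj, smul_smul, smul_smul, ← add_smul]
  rcases lt_or_gt_of_ne hij with h | h
  · rw [if_pos h, if_neg h.not_gt]; simp [mul_comm]
  · rw [if_neg h.not_gt, if_pos h]; simp [mul_comm]

theorem psi_psiStar_anticomm (i j : ℤ) :
    psi i * psiStar j + psiStar j * psi i = if i = j then 1 else 0 := by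
  refine ket_ext fun S => ?_
  simp only [LinearMap.add_apply, Module.End.mul_apply]
  by_cases hij : i = j
  · subst hij
    rw [if_pos rfl, Module.End.one_apply]
    by_cases hi : i ∈ S.1
    · rw [psi_ket_of_mem hi, psiStar_ket_of_mem hi, map_smul, psi_ket_of_notMem (by simp),
        Maya.insert_erase hi, wedgeSign_erase_self, smul_smul, wedgeSign_mul_self]
      simp
    · rw [psi_ket_of_notMem hi, psiStar_ket_of_notMem hi, map_smul, psiStar_ket_of_mem (by simp),
        Maya.erase_insert hi, wedgeSign_insert_self, smul_smul, wedgeSign_mul_self]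
      simp
  rw [if_neg hij, LinearMap.zero_apply]
  by_cases hi : i ∈ S.1
  · rw [psi_ket_of_mem hi, map_zero, add_zero]
    by_cases hj : j ∈ S.1
    · rw [psiStar_ket_of_mem hj, map_smul, psi_ket_of_mem (by simp [hi, hij]), smul_zero]
    · rw [psiStar_ket_of_notMem hj, map_zero]
  by_cases hj : j ∈ S.1
  swap
  · rw [psiStar_ket_of_notMem hj, psi_ket_of_notMem hi, map_smul,
      psiStar_ket_of_notMem (by simp [hj, Ne.symm hij])]
    simp
  rw [psiStar_ket_of_mem hj, psi_ket_of_notMem hi, map_smul, map_smul,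
    psiStar_ket_of_mem (by simp [hj]), psi_ket_of_notMem (by simp [hi]),
    S.insert_erase_comm hij, wedgeSign_insert hi, wedgeSign_erase hj, smul_smul, smul_smul,
    ← add_smul]
  rcases lt_or_gt_of_ne hij with h | h
  · rw [if_pos h, if_neg h.not_gt]; simp [mul_comm]
  · rw [if_neg h.not_gt, if_pos h]; simp [mul_comm]

/-- The modes of both fields, indexed so that `ψ(x) = ∑_m field false m x^m` and
`ψ*(x) = ∑_m field true m x^m`. -/
def field (b : Bool) (m : ℤ) : Module.End ℂ Fock := if b then psiStar (-m - 1) else psi m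

/-- The charge of a field: `1` for `ψ` and `-1` for `ψ*`. -/
def eps (b : Bool) : ℤ := if b then -1 else 1

theorem eps_mul_self (b : Bool) : eps b * eps b = 1 := by cases b <;> rfl

theorem eps_not (b : Bool) : eps (!b) = -eps b := by cases b <;> rfl

theorem field_anticomm (b c : Bool) (m n : ℤ) :
    field b m * field c n + field c n * field b m = if b ≠ c ∧ m + n = -1 then 1 else 0 := by
  rcases b with _ | _ <;> rcases c with _ | _
  · simpa [field] using psi_anticomm m n
  · have h := psi_psiStar_anticomm m (-n - 1)
    simp only [field, if_true, Bool.false_eq_true, if_false]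
    rw [h]
    exact if_congr (by simp; omega) rfl rfl
  · have h := psi_psiStar_anticomm n (-m - 1)
    simp only [field, if_true, Bool.false_eq_true, if_false]
    rw [add_comm, h]
    exact if_congr (by simp; omega) rfl rfl
  · simpa [field] using psiStar_anticomm (-m - 1) (-n - 1)

theorem field_field (b c : Bool) (m n : ℤ) (v : Fock) :
    field b m (field c n v) = (if b ≠ c ∧ m + n = -1 then v else 0) - field c n (field b m v) := by
  have h := LinearMap.congr_fun (field_anticomm b c m n) v
  rw [LinearMap.add_apply, Module.End.mul_apply, Module.End.mul_apply] at h
  rw [eq_sub_iff_add_eq, h]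
  split_ifs <;> simp

open Classical in
/-- The summand of the site `i` in the energy of a state. -/
def energyTerm (S : Maya) (i : ℤ) : ℤ :=
  if i < 0 then (if i ∈ S.1 then 0 else -i) else (if i ∈ S.1 then i else 0)

/-- The energy of a basis state: the sum of the positions of the particles `≥ 0` minus the sum of
the positions of the holes `< 0`.  A mode `psi m` raises it by `m`. -/
def energy (S : Maya) : ℤ := ∑ᶠ i, energyTerm S i

theorem energyTerm_nonneg (S : Maya) (i : ℤ) : 0 ≤ energyTerm S i := by
  unfold energyTerm; split_ifs <;> omega

theorem energyTerm_support (S : Maya) : (Function.support (energyTerm S)).Finite := by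
  refine (S.2.1.union S.2.2).subset fun i hi => ?_
  simp only [Function.mem_support, energyTerm] at hi
  split_ifs at hi with h1 h2 h2
  · exact absurd rfl hi
  · exact Or.inr ⟨h2, h1⟩
  · exact Or.inl ⟨h2, not_lt.1 h1⟩
  · exact absurd rfl hi

theorem energy_nonneg (S : Maya) : 0 ≤ energy S := finsum_nonneg (energyTerm_nonneg S)

theorem energyTerm_le (S : Maya) (i : ℤ) : energyTerm S i ≤ energy S :=
  single_le_finsum i (energyTerm_support S) (energyTerm_nonneg S)

theorem energy_insert {S : Maya} {i : ℤ} (h : i ∉ S.1) : energy (S.insert i) = energy S + i := by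
  have hs : energyTerm (S.insert i) = fun k => energyTerm S k + (Pi.single i i : ℤ → ℤ) k := by
    funext k
    by_cases hk : k = i
    · subst hk
      simp only [energyTerm, Maya.mem_insert_iff, true_or, if_true, h, if_false, Pi.single_eq_same]
      split_ifs <;> omega
    · have e : k ∈ (S.insert i).1 ↔ k ∈ S.1 := by simp [hk]
      rw [Pi.single_eq_of_ne hk, add_zero]
      unfold energyTerm
      by_cases hS : k ∈ S.1
      · rw [if_pos hS, if_pos hS, if_pos (e.2 hS), if_pos (e.2 hS)]
      · rw [if_neg hS, if_neg hS, if_neg (mt e.1 hS), if_neg (mt e.1 hS)]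
  have h2 : (Function.support (Pi.single i i : ℤ → ℤ)).Finite :=
    (Set.finite_singleton i).subset (Pi.support_single_subset)
  rw [energy, hs, finsum_add_distrib (energyTerm_support S) h2, energy]
  congr 1
  rw [finsum_eq_single _ i (fun k hk => by simp [hk]), Pi.single_eq_same]

theorem energy_erase {S : Maya} {i : ℤ} (h : i ∈ S.1) : energy (S.erase i) = energy S - i := by
  have := energy_insert (S := S.erase i) (i := i) (fun h => h.2 rfl)
  rw [Maya.insert_erase h] at this
  omega

/-- States which agree outside a given interval form a finite set. -/
theorem finite_between (a b : ℤ) :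
    {S : Maya | (∀ i, i < a → i ∈ S.1) ∧ ∀ i, b ≤ i → i ∉ S.1}.Finite := by
  refine Set.Finite.of_injOn (f := fun S : Maya => S.1 ∩ Set.Ico a b)
    (t := {s | s ⊆ Set.Ico a b}) (fun S _ => Set.inter_subset_right) ?_
    (Set.finite_Ico a b).finite_subsets
  intro S hS T hT h
  refine Maya.ext_mem fun k => ?_
  by_cases h1 : k < a
  · exact ⟨fun _ => hT.1 k h1, fun _ => hS.1 k h1⟩
  by_cases h2 : b ≤ k
  · exact ⟨fun h => absurd h (hS.2 k h2), fun h => absurd h (hT.2 k h2)⟩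
  have h3 : k ∈ Set.Ico a b := ⟨not_lt.1 h1, not_le.1 h2⟩
  have h4 := Set.ext_iff.1 h k
  simpa [h3, -Set.mem_Ico] using h4

theorem finite_energy_le (e : ℤ) : {S : Maya | energy S ≤ e}.Finite := by
  rcases lt_or_ge e 0 with he | he
  · convert Set.finite_empty (α := Maya)
    ext S
    have := energy_nonneg S
    simp only [Set.mem_ofPred_eq, Set.mem_empty_iff_false, iff_false]
    omega
  refine (finite_between (-e) (e + 1)).subset fun S hS => ⟨fun i hi => ?_, fun i hi h => ?_⟩
  · by_contra h
    have := (energyTerm_le S i).trans hS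
    simp only [energyTerm, h, if_false] at this
    split_ifs at this <;> omega
  · have := (energyTerm_le S i).trans hS
    simp only [energyTerm, h, if_true] at this
    split_ifs at this <;> omega

/-- The shift of the energy by the field `b` relative to its mode number. -/
def fieldShift (b : Bool) : ℤ := if b then 1 else 0

/-- A mode maps a basis state to zero or to a multiple of a basis state of shifted energy. -/
theorem field_ket (b : Bool) (m : ℤ) (S : Maya) :
    field b m (ket S) = 0 ∨ ∃ (c : ℂ) (T : Maya), field b m (ket S) = c • ket T ∧
      energy T = energy S + m + fieldShift b := by
  rcases b with _ | _
  · by_cases h : m ∈ S.1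
    · exact Or.inl (by simp [field, psi_ket_of_mem h])
    · exact Or.inr ⟨_, _, by simpa [field] using psi_ket_of_notMem h,
        by simp [energy_insert h, fieldShift]⟩
  · by_cases h : -m - 1 ∈ S.1
    · exact Or.inr ⟨_, _, by simpa [field] using psiStar_ket_of_mem h,
        by rw [energy_erase h]; simp [fieldShift]; ring⟩
    · exact Or.inl (by simp [field, psiStar_ket_of_notMem h])

theorem field_ket_eq_zero {b : Bool} {m : ℤ} {S : Maya} (h : energy S + m + fieldShift b < 0) :
    field b m (ket S) = 0 := by
  rcases field_ket b m S with h0 | ⟨c, T, -, h2⟩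
  · exact h0
  · have := energy_nonneg T; omega

theorem field_eventually_zero (b : Bool) (v : Fock) : ∃ B : ℤ, ∀ m < B, field b m v = 0 := by
  refine Fock.induction (p := fun v => ∃ B : ℤ, ∀ m < B, field b m v = 0)
    ⟨0, fun m _ => map_zero _⟩ ?_ ?_ v
  · rintro u v ⟨B, hB⟩ ⟨C, hC⟩
    refine ⟨min B C, fun m hm => ?_⟩
    rw [map_add, hB m (hm.trans_le (min_le_left _ _)), hC m (hm.trans_le (min_le_right _ _)),
      add_zero]
  · intro a S
    refine ⟨-energy S - fieldShift b, fun m hm => ?_⟩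
    rw [map_smul, field_ket_eq_zero (by omega), smul_zero]

/-- The sea `{M - 1, M - 2, …}`, the vacuum of charge `M`. -/
def sea (M : ℤ) : Maya :=
  ⟨{i | i < M}, (Set.finite_Ico 0 M).subset fun _ h => ⟨h.2, h.1⟩,
    (Set.finite_Ico M 0).subset fun _ h => ⟨not_lt.1 h.1, h.2⟩⟩

@[simp] theorem mem_sea {M i : ℤ} : i ∈ (sea M).1 ↔ i < M := Iff.rfl

theorem sea_zero : sea 0 = vac := rfl

/-- The covector `⟨M|` of the vacuum of charge `M`. -/
def bra (M : ℤ) : Module.Dual ℂ Fock := Finsupp.lapply (sea M)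

theorem bra_zero : bra 0 = bra0 := rfl

theorem bra_ket_self (M : ℤ) : bra M (ket (sea M)) = 1 := by simp [bra, ket]

theorem bra_ket_of_ne {M : ℤ} {S : Maya} (h : S ≠ sea M) : bra M (ket S) = 0 := by
  simp [bra, ket, h]

theorem bra_field_ket_eq_zero (b : Bool) (M m : ℤ) (S : Maya)
    (h : field b m (ket S) ≠ 0 → (if b then S.erase (-m - 1) else S.insert m) ≠ sea M) :
    bra M (field b m (ket S)) = 0 := by
  by_cases h0 : field b m (ket S) = 0
  · rw [h0, map_zero]
  have h := h h0
  rcases b with _ | _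
  · by_cases hm : m ∈ S.1
    · simp [field, psi_ket_of_mem hm]
    · simp only [field, Bool.false_eq_true, if_false, psi_ket_of_notMem hm, map_smul] at h ⊢
      rw [bra_ket_of_ne h, smul_zero]
  · by_cases hm : -m - 1 ∈ S.1
    · simp only [field, if_true, psiStar_ket_of_mem hm, map_smul] at h ⊢
      rw [bra_ket_of_ne h, smul_zero]
    · simp [field, psiStar_ket_of_notMem hm]

theorem bra_field (b : Bool) {M m : ℤ} (h : eps b * M ≤ m) (v : Fock) :
    bra M (field b m v) = 0 := by
  have : bra M ∘ₗ field b m = 0 := ket_ext fun S => by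
    refine bra_field_ket_eq_zero b M m S fun h0 he => ?_
    rcases b with _ | _
    · have : m ∈ (sea M).1 := by rw [← he]; simp
      simp [eps] at h this
      omega
    · by_cases hm : -m - 1 ∈ S.1
      · have : -m - 1 ∉ (sea M).1 := by rw [← he]; simp
        simp [eps] at h this
        omega
      · exact h0 (by simp [field, psiStar_ket_of_notMem hm])
  exact LinearMap.congr_fun this v

/-- At most one mode of a field connects a given basis state to a vacuum. -/
theorem bra_field_ket_unique {b : Bool} {M m m' : ℤ} {S : Maya}
    (h : bra M (field b m (ket S)) ≠ 0) (h' : bra M (field b m' (ket S)) ≠ 0) : m = m' := by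
  rcases b with _ | _
  · simp only [field, Bool.false_eq_true, if_false] at h h'
    have hm : m ∉ S.1 := fun hm => h (by rw [psi_ket_of_mem hm, map_zero])
    have hm' : m' ∉ S.1 := fun hm => h' (by rw [psi_ket_of_mem hm, map_zero])
    rw [psi_ket_of_notMem hm, map_smul] at h
    rw [psi_ket_of_notMem hm', map_smul] at h'
    have e : S.insert m = sea M := by
      by_contra e; exact h (by rw [bra_ket_of_ne e, smul_zero])
    have e' : S.insert m' = sea M := by
      by_contra e; exact h' (by rw [bra_ket_of_ne e, smul_zero])
    have : m ∈ (S.insert m').1 := by rw [e', ← e]; simp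
    simpa [hm] using this
  · simp only [field, if_true] at h h'
    have hm : -m - 1 ∈ S.1 := by
      by_contra hm; exact h (by rw [psiStar_ket_of_notMem hm, map_zero])
    have hm' : -m' - 1 ∈ S.1 := by
      by_contra hm; exact h' (by rw [psiStar_ket_of_notMem hm, map_zero])
    rw [psiStar_ket_of_mem hm, map_smul] at h
    rw [psiStar_ket_of_mem hm', map_smul] at h'
    have e : S.erase (-m - 1) = sea M := by
      by_contra e; exact h (by rw [bra_ket_of_ne e, smul_zero])
    have e' : S.erase (-m' - 1) = sea M := by
      by_contra e; exact h' (by rw [bra_ket_of_ne e, smul_zero])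
    have : -m - 1 ∉ (S.erase (-m' - 1)).1 := by rw [e', ← e]; simp
    simp only [Maya.mem_erase_iff, not_and, not_not] at this
    have := this hm
    omega

/-- The mode creating the outermost particle of a vacuum. -/
theorem bra_field_sea (b : Bool) (N : ℤ) :
    bra N (field b (eps b * N - 1) (ket (sea (N - eps b)))) = 1 := by
  rcases b with _ | _
  · simp only [field, eps, Bool.false_eq_true, if_false]
    rw [psi_ket_of_notMem (by simp), map_smul]
    have : (sea (N - 1)).insert (1 * N - 1) = sea N :=
      Maya.ext_mem fun k => by simp; omega
    rw [this, bra_ket_self, wedgeSign]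
    have : {k | k ∈ (sea (N - 1)).1 ∧ 1 * N - 1 < k} = ∅ := by
      ext k
      simp only [mem_sea, Set.mem_ofPred_eq, Set.mem_empty_iff_false, iff_false]
      omega
    rw [this]; simp
  · simp only [field, eps, if_true]
    rw [psiStar_ket_of_mem (by simp), map_smul]
    have : (sea (N - -1)).erase (-(-1 * N - 1) - 1) = sea N :=
      Maya.ext_mem fun k => by simp; omega
    rw [this, bra_ket_self, wedgeSign]
    have : {k | k ∈ (sea (N - -1)).1 ∧ -(-1 * N - 1) - 1 < k} = ∅ := by
      ext k
      simp only [mem_sea, Set.mem_ofPred_eq, Set.mem_empty_iff_false, iff_false]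
      omega
    rw [this]; simp

/-- Every basis state other than the vacuum of charge `M` is created by a mode which annihilates
the covector `⟨M|`. -/
theorem exists_field_of_ne_sea {M : ℤ} {S : Maya} (h : S ≠ sea M) :
    ∃ (b : Bool) (m : ℤ) (S' : Maya) (c : ℂ), eps b * M ≤ m ∧ ket S = c • field b m (ket S') ∧
      energy S = energy S' + m + fieldShift b := by
  by_cases h1 : ∃ i ∈ S.1, M ≤ i
  · obtain ⟨i, hi, hM⟩ := h1
    refine ⟨false, i, S.erase i, wedgeSign i (S.erase i), by simpa [eps] using hM, ?_, ?_⟩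
    · simp only [field, Bool.false_eq_true, if_false]
      rw [psi_ket_of_notMem (by simp), smul_smul, wedgeSign_mul_self, Maya.insert_erase hi, one_smul]
    · rw [energy_erase hi]; simp [fieldShift]
  · push Not at h1
    have h2 : ∃ i < M, i ∉ S.1 := by
      by_contra h2
      push Not at h2
      exact h (Maya.ext_mem fun k => ⟨h1 k, h2 k⟩)
    obtain ⟨i, hM, hi⟩ := h2
    refine ⟨true, -i - 1, S.insert i, wedgeSign i (S.insert i), by simp [eps]; omega, ?_, ?_⟩
    · simp only [field, if_true]
      rw [show -(-i - 1) - 1 = i by ring, psiStar_ket_of_mem (by simp), smul_smul,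
        wedgeSign_mul_self, Maya.erase_insert hi, one_smul]
    · rw [energy_insert hi]; simp only [fieldShift, if_true]; ring

/-! ### Evaluation of power series at `1` and exponentials of power series -/

/-- The power series `f` converges (absolutely) at `1`, with value `c`. -/
def EvalsTo (f : PowerSeries ℂ) (c : ℂ) : Prop :=
  HasSum (fun n => PowerSeries.coeff n f) c

theorem EvalsTo.mul {f g : PowerSeries ℂ} {a b : ℂ} (hf : EvalsTo f a)
    (hg : EvalsTo g b) : EvalsTo (f * g) (a * b) := by
  have hf' := hf.summable.norm
  have hg' := hg.summable.norm
  have h := tsum_mul_tsum_eq_tsum_sum_antidiagonal_of_summable_norm hf' hg'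
  rw [hf.tsum_eq, hg.tsum_eq] at h
  rw [EvalsTo, h]
  simp only [PowerSeries.coeff_mul]
  exact (summable_norm_sum_mul_antidiagonal_of_summable_norm hf' hg').of_norm.hasSum

theorem EvalsTo.one : EvalsTo 1 1 := by
  have := hasSum_single (f := fun n => PowerSeries.coeff n (1 : PowerSeries ℂ)) 0
    fun n hn => by simp [PowerSeries.coeff_one, hn]
  simpa [EvalsTo] using this

theorem EvalsTo.pow {f : PowerSeries ℂ} {a : ℂ} (hf : EvalsTo f a) (n : ℕ) :
    EvalsTo (f ^ n) (a ^ n) := by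
  induction n with
  | zero => simpa using EvalsTo.one
  | succ n ih => rw [pow_succ, pow_succ]; exact ih.mul hf

/-- The norm `∑ |f_n|` is submultiplicative; this is the case of powers. -/
theorem EvalsTo.tsum_norm_pow_le {f : PowerSeries ℂ} {a : ℂ} (hf : EvalsTo f a) (n : ℕ) :
    ∑' k, ‖PowerSeries.coeff k (f ^ n)‖ ≤ (∑' k, ‖PowerSeries.coeff k f‖) ^ n := by
  induction n with
  | zero =>
    have := hasSum_single (f := fun n => ‖PowerSeries.coeff n (1 : PowerSeries ℂ)‖) 0
      fun n hn => by simp [PowerSeries.coeff_one, hn]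
    rw [pow_zero, pow_zero, this.tsum_eq]
    simp
  | succ n ih =>
    have h1 := (hf.pow n).summable.norm
    have h2 := hf.summable.norm
    have h3 := (hf.pow (n + 1)).summable.norm
    have h1' : Summable fun k => ‖‖PowerSeries.coeff k (f ^ n)‖‖ := by simpa using h1
    have h2' : Summable fun k => ‖‖PowerSeries.coeff k f‖‖ := by simpa using h2
    have h4 := (summable_norm_sum_mul_antidiagonal_of_summable_norm h1' h2').of_norm
    calc ∑' k, ‖PowerSeries.coeff k (f ^ (n + 1))‖
        ≤ ∑' k, ∑ kl ∈ Finset.HasAntidiagonal.antidiagonal k,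
            ‖PowerSeries.coeff kl.1 (f ^ n)‖ * ‖PowerSeries.coeff kl.2 f‖ := by
          refine h3.tsum_le_tsum (fun k => ?_) h4
          rw [pow_succ, PowerSeries.coeff_mul]
          refine (norm_sum_le _ _).trans (Finset.sum_le_sum fun q _ => (norm_mul _ _).le)
      _ = (∑' k, ‖PowerSeries.coeff k (f ^ n)‖) * ∑' k, ‖PowerSeries.coeff k f‖ :=
          (tsum_mul_tsum_eq_tsum_sum_antidiagonal_of_summable_norm h1' h2').symm
      _ ≤ _ := by
          rw [pow_succ]
          exact mul_le_mul_of_nonneg_right ih (tsum_nonneg fun _ => norm_nonneg _)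

/-- The exponential of a power series without constant term. -/
def expSubst (f : PowerSeries ℂ) : PowerSeries ℂ := (PowerSeries.exp ℂ).subst f

theorem coeff_pow_eq_zero {K : Type*} [Field K] {f : PowerSeries K}
    (hf : PowerSeries.constantCoeff f = 0) {n p : ℕ} (h : n < p) :
    PowerSeries.coeff n (f ^ p) = 0 := by
  have : (PowerSeries.X ^ p : PowerSeries K) ∣ f ^ p :=
    pow_dvd_pow_of_dvd (PowerSeries.X_dvd_iff.2 hf) p
  exact PowerSeries.X_pow_dvd_iff.1 this n h

theorem coeff_expSubst {f : PowerSeries ℂ} (hf : PowerSeries.constantCoeff f = 0) {n N : ℕ}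
    (h : n < N) : PowerSeries.coeff n (expSubst f) =
      ∑ p ∈ Finset.range N, ((p ! : ℂ)⁻¹) * PowerSeries.coeff n (f ^ p) := by
  rw [expSubst, PowerSeries.coeff_subst' (.of_constantCoeff_zero' hf),
    finsum_eq_sum_of_support_subset (s := Finset.range N)]
  · exact Finset.sum_congr rfl fun p _ => by simp [PowerSeries.coeff_exp]
  · intro p hp
    simp only [Finset.coe_range, Set.mem_Iio]
    by_contra hp'
    exact hp (by simp [coeff_pow_eq_zero hf (show n < p by omega)])

theorem constantCoeff_expSubst {f : PowerSeries ℂ} (hf : PowerSeries.constantCoeff f = 0) :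
    PowerSeries.constantCoeff (expSubst f) = 1 := by
  rw [← PowerSeries.coeff_zero_eq_constantCoeff_apply, coeff_expSubst hf zero_lt_one]
  simp

theorem derivative_expSubst {f : PowerSeries ℂ} (hf : PowerSeries.constantCoeff f = 0) :
    PowerSeries.derivative ℂ (expSubst f) = expSubst f * PowerSeries.derivative ℂ f := by
  rw [expSubst, PowerSeries.derivative_subst (.of_constantCoeff_zero' hf),
    PowerSeries.derivative_exp]

/-- A linear differential equation `y' = y a` for power series has at most one solution with given
constant term. -/
theorem eq_of_derivative_eq_mul {a y z : PowerSeries ℂ}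
    (hy : PowerSeries.derivative ℂ y = y * a) (hz : PowerSeries.derivative ℂ z = z * a)
    (h0 : PowerSeries.constantCoeff y = PowerSeries.constantCoeff z) : y = z := by
  ext n
  induction n using Nat.strong_induction_on with
  | _ n ih =>
    rcases n with _ | n
    · simpa using h0
    have h1 := PowerSeries.coeff_derivative y n
    have h2 := PowerSeries.coeff_derivative z n
    rw [hy, PowerSeries.coeff_mul] at h1
    rw [hz, PowerSeries.coeff_mul] at h2
    have h3 : ∑ p ∈ Finset.HasAntidiagonal.antidiagonal n, PowerSeries.coeff p.1 y * PowerSeries.coeff p.2 a =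
        ∑ p ∈ Finset.HasAntidiagonal.antidiagonal n, PowerSeries.coeff p.1 z * PowerSeries.coeff p.2 a :=
      Finset.sum_congr rfl fun p hp => by
        rw [ih p.1 (by have := Finset.HasAntidiagonal.mem_antidiagonal.1 hp; omega)]
    rw [h1, h2] at h3
    exact mul_right_cancel₀ (by exact_mod_cast n.succ_ne_zero) h3

theorem expSubst_add {f g : PowerSeries ℂ} (hf : PowerSeries.constantCoeff f = 0)
    (hg : PowerSeries.constantCoeff g = 0) : expSubst (f + g) = expSubst f * expSubst g := by
  have hfg : PowerSeries.constantCoeff (f + g) = 0 := by simp [hf, hg]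
  refine eq_of_derivative_eq_mul (a := PowerSeries.derivative ℂ (f + g))
    (derivative_expSubst hfg) ?_ ?_
  · rw [Derivation.leibniz, derivative_expSubst hf, derivative_expSubst hg, map_add]
    simp only [smul_eq_mul]; ring
  · rw [map_mul, constantCoeff_expSubst hf, constantCoeff_expSubst hg, constantCoeff_expSubst hfg,
      mul_one]

theorem expSubst_evalsTo {f : PowerSeries ℂ} (hf : PowerSeries.constantCoeff f = 0) {c : ℂ}
    (h : EvalsTo f c) : EvalsTo (expSubst f) (Complex.exp c) := by
  have hsum : Summable fun q : ℕ × ℕ => ((q.1 ! : ℂ)⁻¹) * PowerSeries.coeff q.2 (f ^ q.1) := by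
    refine Summable.of_norm ?_
    simp only [norm_mul, norm_inv, Complex.norm_natCast]
    rw [summable_prod_of_nonneg fun q => by positivity]
    have hp : ∀ p : ℕ, Summable fun n => (p ! : ℝ)⁻¹ * ‖PowerSeries.coeff n (f ^ p)‖ := by
      intro p
      have hp := (h.pow p).summable.norm
      exact hp.mul_left _
    refine ⟨hp, ?_⟩
    simp only [tsum_mul_left]
    refine Summable.of_nonneg_of_le (fun p => mul_nonneg (by positivity)
      (tsum_nonneg fun _ => norm_nonneg _)) (fun p => ?_)
      (Real.summable_pow_div_factorial (∑' k, ‖PowerSeries.coeff k f‖))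
    rw [div_eq_inv_mul]
    exact mul_le_mul_of_nonneg_left (h.tsum_norm_pow_le p) (by positivity)
  have h1 : HasSum (fun p : ℕ => c ^ p / p !)
      (∑' q : ℕ × ℕ, ((q.1 ! : ℂ)⁻¹) * PowerSeries.coeff q.2 (f ^ q.1)) :=
    hsum.hasSum.prod_fiberwise fun p => by
      have := HasSum.mul_left ((p ! : ℂ)⁻¹) (h.pow p)
      rwa [mul_comm _ (c ^ p), ← div_eq_mul_inv] at this
  have h2 := h1.unique (NormedSpace.expSeries_div_hasSum_exp c)
  rw [← Complex.exp_eq_exp_ℂ] at h2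
  have h3 := (Equiv.prodComm ℕ ℕ).hasSum_iff.2 hsum.hasSum
  rw [h2] at h3
  refine h3.prod_fiberwise fun n => ?_
  rw [coeff_expSubst hf n.lt_succ_self]
  exact hasSum_sum_of_ne_finset_zero fun p hp => by
    simp only [Finset.mem_range, not_lt] at hp
    simp [coeff_pow_eq_zero hf (show n < p by omega)]

/-- The power series `ξ(t, X) = ∑_{k ≥ 1} t_k X^k`. -/
def xiSeries (t : ℕ+ → ℂ) : PowerSeries ℂ :=
  PowerSeries.mk fun | 0 => 0 | k + 1 => t k.succPNat

theorem constantCoeff_xiSeries (t : ℕ+ → ℂ) : PowerSeries.constantCoeff (xiSeries t) = 0 := by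
  rw [← PowerSeries.coeff_zero_eq_constantCoeff_apply]; simp [xiSeries]

theorem coeff_xiSeries_succ (t : ℕ+ → ℂ) (k : ℕ) :
    PowerSeries.coeff (k + 1) (xiSeries t) = t k.succPNat := by
  simp [xiSeries]

theorem coeff_xiSeries_zero (t : ℕ+ → ℂ) : PowerSeries.coeff 0 (xiSeries t) = 0 := by
  simp [xiSeries]

theorem xiSeries_add (s t : ℕ+ → ℂ) : xiSeries (s + t) = xiSeries s + xiSeries t := by
  ext (_ | n) <;> simp [xiSeries]

theorem xiSeries_eps (b : Bool) (t : ℕ+ → ℂ) :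
    xiSeries (eps b • t) = (eps b : ℂ) • xiSeries t := by
  ext (_ | n) <;> cases b <;> simp [xiSeries, eps]

/-- The series `∑_j h_j X^j = exp ξ(t, X)` of the complete symmetric functions. -/
def hSeries (t : ℕ+ → ℂ) : PowerSeries ℂ := expSubst (xiSeries t)

theorem hSeries_add (s t : ℕ+ → ℂ) : hSeries (s + t) = hSeries s * hSeries t := by
  rw [hSeries, xiSeries_add, expSubst_add (constantCoeff_xiSeries s) (constantCoeff_xiSeries t)]
  rfl

theorem constantCoeff_hSeries (t : ℕ+ → ℂ) : PowerSeries.constantCoeff (hSeries t) = 1 :=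
  constantCoeff_expSubst (constantCoeff_xiSeries t)

theorem coeff_zero_hSeries (t : ℕ+ → ℂ) : PowerSeries.coeff 0 (hSeries t) = 1 := by
  rw [PowerSeries.coeff_zero_eq_constantCoeff_apply, constantCoeff_hSeries]

theorem hSeries_zero : hSeries 0 = 1 := by
  have h := hSeries_add 0 0
  rw [add_zero] at h
  have h0 : hSeries 0 ≠ 0 := fun h0 => by simpa [h0] using constantCoeff_hSeries 0
  exact (mul_left_cancel₀ h0 (by rw [mul_one]; exact h)).symm

theorem hSeries_mul_neg (t : ℕ+ → ℂ) : hSeries t * hSeries (-t) = 1 := by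
  rw [← hSeries_add, add_neg_cancel, hSeries_zero]

/-- The sequence `[x⁻¹]` for a single variable. -/
def invPow (x : ℂ) : ℕ+ → ℂ := fun k => (1 / (k : ℂ)) * (1 / x ^ (k : ℕ))

theorem invPowerSums_eq_sum {n : ℕ} (z : Fin n → ℂ) : invPowerSums z = ∑ j, invPow (z j) := by
  funext k
  simp [invPowerSums, invPow, Finset.mul_sum]

theorem hSeries_neg_invPow (x : ℂ) :
    hSeries (-invPow x) = 1 - PowerSeries.C x⁻¹ * PowerSeries.X := by
  refine eq_of_derivative_eq_mul
    (derivative_expSubst (constantCoeff_xiSeries _)) ?_ ?_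
  · ext n
    rw [sub_mul, one_mul, map_sub, map_sub, map_sub, mul_assoc, PowerSeries.coeff_C_mul]
    rcases n with _ | n
    · simp [PowerSeries.coeff_derivative, coeff_xiSeries_succ, invPow]
    · simp only [PowerSeries.coeff_derivative, coeff_xiSeries_succ, mul_comm PowerSeries.X,
        PowerSeries.coeff_succ_mul_X, Pi.neg_apply, invPow,
        PowerSeries.coeff_one, Nat.succPNat_coe, Nat.succ_eq_add_one]
      have h1 : ((n : ℂ) + 1) ≠ 0 := by exact_mod_cast n.succ_ne_zero
      have h2 : ((n : ℂ) + 1 + 1) ≠ 0 := by exact_mod_cast (n + 1).succ_ne_zero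
      push_cast
      rw [pow_succ _ (n + 1)]
      field_simp
      simp
  · rw [constantCoeff_hSeries]; simp

theorem hSeries_invPow (x : ℂ) : hSeries (invPow x) = PowerSeries.mk fun n => (x⁻¹) ^ n := by
  have h1 : (PowerSeries.mk fun n => (x⁻¹) ^ n) * (1 - PowerSeries.C x⁻¹ * PowerSeries.X) = 1 := by
    ext n
    rw [mul_sub, mul_one, ← mul_assoc, map_sub]
    rcases n with _ | n
    · simp
    · rw [PowerSeries.coeff_succ_mul_X, mul_comm, PowerSeries.coeff_C_mul]
      simp [PowerSeries.coeff_one, pow_succ, mul_comm]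
  have h2 := hSeries_mul_neg (invPow x)
  rw [hSeries_neg_invPow] at h2
  have h0 : (1 - PowerSeries.C x⁻¹ * PowerSeries.X : PowerSeries ℂ) ≠ 0 := by
    intro h; rw [h, mul_zero] at h1; exact zero_ne_one h1
  exact mul_right_cancel₀ h0 (h2.trans h1.symm)

/-- If `ξ(t, x)` converges to `c`, then `∑_j h_j(t) x^j` converges to `exp c`. -/
theorem hasSum_hSeries {t : ℕ+ → ℂ} {x c : ℂ} (h : HasSum (fun k : ℕ+ => t k * x ^ (k : ℕ)) c) :
    HasSum (fun j => PowerSeries.coeff j (hSeries t) * x ^ j) (Complex.exp c) := by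
  have h0 : PowerSeries.constantCoeff (PowerSeries.rescale x (xiSeries t)) = 0 := by
    rw [← PowerSeries.coeff_zero_eq_constantCoeff_apply, PowerSeries.coeff_rescale,
      coeff_xiSeries_zero, mul_zero]
  have h1 : EvalsTo (PowerSeries.rescale x (xiSeries t)) c := by
    have h2 : HasSum (fun k : ℕ => PowerSeries.coeff (k + 1)
        (PowerSeries.rescale x (xiSeries t))) c := by
      have h3 := Equiv.pnatEquivNat.symm.hasSum_iff.2 h
      convert h3 using 2 with k
      rw [PowerSeries.coeff_rescale, coeff_xiSeries_succ, mul_comm]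
      rfl
    have h3 := (hasSum_nat_add_iff
      (f := fun k : ℕ => PowerSeries.coeff k (PowerSeries.rescale x (xiSeries t))) 1).1 h2
    rwa [Finset.sum_range_one, PowerSeries.coeff_zero_eq_constantCoeff_apply, h0, add_zero] at h3
  have h2 := expSubst_evalsTo h0 h1
  refine Eq.subst (motive := fun F => HasSum F (Complex.exp c)) (funext fun j => ?_) h2
  have hp : ∀ p, PowerSeries.coeff j ((PowerSeries.rescale x (xiSeries t)) ^ p) =
      x ^ j * PowerSeries.coeff j (xiSeries t ^ p) := fun p => by
    rw [← map_pow, PowerSeries.coeff_rescale]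
  rw [hSeries, coeff_expSubst h0 j.lt_succ_self,
    coeff_expSubst (constantCoeff_xiSeries t) j.lt_succ_self, Finset.sum_mul]
  exact Finset.sum_congr rfl fun p _ => by rw [hp]; ring

/-! ### Currents and the flow operator -/

/-- The span of the basis states of energy at most `e`. -/
def lowEnergy (e : ℤ) : Submodule ℂ Fock := Finsupp.supported ℂ ℂ {S | energy S ≤ e}

theorem ket_mem_lowEnergy {S : Maya} {e : ℤ} (h : energy S ≤ e) : ket S ∈ lowEnergy e :=
  Finsupp.single_mem_supported ℂ 1 h

theorem lowEnergy_induction {e : ℤ} {M : Submodule ℂ Fock} (h : ∀ S, energy S ≤ e → ket S ∈ M) :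
    lowEnergy e ≤ M := by
  rw [lowEnergy, Finsupp.supported_eq_span_single, Submodule.span_le]
  rintro _ ⟨S, hS, rfl⟩
  exact h S hS

theorem eq_zero_of_mem_lowEnergy {e : ℤ} (he : e < 0) {v : Fock} (h : v ∈ lowEnergy e) : v = 0 := by
  have := lowEnergy_induction (e := e) (M := ⊥) (fun S hS => absurd (energy_nonneg S) (by omega)) h
  simpa using this

theorem exists_mem_lowEnergy (v : Fock) : ∃ e : ℕ, v ∈ lowEnergy e := by
  refine Fock.induction (p := fun v => ∃ e : ℕ, v ∈ lowEnergy e) ⟨0, Submodule.zero_mem _⟩ ?_ ?_ v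
  · rintro u v ⟨a, ha⟩ ⟨b, hb⟩
    refine ⟨a + b, Submodule.add_mem _ ?_ ?_⟩
    · exact Finsupp.supported_mono (fun S (hS : energy S ≤ a) => by
        simp only [Set.mem_ofPred_eq]; push_cast; omega) ha
    · exact Finsupp.supported_mono (fun S (hS : energy S ≤ b) => by
        simp only [Set.mem_ofPred_eq]; push_cast; omega) hb
  · intro a S
    refine ⟨(energy S).toNat, Submodule.smul_mem _ _ (ket_mem_lowEnergy ?_)⟩
    have := energy_nonneg S; omega

theorem field_mem_lowEnergy (b : Bool) (m : ℤ) {e : ℤ} {v : Fock} (h : v ∈ lowEnergy e) :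
    field b m v ∈ lowEnergy (e + m + fieldShift b) := by
  refine lowEnergy_induction (M := (lowEnergy (e + m + fieldShift b)).comap (field b m)) ?_ h
  intro S hS
  rw [Submodule.mem_comap]
  rcases field_ket b m S with h0 | ⟨c, T, h1, h2⟩
  · rw [h0]; exact Submodule.zero_mem _
  · rw [h1]; exact Submodule.smul_mem _ _ (ket_mem_lowEnergy (by omega))

theorem normalOrd_eq (j : ℤ) (k : ℕ+) (v : Fock) :
    normalOrd j (j + k) v = field false j (field true (-j - k - 1) v) := by
  have h : j ≠ j + k := by have := k.pos; omega
  have h1 : psi j (psiStar (j + k) v) + psiStar (j + k) (psi j v) = 0 := by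
    have := LinearMap.congr_fun (psi_psiStar_anticomm j (j + k)) v
    rwa [if_neg h] at this
  have h2 : field false j (field true (-j - k - 1) v) = psi j (psiStar (j + k) v) := by
    simp only [field, Bool.false_eq_true, if_false, if_true]
    rw [show -(-j - (k : ℤ) - 1) - 1 = j + k by ring]
  rw [h2, normalOrd]
  split_ifs with h3
  · rfl
  · rw [LinearMap.neg_apply, Module.End.mul_apply, eq_comm]
    exact eq_neg_of_add_eq_zero_left h1

theorem current_support (k : ℕ+) (v : Fock) :
    (Function.support fun j : ℤ => field false j (field true (-j - k - 1) v)).Finite := by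
  obtain ⟨B, hB⟩ := field_eventually_zero true v
  obtain ⟨C, hC⟩ := field_eventually_zero false v
  refine (Set.finite_Icc C (-B - k - 1)).subset fun j hj => ⟨?_, ?_⟩
  · by_contra h
    refine hj ?_
    have hk := k.pos
    change field false j (field true (-j - k - 1) v) = 0
    rw [field_field, hC j (by omega), map_zero, if_neg (by simp; omega), sub_zero]
  · by_contra h
    refine hj ?_
    change field false j (field true (-j - k - 1) v) = 0
    rw [hB _ (by omega), map_zero]

theorem current_apply (k : ℕ+) (v : Fock) :
    current k v = ∑ᶠ j : ℤ, field false j (field true (-j - k - 1) v) := by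
  refine Fock.induction (p := fun v => current k v =
    ∑ᶠ j : ℤ, field false j (field true (-j - k - 1) v)) (by simp) ?_ ?_ v
  · intro u v hu hv
    rw [map_add, hu, hv, ← finsum_add_distrib (current_support k u) (current_support k v)]
    simp only [map_add]
  · intro a S
    rw [map_smul]
    simp only [map_smul]
    rw [← smul_finsum' a (current_support k (ket S))]
    congr 1
    rw [current, ket, Finsupp.linearCombination_single, one_smul]
    exact finsum_congr fun j => normalOrd_eq j k _

theorem current_mem_lowEnergy (k : ℕ+) {e : ℤ} {v : Fock} (h : v ∈ lowEnergy e) :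
    current k v ∈ lowEnergy (e - k) := by
  rw [current_apply, finsum_eq_sum _ (current_support k v)]
  refine Submodule.sum_mem _ fun j _ => ?_
  have := field_mem_lowEnergy false j (field_mem_lowEnergy true (-j - k - 1) h)
  convert this using 1
  simp only [fieldShift, if_true, Bool.false_eq_true, if_false]
  ring_nf

theorem current_field (k : ℕ+) (b : Bool) (m : ℤ) (v : Fock) :
    current k (field b m v) = field b m (current k v) + (eps b : ℂ) • field b (m - k) v := by
  -- the only summand of the current which does not commute with the given mode
  let j₀ : ℤ := if b then -1 - m else m - k
  let F : ℤ → Fock := fun j => if j = j₀ then (eps b : ℂ) • field b (m - k) v else 0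
  have hF : (Function.support F).Finite := (Set.finite_singleton j₀).subset fun j hj => by
    by_contra h; exact hj (if_neg h)
  have h1 : ∀ j : ℤ, field false j (field true (-j - k - 1) (field b m v)) =
      field b m (field false j (field true (-j - k - 1) v)) + F j := by
    intro j
    rcases b with _ | _
    · rw [field_field true false, map_sub, field_field false false j m]
      simp only [F, j₀, eps]
      by_cases hj : j = m - k
      · subst hj
        simp only [sub_eq_add_neg, neg_add, neg_neg]
        simp [add_comm]
      · rw [if_neg (by rintro ⟨-, h⟩; apply hj; omega)]
        simp [hj]
    · rw [field_field true true, map_sub, field_field false true j m]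
      simp only [F, j₀, eps]
      by_cases hj : j = -1 - m
      · subst hj
        rw [show -(-1 - m) - (k : ℤ) - 1 = m - k by ring]
        simp [sub_eq_add_neg, add_comm]
      · rw [if_neg (by simp), if_neg (by rintro ⟨-, h⟩; apply hj; omega),
          if_neg (by simpa using hj)]
        simp
  have h2 : (Function.support fun j : ℤ =>
      field b m (field false j (field true (-j - k - 1) v))).Finite :=
    (current_support k v).subset fun j hj h => hj (by
      change field false j (field true (-j - k - 1) v) = 0 at h
      change field b m (field false j (field true (-j - k - 1) v)) = 0
      rw [h, map_zero])
  rw [current_apply, current_apply, finsum_congr h1, finsum_add_distrib h2 hF]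
  congr 1
  · exact ((field b m).toAddMonoidHom.map_finsum (current_support k v)).symm
  · rw [finsum_eq_single _ j₀ fun j hj => if_neg hj]
    exact if_pos rfl

theorem current_sea (k : ℕ+) (M : ℤ) : current k (ket (sea M)) = 0 := by
  rw [current_apply]
  refine finsum_eq_zero_of_forall_eq_zero fun j => ?_
  have hk := k.pos
  by_cases h : j < M
  · rw [field_field, if_neg (by simp; omega), zero_sub, neg_eq_zero]
    simp only [field, Bool.false_eq_true, if_false]
    rw [psi_ket_of_mem (by simpa using h), map_zero]
  · simp only [field, Bool.false_eq_true, if_false, if_true]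
    rw [psiStar_ket_of_notMem (by simp; omega), map_zero]

theorem flowGen_support (t : ℕ+ → ℂ) (v : Fock) :
    (Function.support fun k : ℕ+ => t k • current k v).Finite := by
  obtain ⟨e, he⟩ := exists_mem_lowEnergy v
  refine Set.Finite.subset (s := {k : ℕ+ | (k : ℕ) ≤ e})
    ((Set.finite_Iic e).preimage PNat.coe_injective.injOn) fun k hk => ?_
  by_contra h
  refine hk ?_
  have h1 := current_mem_lowEnergy k he
  simp only [Set.mem_ofPred_eq, not_le] at h
  change t k • current k v = 0
  rw [eq_zero_of_mem_lowEnergy (by omega) h1, smul_zero]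

theorem flowGen_apply (t : ℕ+ → ℂ) (v : Fock) :
    flowGen t v = ∑ᶠ k : ℕ+, t k • current k v := by
  refine Fock.induction (p := fun v => flowGen t v = ∑ᶠ k : ℕ+, t k • current k v)
    (by simp) ?_ ?_ v
  · intro u v hu hv
    rw [map_add, hu, hv, ← finsum_add_distrib (flowGen_support t u) (flowGen_support t v)]
    simp only [map_add, smul_add]
  · intro a S
    rw [map_smul]
    simp only [map_smul, smul_comm _ a]
    rw [← smul_finsum' a (flowGen_support t (ket S))]
    congr 1
    rw [flowGen]
    conv_lhs => rw [ket, Finsupp.linearCombination_single, one_smul]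

theorem flowGen_mem_lowEnergy (t : ℕ+ → ℂ) {e : ℤ} {v : Fock} (h : v ∈ lowEnergy e) :
    flowGen t v ∈ lowEnergy (e - 1) := by
  rw [flowGen_apply, finsum_eq_sum _ (flowGen_support t v)]
  refine Submodule.sum_mem _ fun k _ => Submodule.smul_mem _ _ ?_
  have hk := k.pos
  exact Finsupp.supported_mono (fun S (hS : energy S ≤ e - k) => by
    simp only [Set.mem_ofPred_eq]; omega) (current_mem_lowEnergy k h)

theorem flowGen_pow_mem_lowEnergy (t : ℕ+ → ℂ) (p : ℕ) {e : ℤ} {v : Fock}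
    (h : v ∈ lowEnergy e) : (flowGen t ^ p) v ∈ lowEnergy (e - p) := by
  induction p with
  | zero => simpa using h
  | succ p ih =>
    rw [pow_succ', Module.End.mul_apply]
    have := flowGen_mem_lowEnergy t ih
    convert this using 1
    push_cast; ring_nf

theorem flowGen_pow_eq_zero (t : ℕ+ → ℂ) {p e : ℕ} {v : Fock} (h : v ∈ lowEnergy e)
    (hp : e < p) : (flowGen t ^ p) v = 0 :=
  eq_zero_of_mem_lowEnergy (by omega) (flowGen_pow_mem_lowEnergy t p h)

theorem flowGen_sea (t : ℕ+ → ℂ) (M : ℤ) : flowGen t (ket (sea M)) = 0 := by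
  rw [flowGen_apply]
  exact finsum_eq_zero_of_forall_eq_zero fun k => by rw [current_sea, smul_zero]

theorem gammaPlus_support (t : ℕ+ → ℂ) (v : Fock) :
    (Function.support fun p : ℕ => ((p ! : ℂ)⁻¹) • (flowGen t ^ p) v).Finite := by
  obtain ⟨e, he⟩ := exists_mem_lowEnergy v
  refine (Set.finite_Iic e).subset fun p hp => ?_
  by_contra h
  refine hp ?_
  change ((p ! : ℂ)⁻¹) • (flowGen t ^ p) v = 0
  rw [flowGen_pow_eq_zero t he (not_le.1 h), smul_zero]

theorem gammaPlus_apply (t : ℕ+ → ℂ) (v : Fock) :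
    gammaPlus t v = ∑ᶠ p : ℕ, ((p ! : ℂ)⁻¹) • (flowGen t ^ p) v := by
  refine Fock.induction (p := fun v => gammaPlus t v =
    ∑ᶠ p : ℕ, ((p ! : ℂ)⁻¹) • (flowGen t ^ p) v) (by simp) ?_ ?_ v
  · intro u v hu hv
    rw [map_add, hu, hv, ← finsum_add_distrib (gammaPlus_support t u) (gammaPlus_support t v)]
    simp only [map_add, smul_add]
  · intro a S
    rw [map_smul]
    simp only [map_smul, smul_comm _ a]
    rw [← smul_finsum' a (gammaPlus_support t (ket S))]
    congr 1
    rw [gammaPlus]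
    conv_lhs => rw [ket, Finsupp.linearCombination_single, one_smul]

theorem gammaPlus_eq_sum (t : ℕ+ → ℂ) {v : Fock} {e N : ℕ} (h : v ∈ lowEnergy e) (hN : e < N) :
    gammaPlus t v = ∑ p ∈ Finset.range N, ((p ! : ℂ)⁻¹) • (flowGen t ^ p) v := by
  rw [gammaPlus_apply]
  refine finsum_eq_sum_of_support_subset _ fun p hp => ?_
  simp only [Finset.coe_range, Set.mem_Iio]
  by_contra h'
  refine hp ?_
  change ((p ! : ℂ)⁻¹) • (flowGen t ^ p) v = 0
  rw [flowGen_pow_eq_zero t h (by omega), smul_zero]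

theorem gammaPlus_sea (t : ℕ+ → ℂ) (M : ℤ) : gammaPlus t (ket (sea M)) = ket (sea M) := by
  rw [gammaPlus_apply, finsum_eq_single _ 0 fun p hp => ?_]
  · simp
  · obtain ⟨p, rfl⟩ := Nat.exists_eq_succ_of_ne_zero hp
    rw [pow_succ, Module.End.mul_apply, flowGen_sea, map_zero, smul_zero]

theorem gammaPlus_zero : gammaPlus 0 = 1 := by
  have h0 : flowGen 0 = 0 := LinearMap.ext fun v => by
    rw [flowGen_apply, finsum_eq_zero_of_forall_eq_zero fun k => by simp]; rfl
  refine LinearMap.ext fun v => ?_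
  rw [gammaPlus_apply, finsum_eq_single _ 0 fun p hp => by simp [h0, hp]]
  simp

/-! ### Commutation of the flow operator with the fields -/

theorem smear_support (b : Bool) (m : ℤ) (f : ℕ → ℂ) (v : Fock) :
    (Function.support fun j : ℕ => f j • field b (m - j) v).Finite := by
  obtain ⟨B, hB⟩ := field_eventually_zero b v
  refine (Set.finite_Iic (m - B).toNat).subset fun j hj => ?_
  by_contra h
  refine hj ?_
  simp only [Set.mem_Iic, not_le] at h
  change f j • field b (m - j) v = 0
  rw [hB _ (by omega), smul_zero]

/-- The combination `∑_{j ≥ 0} f_j φ_{m-j}` of the modes of a field `φ`, applied to `v`. -/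
def smear (b : Bool) (m : ℤ) (f : PowerSeries ℂ) (v : Fock) : Fock :=
  ∑ᶠ j : ℕ, PowerSeries.coeff j f • field b (m - j) v

theorem smear_eq_sum {b : Bool} {m B : ℤ} {v : Fock} (h : ∀ n < B, field b n v = 0) {N : ℕ}
    (hN : m - B < N) (f : PowerSeries ℂ) :
    smear b m f v = ∑ j ∈ Finset.range N, PowerSeries.coeff j f • field b (m - j) v := by
  refine finsum_eq_sum_of_support_subset _ fun j hj => ?_
  simp only [Finset.coe_range, Set.mem_Iio]
  by_contra h'
  refine hj ?_
  change PowerSeries.coeff j f • field b (m - j) v = 0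
  rw [h _ (by omega), smul_zero]

theorem smear_add_vec (b : Bool) (m : ℤ) (f : PowerSeries ℂ) (u v : Fock) :
    smear b m f (u + v) = smear b m f u + smear b m f v := by
  rw [smear, smear, smear, ← finsum_add_distrib (smear_support b m _ u) (smear_support b m _ v)]
  simp only [map_add, smul_add]

theorem smear_smul_vec (b : Bool) (m : ℤ) (f : PowerSeries ℂ) (a : ℂ) (v : Fock) :
    smear b m f (a • v) = a • smear b m f v := by
  rw [smear, smear, smul_finsum' a (smear_support b m _ v)]
  simp only [map_smul, smul_comm _ a]

theorem smear_zero_vec (b : Bool) (m : ℤ) (f : PowerSeries ℂ) : smear b m f 0 = 0 := by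
  simp [smear]

theorem smear_smul (b : Bool) (m : ℤ) (f : PowerSeries ℂ) (a : ℂ) (v : Fock) :
    smear b m (a • f) v = a • smear b m f v := by
  rw [smear, smear, smul_finsum' a (smear_support b m _ v)]
  simp only [map_smul, smul_smul, smul_eq_mul]

theorem smear_one (b : Bool) (m : ℤ) (v : Fock) : smear b m 1 v = field b m v := by
  rw [smear, finsum_eq_single _ 0 fun j hj => by simp [PowerSeries.coeff_one, hj]]
  simp

theorem smear_smear_support (b : Bool) (m : ℤ) (f g : PowerSeries ℂ) (v : Fock) :
    (Function.support fun j : ℕ => PowerSeries.coeff j f • smear b (m - j) g v).Finite := by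
  obtain ⟨B, hB⟩ := field_eventually_zero b v
  refine (Set.finite_Iic (m - B).toNat).subset fun j hj => ?_
  by_contra h
  refine hj ?_
  simp only [Set.mem_Iic, not_le] at h
  change PowerSeries.coeff j f • smear b (m - j) g v = 0
  rw [smear_eq_sum hB (N := 0) (by push_cast; omega)]
  simp

theorem smear_mul (b : Bool) (m : ℤ) (f g : PowerSeries ℂ) (v : Fock) :
    smear b m (f * g) v = ∑ᶠ j : ℕ, PowerSeries.coeff j f • smear b (m - j) g v := by
  obtain ⟨B, hB⟩ := field_eventually_zero b v
  obtain ⟨N, hN⟩ : ∃ N : ℕ, m - B < N := ⟨(m - B).toNat + 1, by omega⟩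
  have h1 : ∑ᶠ j : ℕ, PowerSeries.coeff j f • smear b (m - j) g v =
      ∑ j ∈ Finset.range N, PowerSeries.coeff j f • smear b (m - j) g v := by
    refine finsum_eq_sum_of_support_subset _ fun j hj => ?_
    simp only [Finset.coe_range, Set.mem_Iio]
    by_contra h'
    refine hj ?_
    change PowerSeries.coeff j f • smear b (m - j) g v = 0
    rw [smear_eq_sum hB (N := 0) (by push_cast; omega)]
    simp
  have h2 : ∀ j ∈ Finset.range N, PowerSeries.coeff j f • smear b (m - j) g v =
      ∑ k ∈ Finset.range (N - j),
        (PowerSeries.coeff j f * PowerSeries.coeff k g) • field b (m - (j + k : ℕ)) v := by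
    intro j hj
    have := Finset.mem_range.1 hj
    rw [smear_eq_sum hB (N := N - j) (by omega), Finset.smul_sum]
    refine Finset.sum_congr rfl fun k _ => ?_
    rw [smul_smul]; push_cast; rw [sub_sub]
  rw [h1, Finset.sum_congr rfl h2, smear_eq_sum hB hN, ← Finset.sum_range_diag_flip N
    fun j k => (PowerSeries.coeff j f * PowerSeries.coeff k g) • field b (m - (j + k : ℕ)) v]
  refine Finset.sum_congr rfl fun n _ => ?_
  rw [PowerSeries.coeff_mul, Finset.sum_smul, Finset.Nat.sum_antidiagonal_eq_sum_range_succ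
    (fun j k => (PowerSeries.coeff j f * PowerSeries.coeff k g) • field b (m - n) v)]
  refine Finset.sum_congr rfl fun k hk => ?_
  have := Finset.mem_range.1 hk
  rw [show k + (n - k) = n by omega]

theorem smear_xiSeries (b : Bool) (m : ℤ) (t : ℕ+ → ℂ) (v : Fock) :
    smear b m (xiSeries t) v = ∑ᶠ k : ℕ+, t k • field b (m - k) v := by
  have e : ∀ k : ℕ+, PowerSeries.coeff (k : ℕ) (xiSeries t) = t k := fun k => by
    conv_lhs => rw [← PNat.natPred_add_one k]
    rw [coeff_xiSeries_succ, PNat.succPNat_natPred]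
  have h1 : ∑ᶠ k : ℕ+, t k • field b (m - k) v =
      ∑ᶠ k : ℕ+, PowerSeries.coeff (k : ℕ) (xiSeries t) • field b (m - (k : ℕ)) v :=
    finsum_congr fun k => by rw [e]
  rw [h1, ← finsum_mem_range (f := fun j : ℕ => PowerSeries.coeff j (xiSeries t) •
    field b (m - j) v) PNat.coe_injective, smear]
  refine finsum_congr fun j => ?_
  rcases j with _ | j
  · rw [coeff_xiSeries_zero, zero_smul]; simp
  · classical
    rw [finsum_eq_if, if_pos ⟨j.succPNat, rfl⟩]

theorem flowGen_field (t : ℕ+ → ℂ) (b : Bool) (m : ℤ) (v : Fock) :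
    flowGen t (field b m v) =
      field b m (flowGen t v) + (eps b : ℂ) • smear b m (xiSeries t) v := by
  have h1 : (Function.support fun k : ℕ+ => t k • field b m (current k v)).Finite :=
    (flowGen_support t v).subset fun k hk h => hk (by
      change t k • current k v = 0 at h
      change t k • field b m (current k v) = 0
      rw [← map_smul, h, map_zero])
  have h2 : (Function.support fun k : ℕ+ => t k • field b (m - k) v).Finite := by
    obtain ⟨B, hB⟩ := field_eventually_zero b v
    refine Set.Finite.subset (s := {k : ℕ+ | (k : ℕ) ≤ (m - B).toNat})
      ((Set.finite_Iic _).preimage PNat.coe_injective.injOn) fun k hk => ?_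
    by_contra h
    refine hk ?_
    simp only [Set.mem_ofPred_eq, not_le] at h
    change t k • field b (m - k) v = 0
    rw [hB _ (by omega), smul_zero]
  have h3 : (Function.support fun k : ℕ+ => (eps b : ℂ) • t k • field b (m - k) v).Finite :=
    h2.subset fun k hk h => hk (by
      change t k • field b (m - k) v = 0 at h
      change (eps b : ℂ) • t k • field b (m - k) v = 0
      rw [h, smul_zero])
  rw [flowGen_apply, flowGen_apply, smear_xiSeries, smul_finsum' _ h2]
  have h4 : field b m (∑ᶠ k : ℕ+, t k • current k v) =
      ∑ᶠ k : ℕ+, t k • field b m (current k v) := by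
    refine ((field b m).toAddMonoidHom.map_finsum (flowGen_support t v)).trans ?_
    exact finsum_congr fun k => (field b m).map_smul _ _
  rw [h4, ← finsum_add_distrib h1 h3]
  refine finsum_congr fun k => ?_
  rw [current_field, smul_add, smul_comm (t k)]

theorem flowGen_smear (t : ℕ+ → ℂ) (b : Bool) (m : ℤ) (f : PowerSeries ℂ) (v : Fock) :
    flowGen t (smear b m f v) =
      smear b m f (flowGen t v) + (eps b : ℂ) • smear b m (f * xiSeries t) v := by
  have h1 := smear_smear_support b m f (xiSeries t) v
  have h2 : (Function.support fun j : ℕ =>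
      (eps b : ℂ) • PowerSeries.coeff j f • smear b (m - j) (xiSeries t) v).Finite :=
    h1.subset fun j hj h => hj (by
      change PowerSeries.coeff j f • smear b (m - j) (xiSeries t) v = 0 at h
      change (eps b : ℂ) • PowerSeries.coeff j f • smear b (m - j) (xiSeries t) v = 0
      rw [h, smul_zero])
  rw [smear_mul, smul_finsum' _ h1]
  conv_rhs => rw [smear]
  rw [← finsum_add_distrib (smear_support b m _ _) h2, smear]
  refine ((flowGen t).toAddMonoidHom.map_finsum (smear_support b m _ v)).trans ?_
  refine finsum_congr fun j => ?_
  change flowGen t (PowerSeries.coeff j f • field b (m - j) v) = _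
  rw [map_smul, flowGen_field, smul_add, smul_comm (eps b : ℂ)]

/-- The divided power `D^p / p!` of the exponent `D` of the flow operator. -/
def flowDiv (t : ℕ+ → ℂ) (p : ℕ) (v : Fock) : Fock := ((p ! : ℂ)⁻¹) • (flowGen t ^ p) v

theorem flowGen_flowDiv (t : ℕ+ → ℂ) (p : ℕ) (v : Fock) :
    flowGen t (flowDiv t p v) = ((p : ℂ) + 1) • flowDiv t (p + 1) v := by
  have h : (p : ℂ) + 1 ≠ 0 := by exact_mod_cast p.succ_ne_zero
  rw [flowDiv, flowDiv, map_smul, ← Module.End.mul_apply, ← pow_succ', smul_smul,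
    Nat.factorial_succ]
  congr 1
  push_cast
  field_simp

theorem smul_sum_antidiagonal_succ {M : Type*} [AddCommGroup M] [Module ℂ M] (F : ℕ → ℕ → M)
    (p : ℕ) : ((p : ℂ) + 1) • ∑ q ∈ Finset.HasAntidiagonal.antidiagonal (p + 1), F q.1 q.2 =
      ∑ q ∈ Finset.HasAntidiagonal.antidiagonal p,
        (((q.2 : ℂ) + 1) • F q.1 (q.2 + 1) + ((q.1 : ℂ) + 1) • F (q.1 + 1) q.2) := by
  have h1 : ((p : ℂ) + 1) • ∑ q ∈ Finset.HasAntidiagonal.antidiagonal (p + 1), F q.1 q.2 =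
      ∑ q ∈ Finset.HasAntidiagonal.antidiagonal (p + 1), (q.2 : ℂ) • F q.1 q.2 +
      ∑ q ∈ Finset.HasAntidiagonal.antidiagonal (p + 1), (q.1 : ℂ) • F q.1 q.2 := by
    rw [Finset.smul_sum, ← Finset.sum_add_distrib]
    refine Finset.sum_congr rfl fun q hq => ?_
    rw [← add_smul]
    congr 1
    have := Finset.HasAntidiagonal.mem_antidiagonal.1 hq
    exact_mod_cast (by omega : p + 1 = q.2 + q.1)
  rw [h1, Finset.sum_add_distrib, Finset.Nat.sum_antidiagonal_succ'
    (f := fun q => (q.2 : ℂ) • F q.1 q.2), Finset.Nat.sum_antidiagonal_succ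
    (f := fun q => (q.1 : ℂ) • F q.1 q.2)]
  simp

theorem flowDiv_field (t : ℕ+ → ℂ) (b : Bool) (m : ℤ) (p : ℕ) (v : Fock) :
    flowDiv t p (field b m v) = ∑ q ∈ Finset.HasAntidiagonal.antidiagonal p,
      smear b m (((q.1 ! : ℂ)⁻¹) • xiSeries (eps b • t) ^ q.1) (flowDiv t q.2 v) := by
  induction p with
  | zero => simp [flowDiv, smear_one]
  | succ p ih =>
    have h : (p : ℂ) + 1 ≠ 0 := by exact_mod_cast p.succ_ne_zero
    refine smul_right_injective _ h ?_
    simp only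
    rw [← flowGen_flowDiv, ih, map_sum, smul_sum_antidiagonal_succ fun a c =>
      smear b m (((a ! : ℂ)⁻¹) • xiSeries (eps b • t) ^ a) (flowDiv t c v)]
    refine Finset.sum_congr rfl fun q _ => ?_
    rw [flowGen_smear, flowGen_flowDiv, smear_smul_vec]
    congr 1
    rw [← smear_smul, ← smear_smul]
    congr 1
    have h1 : (q.1 : ℂ) + 1 ≠ 0 := by exact_mod_cast q.1.succ_ne_zero
    rw [smul_smul, Nat.factorial_succ, pow_succ, xiSeries_eps, mul_smul_comm, smul_mul_assoc,
      smul_comm (eps b : ℂ)]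
    congr 1
    push_cast
    field_simp

theorem sum_antidiagonal_eq_sum_prod {M : Type*} [AddCommMonoid M] (F : ℕ → ℕ → M) {A C : ℕ}
    (hA : ∀ a c, A ≤ a → F a c = 0) (hC : ∀ a c, C ≤ c → F a c = 0) :
    ∑ p ∈ Finset.range (A + C), ∑ q ∈ Finset.HasAntidiagonal.antidiagonal p, F q.1 q.2 =
      ∑ a ∈ Finset.range A, ∑ c ∈ Finset.range C, F a c := by
  simp only [Finset.Nat.sum_antidiagonal_eq_sum_range_succ F]
  rw [Finset.sum_range_diag_flip (A + C) F]
  refine (Finset.sum_subset (Finset.range_subset_range.2 (Nat.le_add_right A C)) ?_).symm.trans ?_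
  · intro a _ ha
    exact Finset.sum_eq_zero fun c _ => hA a c (by simpa using ha)
  · refine Finset.sum_congr rfl fun a ha => ?_
    have := Finset.mem_range.1 ha
    refine (Finset.sum_subset (Finset.range_subset_range.2 (by omega)) ?_).symm
    intro c _ hc
    exact hC a c (by simpa using hc)

theorem lowEnergy_mono {d e : ℤ} (h : d ≤ e) : lowEnergy d ≤ lowEnergy e :=
  Finsupp.supported_mono fun _ hS => le_trans hS h

theorem flowDiv_eq_zero (t : ℕ+ → ℂ) {p e : ℕ} {v : Fock} (h : v ∈ lowEnergy e) (hp : e < p) :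
    flowDiv t p v = 0 := by
  rw [flowDiv, flowGen_pow_eq_zero t h hp, smul_zero]

theorem flowDiv_mem_lowEnergy (t : ℕ+ → ℂ) (p : ℕ) {e : ℤ} {v : Fock} (h : v ∈ lowEnergy e) :
    flowDiv t p v ∈ lowEnergy e :=
  Submodule.smul_mem _ _ (lowEnergy_mono (by omega) (flowGen_pow_mem_lowEnergy t p h))

theorem gammaPlus_mem_lowEnergy (t : ℕ+ → ℂ) {e : ℕ} {v : Fock} (h : v ∈ lowEnergy e) :
    gammaPlus t v ∈ lowEnergy e := by
  rw [gammaPlus_eq_sum t h e.lt_succ_self]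
  exact Submodule.sum_mem _ fun p _ => flowDiv_mem_lowEnergy t p h

theorem smear_sum_vec {ι : Type*} (b : Bool) (m : ℤ) (f : PowerSeries ℂ) (s : Finset ι)
    (v : ι → Fock) : smear b m f (∑ i ∈ s, v i) = ∑ i ∈ s, smear b m f (v i) := by
  classical
  induction s using Finset.induction_on with
  | empty => simp [smear_zero_vec]
  | insert i s hi ih => rw [Finset.sum_insert hi, Finset.sum_insert hi, smear_add_vec, ih]

/-- Conjugation by the flow operator multiplies the fields `ψ(x)` and `ψ*(x)` by
`exp (± ξ(t, x))`. -/
theorem gammaPlus_field (t : ℕ+ → ℂ) (b : Bool) (m : ℤ) (v : Fock) :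
    gammaPlus t (field b m v) = smear b m (hSeries (eps b • t)) (gammaPlus t v) := by
  obtain ⟨e, he⟩ := exists_mem_lowEnergy v
  have hB : ∀ u ∈ lowEnergy e, ∀ n < -(e : ℤ) - fieldShift b, field b n u = 0 := fun u hu n hn =>
    eq_zero_of_mem_lowEnergy (by omega) (field_mem_lowEnergy b n hu)
  obtain ⟨A, hA⟩ : ∃ A : ℕ, m - (-(e : ℤ) - fieldShift b) < A :=
    ⟨(m - (-(e : ℤ) - fieldShift b)).toNat + 1, by omega⟩
  have h1 : gammaPlus t (field b m v) = ∑ p ∈ Finset.range (A + (e + 1)),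
      flowDiv t p (field b m v) := by
    refine gammaPlus_eq_sum (e := (e + m + fieldShift b).toNat) t ?_ (by omega)
    exact lowEnergy_mono (by omega) (field_mem_lowEnergy b m he)
  have h2 : gammaPlus t v = ∑ c ∈ Finset.range (e + 1), flowDiv t c v :=
    gammaPlus_eq_sum t he e.lt_succ_self
  rw [h1]
  simp only [flowDiv_field]
  rw [sum_antidiagonal_eq_sum_prod fun a c =>
    smear b m (((a ! : ℂ)⁻¹) • xiSeries (eps b • t) ^ a) (flowDiv t c v)]
  · simp only [← smear_sum_vec, ← h2]
    have hu := hB _ (gammaPlus_mem_lowEnergy t he)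
    simp only [smear_eq_sum hu hA]
    rw [Finset.sum_comm]
    refine Finset.sum_congr rfl fun j hj => ?_
    rw [hSeries, coeff_expSubst (constantCoeff_xiSeries _) (Finset.mem_range.1 hj), Finset.sum_smul]
    refine Finset.sum_congr rfl fun a _ => ?_
    simp
  · intro a c ha
    rw [smear_eq_sum (hB _ (flowDiv_mem_lowEnergy t c he)) hA]
    refine Finset.sum_eq_zero fun j hj => ?_
    have := Finset.mem_range.1 hj
    rw [map_smul, coeff_pow_eq_zero (constantCoeff_xiSeries _) (by omega), smul_zero, zero_smul]
  · intro a c hc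
    rw [flowDiv_eq_zero t he hc, smear_zero_vec]

/-! ### Additivity of the flow -/

/-- The sites at which a state differs from the vacuum form a finite set, which shrinks by one when
a particle or a hole is removed; hence every state arises from the vacuum by insertions and
removals. -/
theorem Maya.induction {p : Maya → Prop} (h0 : p vac)
    (hi : ∀ (S : Maya) i, i ∉ S.1 → p S → p (S.insert i))
    (he : ∀ (S : Maya) i, i ∈ S.1 → p S → p (S.erase i)) (S : Maya) : p S := by
  have hfin : ∀ S : Maya, ({i | i ∈ S.1 ∧ 0 ≤ i} ∪ {i | i ∉ S.1 ∧ i < 0}).Finite :=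
    fun S => S.2.1.union S.2.2
  induction hn : Set.ncard ({i | i ∈ S.1 ∧ 0 ≤ i} ∪ {i | i ∉ S.1 ∧ i < 0}) generalizing S with
  | zero =>
    rw [Set.ncard_eq_zero (hfin S)] at hn
    have : S = vac := Maya.ext_mem fun k => by
      have hk := Set.ext_iff.1 hn k
      simp only [Set.mem_union, Set.mem_ofPred_eq, Set.mem_empty_iff_false, iff_false] at hk
      change k ∈ S.1 ↔ k < 0
      by_cases k ∈ S.1 <;> simp_all
    exact this ▸ h0
  | succ n ih =>
    obtain ⟨i, hi'⟩ := (Set.ncard_pos (hfin S)).1 (by omega)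
    rcases hi' with ⟨h1, h2⟩ | ⟨h1, h2⟩
    · rw [← Maya.insert_erase h1]
      refine hi _ _ (fun h => h.2 rfl) (ih _ ?_)
      have e : ({k | k ∈ (S.erase i).1 ∧ 0 ≤ k} ∪ {k | k ∉ (S.erase i).1 ∧ k < 0}) =
          ({k | k ∈ S.1 ∧ 0 ≤ k} ∪ {k | k ∉ S.1 ∧ k < 0}) \ {i} := by
        ext k
        simp only [Maya.mem_erase_iff, Set.mem_union, Set.mem_ofPred_eq, Set.mem_sdiff,
          Set.mem_singleton_iff]
        by_cases hk : k = i
        · subst hk; simp; omega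
        · simp [hk]
      have h3 := Set.ncard_sdiff_singleton_add_one
        (show i ∈ {k | k ∈ S.1 ∧ 0 ≤ k} ∪ {k | k ∉ S.1 ∧ k < 0} from Or.inl ⟨h1, h2⟩) (hfin S)
      rw [e]
      omega
    · rw [← Maya.erase_insert h1]
      refine he _ _ (Or.inl rfl) (ih _ ?_)
      have e : ({k | k ∈ (S.insert i).1 ∧ 0 ≤ k} ∪ {k | k ∉ (S.insert i).1 ∧ k < 0}) =
          ({k | k ∈ S.1 ∧ 0 ≤ k} ∪ {k | k ∉ S.1 ∧ k < 0}) \ {i} := by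
        ext k
        simp only [Maya.mem_insert_iff, Set.mem_union, Set.mem_ofPred_eq, Set.mem_sdiff,
          Set.mem_singleton_iff]
        by_cases hk : k = i
        · subst hk; simp; omega
        · simp [hk]
      have h3 := Set.ncard_sdiff_singleton_add_one
        (show i ∈ {k | k ∈ S.1 ∧ 0 ≤ k} ∪ {k | k ∉ S.1 ∧ k < 0} from Or.inr ⟨h1, h2⟩) (hfin S)
      rw [e]
      omega

/-- The vacuum is cyclic for the fields: an operator commuting with all modes and annihilating the
vacuum vanishes. -/
theorem eq_zero_of_commute_field {X : Module.End ℂ Fock}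
    (h : ∀ b m v, X (field b m v) = field b m (X v)) (h0 : X (ket vac) = 0) : X = 0 := by
  refine ket_ext fun S => ?_
  rw [LinearMap.zero_apply]
  refine Maya.induction (p := fun S => X (ket S) = 0) h0 ?_ ?_ S
  · intro S i hi hS
    have := h false i (ket S)
    rw [hS, map_zero] at this
    simp only [field, Bool.false_eq_true, if_false] at this
    rw [psi_ket_of_notMem hi, map_smul] at this
    exact (smul_eq_zero.1 this).resolve_left (wedgeSign_ne_zero _ _)
  · intro S i hi hS
    have := h true (-i - 1) (ket S)
    rw [hS, map_zero] at this
    simp only [field, if_true] at this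
    rw [show -(-i - 1) - 1 = i by ring, psiStar_ket_of_mem hi, map_smul] at this
    exact (smul_eq_zero.1 this).resolve_left (wedgeSign_ne_zero _ _)

theorem flowGen_commute (s t : ℕ+ → ℂ) : Commute (flowGen s) (flowGen t) := by
  have h : flowGen s * flowGen t - flowGen t * flowGen s = 0 := by
    refine eq_zero_of_commute_field (fun b m v => ?_) ?_
    · simp only [LinearMap.sub_apply, Module.End.mul_apply]
      rw [flowGen_field, flowGen_field, map_add, map_add, map_smul, map_smul, flowGen_field,
        flowGen_field, flowGen_smear, flowGen_smear, mul_comm (xiSeries t), map_sub]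
      module
    · simp only [LinearMap.sub_apply, Module.End.mul_apply, ← sea_zero, flowGen_sea, map_zero,
        sub_self]
  exact sub_eq_zero.1 h

theorem flowGen_add (s t : ℕ+ → ℂ) : flowGen (s + t) = flowGen s + flowGen t := by
  refine LinearMap.ext fun v => ?_
  rw [LinearMap.add_apply, flowGen_apply, flowGen_apply, flowGen_apply,
    ← finsum_add_distrib (flowGen_support s v) (flowGen_support t v)]
  exact finsum_congr fun k => by rw [Pi.add_apply, add_smul]

theorem flowDiv_add (s t : ℕ+ → ℂ) (p : ℕ) (v : Fock) :
    flowDiv (s + t) p v = ∑ q ∈ Finset.HasAntidiagonal.antidiagonal p,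
      flowDiv s q.1 (flowDiv t q.2 v) := by
  rw [flowDiv, flowGen_add, (flowGen_commute s t).add_pow', LinearMap.sum_apply, Finset.smul_sum]
  refine Finset.sum_congr rfl fun q hq => ?_
  have := Finset.HasAntidiagonal.mem_antidiagonal.1 hq
  subst this
  rw [flowDiv, flowDiv, map_smul, smul_smul, LinearMap.smul_apply, Module.End.mul_apply,
    ← Nat.cast_smul_eq_nsmul ℂ, smul_smul]
  congr 1
  have h1 := Nat.add_choose_mul_factorial_mul_factorial q.1 q.2
  have h2 : (q.1 ! : ℂ) ≠ 0 := by exact_mod_cast q.1.factorial_ne_zero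
  have h3 : (q.2 ! : ℂ) ≠ 0 := by exact_mod_cast q.2.factorial_ne_zero
  have h4 : ((q.1 + q.2)! : ℂ) ≠ 0 := by exact_mod_cast (q.1 + q.2).factorial_ne_zero
  have h5 : ((q.1 + q.2).choose q.1 : ℂ) * q.1 ! * q.2 ! = (q.1 + q.2)! := by
    rw [Nat.choose_symm_add]; exact_mod_cast h1
  field_simp
  linear_combination h5

theorem gammaPlus_add (s t : ℕ+ → ℂ) (v : Fock) :
    gammaPlus (s + t) v = gammaPlus s (gammaPlus t v) := by
  obtain ⟨e, he⟩ := exists_mem_lowEnergy v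
  have h1 : gammaPlus (s + t) v =
      ∑ p ∈ Finset.range ((e + 1) + (e + 1)), flowDiv (s + t) p v :=
    gammaPlus_eq_sum _ he (by omega)
  have h2 : gammaPlus t v = ∑ c ∈ Finset.range (e + 1), flowDiv t c v :=
    gammaPlus_eq_sum t he e.lt_succ_self
  have h3 : gammaPlus s (gammaPlus t v) =
      ∑ c ∈ Finset.range (e + 1), flowDiv s c (gammaPlus t v) :=
    gammaPlus_eq_sum s (gammaPlus_mem_lowEnergy t he) e.lt_succ_self
  rw [h1, h3, h2]
  simp only [flowDiv_add]
  rw [sum_antidiagonal_eq_sum_prod fun a c => flowDiv s a (flowDiv t c v)]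
  · refine Finset.sum_congr rfl fun a _ => ?_
    simp only [flowDiv, map_sum, Finset.smul_sum]
  · intro a c ha
    exact flowDiv_eq_zero s (flowDiv_mem_lowEnergy t c he) ha
  · intro a c hc
    rw [flowDiv_eq_zero t he hc, flowDiv, map_zero, smul_zero]

/-! ### Bosonization of a single field -/

theorem hasSum_smear (L : Module.Dual ℂ Fock) (b : Bool) (m : ℤ) (f : PowerSeries ℂ) (v : Fock) :
    HasSum (fun j : ℕ => PowerSeries.coeff j f * L (field b (m - j) v)) (L (smear b m f v)) := by
  obtain ⟨B, hB⟩ := field_eventually_zero b v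
  obtain ⟨N, hN⟩ : ∃ N : ℕ, m - B < N := ⟨(m - B).toNat + 1, by omega⟩
  rw [smear_eq_sum hB hN, map_sum]
  simp only [map_smul, smul_eq_mul]
  refine hasSum_sum_of_ne_finset_zero fun j hj => ?_
  simp only [Finset.mem_range, not_lt] at hj
  rw [hB _ (by omega), map_zero, mul_zero]

/-- The coefficients of a power series, extended by zero to negative indices. -/
def coeffInt (f : PowerSeries ℂ) (k : ℤ) : ℂ := if 0 ≤ k then PowerSeries.coeff k.toNat f else 0

theorem apply_smear_eq_sum (L : Module.Dual ℂ Fock) (b : Bool) (k : ℤ) (f : PowerSeries ℂ)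
    (v : Fock) {I : Finset ℤ} (hI : ∀ m ≤ k, m ∉ I → L (field b m v) = 0) :
    L (smear b k f v) = ∑ m ∈ I, coeffInt f (k - m) * L (field b m v) := by
  obtain ⟨B, hB⟩ := field_eventually_zero b v
  obtain ⟨N, hN⟩ : ∃ N : ℕ, k - B < N := ⟨(k - B).toNat + 1, by omega⟩
  have h1 : L (smear b k f v) = ∑ m ∈ (Finset.range N).image fun j : ℕ => k - (j : ℤ),
      coeffInt f (k - m) * L (field b m v) := by
    rw [Finset.sum_image fun i _ j _ h => by simpa using h, smear_eq_sum hB hN, map_sum]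
    refine Finset.sum_congr rfl fun j _ => ?_
    rw [map_smul, smul_eq_mul, coeffInt, sub_sub_cancel, if_pos (Int.natCast_nonneg j),
      Int.toNat_natCast]
  rw [h1]
  refine Finset.sum_congr_of_eq_on_inter ?_ ?_ fun _ _ _ => rfl
  · intro m hm hmI
    obtain ⟨j, -, rfl⟩ := Finset.mem_image.1 hm
    rw [hI _ (by omega) hmI, mul_zero]
  · intro m _ hm
    by_cases h : m ≤ k
    · have : m < B := by
        by_contra h'
        exact hm (Finset.mem_image.2 ⟨(k - m).toNat, Finset.mem_range.2 (by omega), by omega⟩)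
      rw [hB m this, map_zero, mul_zero]
    · rw [coeffInt, if_neg (by omega), zero_mul]

theorem gammaPlus_smear (t : ℕ+ → ℂ) (b : Bool) (m : ℤ) (f : PowerSeries ℂ) (v : Fock) :
    gammaPlus t (smear b m f v) = smear b m (f * hSeries (eps b • t)) (gammaPlus t v) := by
  rw [smear_mul]
  refine ((gammaPlus t).toAddMonoidHom.map_finsum (smear_support b m _ v)).trans ?_
  refine finsum_congr fun j => ?_
  change gammaPlus t (PowerSeries.coeff j f • field b (m - j) v) = _
  rw [map_smul, gammaPlus_field]

/-- A covector satisfying the same annihilation relations as `⟨M| γ̂₊(t)` is determined by its value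
on the vacuum: by the relations, its value on a state is a combination of values on states of lower
energy. -/
theorem dual_eq_zero {c : Module.Dual ℂ Fock} {M : ℤ} {p : Bool → PowerSeries ℂ}
    (hp : ∀ b, PowerSeries.coeff 0 (p b) = 1)
    (h : ∀ b m, eps b * M ≤ m → ∀ v, c (smear b m (p b) v) = 0)
    (h0 : c (ket (sea M)) = 0) : c = 0 := by
  have key : ∀ (n : ℕ) (S : Maya), energy S < n → c (ket S) = 0 := by
    intro n
    induction n with
    | zero => intro S hS; exact absurd (energy_nonneg S) (by simpa using hS)
    | succ n ih =>
      intro S hS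
      by_cases hne : S = sea M
      · rw [hne, h0]
      obtain ⟨b, m, S', a, hm, h1, h2⟩ := exists_field_of_ne_sea hne
      have h3 := (hasSum_smear c b m (p b) (ket S'))
      rw [h b m hm] at h3
      have h4 : ∀ j : ℕ, j ≠ 0 →
          PowerSeries.coeff j (p b) * c (field b (m - j) (ket S')) = 0 := by
        intro j hj
        rcases field_ket b (m - j) S' with h5 | ⟨d, T, h5, h6⟩
        · rw [h5, map_zero, mul_zero]
        · rw [h5, map_smul, ih T (by push_cast at hS; omega), smul_zero, mul_zero]
      have h5 := h3.unique (hasSum_single 0 h4)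
      rw [hp, one_mul, Nat.cast_zero, sub_zero] at h5
      rw [h1, map_smul, ← h5, smul_zero]
  refine ket_ext fun S => key ((energy S).toNat + 1) S ?_
  have := energy_nonneg S
  push_cast; omega

theorem bra_field_support (b : Bool) (N : ℤ) (x : ℂ) (v : Fock) :
    (Function.support fun m : ℤ => x ^ m * bra N (field b m v)).Finite := by
  obtain ⟨B, hB⟩ := field_eventually_zero b v
  refine (Set.finite_Ico B (eps b * N)).subset fun m hm => ⟨?_, ?_⟩
  · by_contra h
    refine hm ?_
    change x ^ m * bra N (field b m v) = 0
    rw [hB m (not_le.1 h), map_zero, mul_zero]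
  · by_contra h
    refine hm ?_
    change x ^ m * bra N (field b m v) = 0
    rw [bra_field b (not_lt.1 h), mul_zero]

/-- The covector `⟨N| φ(x)` for a field `φ`. -/
def braField (b : Bool) (N : ℤ) (x : ℂ) : Module.Dual ℂ Fock where
  toFun v := ∑ᶠ m : ℤ, x ^ m * bra N (field b m v)
  map_add' u v := by
    rw [← finsum_add_distrib (bra_field_support b N x u) (bra_field_support b N x v)]
    simp only [map_add, mul_add]
  map_smul' a v := by
    rw [RingHom.id_apply, smul_finsum' a (bra_field_support b N x v)]
    exact finsum_congr fun m => by rw [map_smul, map_smul, smul_eq_mul, smul_eq_mul]; ring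

theorem braField_apply (b : Bool) (N : ℤ) (x : ℂ) (v : Fock) :
    braField b N x v = ∑ᶠ m : ℤ, x ^ m * bra N (field b m v) := rfl

theorem braField_field_not {b : Bool} {N k : ℤ} {x : ℂ} (hk : -(eps b * N) ≤ k) (v : Fock) :
    braField b N x (field (!b) k v) = x ^ (-1 - k) * bra N v := by
  rw [braField_apply, finsum_eq_single _ (-1 - k)]
  · rw [field_field, if_pos (by simp), map_sub, bra_field (!b) (by rw [eps_not]; linarith),
      sub_zero]
  · intro m hm
    rw [field_field, if_neg (by rintro ⟨-, h⟩; apply hm; omega), zero_sub, map_neg,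
      bra_field (!b) (by rw [eps_not]; linarith), neg_zero, mul_zero]

theorem braField_smear_not {b : Bool} {N k : ℤ} {x : ℂ} (hx : x ≠ 0) (hk : -(eps b * N) + 1 ≤ k)
    (v : Fock) :
    braField b N x (smear (!b) k (1 - PowerSeries.C x⁻¹ * PowerSeries.X) v) = 0 := by
  have h1 : ∀ j : ℕ, PowerSeries.coeff (j + 2)
      (1 - PowerSeries.C x⁻¹ * PowerSeries.X : PowerSeries ℂ) = 0 := fun j => by
    simp [PowerSeries.coeff_one]
  have h2 := (hasSum_smear (braField b N x) (!b) k
    (1 - PowerSeries.C x⁻¹ * PowerSeries.X) v).unique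
    (hasSum_sum_of_ne_finset_zero (s := Finset.range 2) fun j hj => by
      obtain ⟨i, rfl⟩ := Nat.exists_eq_add_of_le (not_lt.1 (mt Finset.mem_range.2 hj))
      rw [add_comm, h1, zero_mul])
  rw [h2, Finset.sum_range_succ, Finset.sum_range_one, braField_field_not (by push_cast; omega),
    braField_field_not (by push_cast; omega)]
  have h3 : x ^ (-1 - (k - ((1 : ℕ) : ℤ))) = x * x ^ (-1 - (k - ((0 : ℕ) : ℤ))) := by
    rw [← zpow_one_add₀ hx]; congr 1; push_cast; ring
  rw [h3]
  simp [PowerSeries.coeff_one]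
  field_simp
  simp

theorem braField_smear_self {b : Bool} {N k : ℤ} {x : ℂ} (hx : x ≠ 0) (hk : eps b * N - 1 ≤ k)
    (v : Fock) : braField b N x (smear b k (PowerSeries.mk fun n => x⁻¹ ^ n) v) = 0 := by
  obtain ⟨B, hB⟩ := field_eventually_zero b v
  have hanti : ∀ m n, field b m (field b n v) = -field b n (field b m v) := fun m n => by
    rw [field_field, if_neg (by simp), zero_sub]
  have h1 : ∀ n, braField b N x (field b n v) =
      ∑ m ∈ Finset.Ico B (eps b * N), x ^ m * bra N (field b m (field b n v)) := by
    intro n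
    rw [braField_apply]
    refine finsum_eq_sum_of_support_subset _ fun m hm => ?_
    rw [Finset.coe_Ico]
    refine ⟨?_, ?_⟩
    · by_contra h
      refine hm ?_
      change x ^ m * bra N (field b m (field b n v)) = 0
      rw [hanti, hB m (not_le.1 h), map_zero, neg_zero, map_zero, mul_zero]
    · by_contra h
      refine hm ?_
      change x ^ m * bra N (field b m (field b n v)) = 0
      rw [bra_field b (not_lt.1 h), mul_zero]
  have h2 : ∀ n ≤ k, n ∉ Finset.Ico B (eps b * N) → braField b N x (field b n v) = 0 := by
    intro n _ hn
    rw [h1]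
    refine Finset.sum_eq_zero fun m _ => ?_
    rw [Finset.mem_Ico, not_and_or] at hn
    rcases hn with hn | hn
    · rw [hB n (not_le.1 hn), map_zero, map_zero, mul_zero]
    · rw [hanti, map_neg, bra_field b (not_lt.1 hn), neg_zero, mul_zero]
  rw [apply_smear_eq_sum _ b k _ v h2]
  -- the double sum is antisymmetric in the two mode numbers
  have h3 : ∑ n ∈ Finset.Ico B (eps b * N),
      coeffInt (PowerSeries.mk fun n => x⁻¹ ^ n) (k - n) * braField b N x (field b n v) =
      ∑ n ∈ Finset.Ico B (eps b * N), ∑ m ∈ Finset.Ico B (eps b * N),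
        x ^ (m + n - k) * bra N (field b m (field b n v)) := by
    refine Finset.sum_congr rfl fun n hn => ?_
    rw [h1, Finset.mul_sum]
    refine Finset.sum_congr rfl fun m _ => ?_
    have := (Finset.mem_Ico.1 hn).2
    have h4 : x⁻¹ ^ (k - n).toNat = x ^ (n - k) := by
      rw [← zpow_natCast, inv_zpow', Int.toNat_of_nonneg (by omega), neg_sub]
    rw [coeffInt, if_pos (by omega), PowerSeries.coeff_mk, h4, ← mul_assoc, ← zpow_add₀ hx]
    congr 2; ring
  rw [h3]
  refine self_eq_neg.1 ?_
  conv_lhs => rw [Finset.sum_comm]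
  rw [← Finset.sum_neg_distrib]
  refine Finset.sum_congr rfl fun n _ => ?_
  rw [← Finset.sum_neg_distrib]
  refine Finset.sum_congr rfl fun m _ => ?_
  rw [hanti n m, map_neg, mul_neg, add_comm m n]

/-- Bosonization of a single field:
`⟨N| φ(x) = x^{εN - 1} ⟨N - ε| γ̂₊(-ε [x⁻¹])`, where `ε = ±1` is the charge of `φ`. -/
theorem braField_eq (b : Bool) (N : ℤ) {x : ℂ} (hx : x ≠ 0) (v : Fock) :
    braField b N x v =
      x ^ (eps b * N - 1) * bra (N - eps b) (gammaPlus (-(eps b • invPow x)) v) := by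
  set s : ℕ+ → ℂ := -(eps b • invPow x) with hs
  have h0 : braField b N x - x ^ (eps b * N - 1) • (bra (N - eps b) ∘ₗ gammaPlus s) = 0 := by
    refine dual_eq_zero (M := N - eps b) (p := fun c => hSeries (-(eps c • s)))
      (fun c => coeff_zero_hSeries _) (fun c m hm v => ?_) ?_
    · have h1 : bra (N - eps b) (gammaPlus s (smear c m (hSeries (-(eps c • s))) v)) = 0 := by
        rw [gammaPlus_smear, mul_comm, hSeries_mul_neg, smear_one, bra_field c hm]
      have h2 : braField b N x (smear c m (hSeries (-(eps c • s))) v) = 0 := by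
        by_cases hc : c = b
        · subst hc
          have : -(eps c • s) = invPow x := by
            rw [hs, smul_neg, neg_neg, smul_smul, eps_mul_self, one_smul]
          rw [this, hSeries_invPow]
          refine braField_smear_self hx ?_ v
          rw [mul_sub, eps_mul_self] at hm
          exact hm
        · have hc' : c = !b := by cases c <;> cases b <;> simp_all
          subst hc'
          have : -(eps (!b) • s) = -invPow x := by
            rw [hs, smul_neg, neg_neg, smul_smul, eps_not, neg_mul, eps_mul_self, neg_smul,
              one_smul]
          rw [this, hSeries_neg_invPow]
          refine braField_smear_not hx ?_ v
          rw [eps_not, mul_sub, neg_mul, neg_mul, eps_mul_self] at hm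
          omega
      rw [LinearMap.sub_apply, LinearMap.smul_apply, LinearMap.comp_apply, h1, h2]
      simp
    · rw [LinearMap.sub_apply, LinearMap.smul_apply, LinearMap.comp_apply, gammaPlus_sea,
        bra_ket_self, braField_apply, finsum_eq_single _ (eps b * N - 1), bra_field_sea]
      · simp
      · intro m hm
        by_contra h
        refine hm (bra_field_ket_unique (right_ne_zero_of_mul h) ?_)
        rw [bra_field_sea]; exact one_ne_zero
  have := LinearMap.congr_fun h0 v
  rw [LinearMap.sub_apply, LinearMap.smul_apply, LinearMap.comp_apply, LinearMap.zero_apply,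
    sub_eq_zero] at this
  exact this

theorem hasSum_bra_field (b : Bool) (N : ℤ) {x : ℂ} (hx : x ≠ 0) (v : Fock) :
    HasSum (fun m : ℤ => x ^ m * bra N (field b m v))
      (x ^ (eps b * N - 1) * bra (N - eps b) (gammaPlus (-(eps b • invPow x)) v)) := by
  rw [← braField_eq b N hx, braField_apply, finsum_eq_sum _ (bra_field_support b N x v)]
  exact hasSum_sum_of_ne_finset_zero fun m hm => by
    by_contra h
    exact hm ((Set.Finite.mem_toFinset _).2 h)

/-! ### Multiple series of products of fields -/

theorem hasSum_of_eq {ι : Type*} {f g : ι → ℂ} {a b : ℂ} (h : HasSum f a) (hf : ∀ i, g i = f i)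
    (hb : b = a) : HasSum g b := by
  rw [hb, funext hf]
  exact h

theorem hasSum_mul_prod {ι κ : Type*} {f : ι → ℂ} {g : κ → ℂ} {a b : ℂ} (hf : HasSum f a)
    (hg : HasSum g b) : HasSum (fun q : ι × κ => f q.1 * g q.2) (a * b) := by
  have hf' : Summable fun i => ‖f i‖ := hf.summable.norm
  have hg' : Summable fun i => ‖g i‖ := hg.summable.norm
  exact hf.mul hg (summable_mul_of_summable_norm hf' hg')

/-- The product of modes `φ_{1,k_1} φ_{2,k_2} ⋯ φ_{m,k_m}` of the fields of types `b`. -/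
def fieldProd {m : ℕ} (b : Fin m → Bool) (k : Fin m → ℤ) : Module.End ℂ Fock :=
  (List.ofFn fun p => field (b p) (k p)).prod

theorem fieldProd_succ {m : ℕ} (b : Fin (m + 1) → Bool) (k : Fin (m + 1) → ℤ) (v : Fock) :
    fieldProd b k v = field (b 0) (k 0) (fieldProd (b ∘ Fin.succ) (k ∘ Fin.succ) v) := by
  rw [fieldProd, List.ofFn_succ, List.prod_cons, Module.End.mul_apply]
  rfl

theorem fieldProd_ket {m : ℕ} (b : Fin m → Bool) (k : Fin m → ℤ) (S : Maya) :
    ∃ (c : ℂ) (T : Maya), fieldProd b k (ket S) = c • ket T := by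
  induction m with
  | zero => exact ⟨1, S, by simp [fieldProd]⟩
  | succ m ih =>
    obtain ⟨c, T, h⟩ := ih (b ∘ Fin.succ) (k ∘ Fin.succ)
    rw [fieldProd_succ, h, map_smul]
    rcases field_ket (b 0) (k 0) T with h0 | ⟨d, U, h0, -⟩
    · exact ⟨0, T, by rw [h0, smul_zero, zero_smul]⟩
    · exact ⟨c * d, U, by rw [h0, smul_smul]⟩

/-- The flow operator placed in front of the factor number `i` of a product of modes. -/
def mixedProd {m : ℕ} (b : Fin m → Bool) (t : ℕ+ → ℂ) (i : ℕ) (k : Fin m → ℤ) :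
    Module.End ℂ Fock :=
  ((List.ofFn fun p => field (b p) (k p)).take i).prod * gammaPlus t *
    ((List.ofFn fun p => field (b p) (k p)).drop i).prod

theorem mixedProd_zero {m : ℕ} (b : Fin m → Bool) (t : ℕ+ → ℂ) (k : Fin m → ℤ) :
    mixedProd b t 0 k = gammaPlus t * fieldProd b k := by
  rw [mixedProd, List.take_zero, List.drop_zero, List.prod_nil, one_mul, fieldProd]

theorem mixedProd_self {m : ℕ} (b : Fin m → Bool) (t : ℕ+ → ℂ) (k : Fin m → ℤ) :
    mixedProd b t m k = fieldProd b k * gammaPlus t := by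
  rw [mixedProd, List.take_of_length_le (by rw [List.length_ofFn]),
    List.drop_of_length_le (by rw [List.length_ofFn]), List.prod_nil, mul_one, fieldProd]

theorem hasSum_mixedProd {m : ℕ} (b : Fin m → Bool) (t : ℕ+ → ℂ) (p : Fin m) (k : Fin m → ℤ)
    (l : Module.Dual ℂ Fock) (v : Fock) :
    HasSum (fun j : ℕ => PowerSeries.coeff j (hSeries (eps (b p) • t)) *
        l (mixedProd b t (p + 1) (Function.update k p (k p - j)) v))
      (l (mixedProd b t p k v)) := by
  set L : (Fin m → ℤ) → List (Module.End ℂ Fock) := fun k => List.ofFn fun p => field (b p) (k p)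
  have hlen : ∀ k, (L k).length = m := fun k => List.length_ofFn
  have hget : ∀ k i (hi : i < (L k).length), (L k)[i] = field (b ⟨i, hlen k ▸ hi⟩)
      (k ⟨i, hlen k ▸ hi⟩) := fun k i hi => List.getElem_ofFn hi
  have htake : ∀ a, (L (Function.update k p a)).take p = (L k).take p := by
    intro a
    refine List.ext_getElem (by simp [hlen]) fun i h1 h2 => ?_
    have hi : i < p := by simp at h2; omega
    rw [List.getElem_take, List.getElem_take, hget, hget, Function.update_of_ne]
    exact Fin.ne_of_val_ne (by simpa using hi.ne)
  have hdrop : ∀ a, (L (Function.update k p a)).drop (p + 1) = (L k).drop (p + 1) := by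
    intro a
    refine List.ext_getElem (by simp [hlen]) fun i h1 h2 => ?_
    rw [List.getElem_drop, List.getElem_drop, hget, hget, Function.update_of_ne]
    exact Fin.ne_of_val_ne (by simp; omega)
  have h1 : ∀ a, mixedProd b t (p + 1) (Function.update k p a) v =
      ((L k).take p).prod (field (b p) a (gammaPlus t (((L k).drop (p + 1)).prod v))) := by
    intro a
    have hp : (p : ℕ) < (L (Function.update k p a)).length := by rw [hlen]; exact p.2
    have : mixedProd b t (p + 1) (Function.update k p a) =
      ((L (Function.update k p a)).take (p + 1)).prod * gammaPlus t *
        ((L (Function.update k p a)).drop (p + 1)).prod := rfl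
    rw [this, List.take_succ_eq_append_getElem hp, hdrop, htake, hget]
    simp
  have h2 : mixedProd b t p k v = ((L k).take p).prod (smear (b p) (k p) (hSeries (eps (b p) • t))
      (gammaPlus t (((L k).drop (p + 1)).prod v))) := by
    have hp : (p : ℕ) < (L k).length := by rw [hlen]; exact p.2
    have : mixedProd b t p k = ((L k).take p).prod * gammaPlus t * ((L k).drop p).prod := rfl
    rw [this, List.drop_eq_getElem_cons hp, hget, ← gammaPlus_field]
    simp
  rw [h2]
  simp only [h1]
  exact hasSum_smear (l ∘ₗ ((L k).take p).prod) _ _ _ _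

/-- Moving one mode number and recording the displacement. -/
def shiftEquiv {m : ℕ} (p : Fin m) : (Fin m → ℤ) × ℕ ≃ ℕ × (Fin m → ℤ) where
  toFun q := (q.2, Function.update q.1 p (q.1 p - q.2))
  invFun q := (Function.update q.2 p (q.2 p + q.1), q.1)
  left_inv q := by simp
  right_inv q := by simp

theorem prod_zpow_update {m : ℕ} {x : Fin m → ℂ} (hx : ∀ p, x p ≠ 0) (p : Fin m) (k : Fin m → ℤ)
    (j : ℕ) : x p ^ j * ∏ q, x q ^ (Function.update k p (k p - j) q) = ∏ q, x q ^ k q := by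
  rw [← Finset.mul_prod_erase _ _ (Finset.mem_univ p),
    ← Finset.mul_prod_erase _ (fun q => x q ^ k q) (Finset.mem_univ p), ← mul_assoc,
    Function.update_self, ← zpow_natCast, ← zpow_add₀ (hx p), add_sub_cancel]
  congr 1
  refine Finset.prod_congr rfl fun q hq => ?_
  rw [Function.update_of_ne (Finset.ne_of_mem_erase hq)]

/-- The flow operator can be moved past a product of fields inside an absolutely convergent
multiple series, which multiplies the sum by the values `E` of the series `exp (± ξ(t, x))`. -/
theorem hasSum_fieldProd_gammaPlus {m : ℕ} {b : Fin m → Bool} {x : Fin m → ℂ} {t : ℕ+ → ℂ}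
    {E : Fin m → ℂ} {l : Module.Dual ℂ Fock} {v : Fock} {V : ℂ} (hx : ∀ p, x p ≠ 0)
    (hE : ∀ p, HasSum (fun j : ℕ => PowerSeries.coeff j (hSeries (eps (b p) • t)) * x p ^ j) (E p))
    (h : HasSum (fun k : Fin m → ℤ => (∏ p, x p ^ k p) * l (fieldProd b k (gammaPlus t v))) V) :
    HasSum (fun k : Fin m → ℤ => (∏ p, x p ^ k p) * l (gammaPlus t (fieldProd b k v)))
      ((∏ p, E p) * V) := by
  have key : ∀ i : ℕ, i ≤ m → HasSum
      (fun k : Fin m → ℤ => (∏ p, x p ^ k p) * l (mixedProd b t (m - i) k v))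
      ((∏ p with m - i ≤ (p : Fin m).val, E p) * V) := by
    intro i
    induction i with
    | zero =>
      intro _
      have h1 : (Finset.univ.filter fun p : Fin m => m - 0 ≤ p.val) = ∅ :=
        Finset.filter_eq_empty_iff.2 fun p _ => by have := p.2; omega
      rw [h1, Finset.prod_empty, one_mul]
      simp only [Nat.sub_zero, mixedProd_self, Module.End.mul_apply]
      exact h
    | succ i ih =>
      intro hi
      obtain ⟨p, hpi⟩ : ∃ p : Fin m, (p : ℕ) = m - (i + 1) := ⟨⟨m - (i + 1), by omega⟩, rfl⟩
      have hp : m - i = p + 1 := by omega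
      have h1 := ih (by omega)
      rw [hp] at h1
      have h2 := hasSum_mul_prod (hE p) h1
      have h3 := (shiftEquiv p).hasSum_iff.2 h2
      have h4 : (Finset.univ.filter fun q : Fin m => m - (i + 1) ≤ q.val) =
          insert p (Finset.univ.filter fun q : Fin m => (p : ℕ) + 1 ≤ q.val) := by
        ext q
        simp only [Finset.mem_filter, Finset.mem_univ, true_and, Finset.mem_insert, Fin.ext_iff]
        omega
      rw [h4, Finset.prod_insert (by simp), mul_assoc, ← hpi]
      refine h3.prod_fiberwise fun k => ?_
      have h5 := (hasSum_mixedProd b t p k l v).mul_left (∏ p, x p ^ k p)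
      refine Eq.subst (motive := fun F => HasSum F _) (funext fun j => ?_) h5
      simp only [Function.comp, shiftEquiv, Equiv.coe_fn_mk]
      rw [← prod_zpow_update hx p k j]
      ring
  have h1 := key m le_rfl
  have h2 : (Finset.univ.filter fun p : Fin m => m - m ≤ p.val) = Finset.univ :=
    Finset.filter_true_of_mem fun p _ => by omega
  rw [h2] at h1
  simpa only [Nat.sub_self, mixedProd_zero, Module.End.mul_apply] using h1

/-- The scalar factor of the radially ordered product of the fields `b` with arguments `x`, for the
covector of charge `M` on the right. -/
def orderedFactor {m : ℕ} (b : Fin m → Bool) (x : Fin m → ℂ) (M : ℤ) : ℂ :=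
  (∏ p, x p ^ (eps (b p) * M)) *
    ∏ p, ∏ q ∈ Finset.Ioi p, (x p - x q) ^ (eps (b p) * eps (b q))

theorem orderedFactor_succ {m : ℕ} (b : Fin (m + 1) → Bool) {x : Fin (m + 1) → ℂ}
    (hx : x 0 ≠ 0) (N : ℤ) :
    orderedFactor b x (N - ∑ p, eps (b p)) =
      x 0 ^ (eps (b 0) * N - 1) *
        ((∏ q : Fin m, (1 - x q.succ / x 0) ^ (eps (b 0) * eps (b q.succ))) *
          orderedFactor (b ∘ Fin.succ) (x ∘ Fin.succ)
            (N - eps (b 0) - ∑ p : Fin m, eps (b p.succ))) := by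
  have hM : N - ∑ p, eps (b p) = N - eps (b 0) - ∑ p : Fin m, eps (b p.succ) := by
    rw [Fin.sum_univ_succ]; ring
  rw [hM]
  generalize hM' : N - eps (b 0) - ∑ p : Fin m, eps (b p.succ) = M
  have h1 : ∏ q : Fin m, (1 - x q.succ / x 0) ^ (eps (b 0) * eps (b q.succ)) =
      (∏ q : Fin m, (x 0 - x q.succ) ^ (eps (b 0) * eps (b q.succ))) *
        x 0 ^ (-(eps (b 0) * ∑ p : Fin m, eps (b p.succ))) := by
    have h2 : x 0 ^ (-(eps (b 0) * ∑ p : Fin m, eps (b p.succ))) =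
        ∏ q : Fin m, x 0 ^ (-(eps (b 0) * eps (b q.succ))) := by
      rw [Finset.mul_sum, ← Finset.sum_neg_distrib]
      induction (Finset.univ : Finset (Fin m)) using Finset.induction_on with
      | empty => simp
      | insert a s ha ih => rw [Finset.sum_insert ha, Finset.prod_insert ha, zpow_add₀ hx, ih]
    rw [h2, ← Finset.prod_mul_distrib]
    refine Finset.prod_congr rfl fun q _ => ?_
    rw [zpow_neg, ← div_eq_mul_inv, ← div_zpow, sub_div, div_self hx]
  have h3 : x 0 ^ (eps (b 0) * M) =
      x 0 ^ (eps (b 0) * N - 1) * x 0 ^ (-(eps (b 0) * ∑ p : Fin m, eps (b p.succ))) := by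
    rw [← zpow_add₀ hx, ← hM', mul_sub, mul_sub, eps_mul_self]
    congr 1
  rw [orderedFactor, orderedFactor, h1, Fin.prod_univ_succ, Fin.prod_univ_succ, h3,
    Fin.prod_Ioi_zero]
  simp only [Fin.prod_Ioi_succ, Function.comp]
  ring

/-- The factor which a field `c` at `y` acquires when the field `b` at `x` is bosonized. -/
theorem hasSum_hSeries_contraction {b c : Bool} {x y : ℂ} (hx : x ≠ 0) (h : b ≠ c → ‖y‖ < ‖x‖) :
    HasSum (fun j : ℕ => PowerSeries.coeff j (hSeries (eps c • -(eps b • invPow x))) * y ^ j)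
      ((1 - y / x) ^ (eps b * eps c)) := by
  by_cases hc : b = c
  · subst hc
    rw [eps_mul_self, smul_neg, smul_smul, eps_mul_self, one_smul, zpow_one, hSeries_neg_invPow]
    have : HasSum (fun j : ℕ => PowerSeries.coeff j
        (1 - PowerSeries.C x⁻¹ * PowerSeries.X : PowerSeries ℂ) * y ^ j)
        (∑ j ∈ Finset.range 2, PowerSeries.coeff j
          (1 - PowerSeries.C x⁻¹ * PowerSeries.X : PowerSeries ℂ) * y ^ j) := by
      refine hasSum_sum_of_ne_finset_zero fun j hj => ?_
      obtain ⟨i, rfl⟩ := Nat.exists_eq_add_of_le (not_lt.1 (mt Finset.mem_range.2 hj))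
      rw [add_comm]
      simp [PowerSeries.coeff_one]
    refine hasSum_of_eq this (fun _ => rfl) ?_
    rw [Finset.sum_range_succ, Finset.sum_range_one]
    simp [PowerSeries.coeff_one]
    field_simp
    ring
  · have hc' : c = !b := by cases c <;> cases b <;> simp_all
    subst hc'
    rw [eps_not, mul_neg, eps_mul_self, smul_neg, smul_smul, neg_mul, eps_mul_self, neg_smul,
      neg_neg, one_smul, hSeries_invPow, zpow_neg_one]
    have := hasSum_geometric_of_norm_lt_one (ξ := y / x) (by
      rw [norm_div, div_lt_one (norm_pos_iff.2 hx)]; exact h (by simp))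
    refine hasSum_of_eq this (fun j => ?_) rfl
    rw [PowerSeries.coeff_mk, div_pow, inv_pow, div_eq_inv_mul]

theorem hasSum_norm_of_subsingleton {ι : Type*} {g : ι → ℂ} {c : ℂ}
    (h : ∀ a a', g a ≠ 0 → g a' ≠ 0 → a = a') (hg : HasSum g c) :
    HasSum (fun a => ‖g a‖) ‖c‖ := by
  by_cases h0 : ∃ a, g a ≠ 0
  · obtain ⟨a, ha⟩ := h0
    have h1 : ∀ a', a' ≠ a → g a' = 0 := fun a' ha' => by
      by_contra h2; exact ha' (h _ _ h2 ha)
    rw [hg.unique (hasSum_single a h1)]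
    exact hasSum_single a fun a' ha' => by rw [h1 a' ha', norm_zero]
  · push Not at h0
    have h1 : g = fun _ => 0 := funext h0
    subst h1
    rw [hg.unique hasSum_zero]
    simp

/-- Radially ordered products of fields between a vacuum covector and an arbitrary vector: the
multiple series converges absolutely, and the product of the fields acts as a multiple of a flow
operator. -/
theorem hasSum_fieldProd {m : ℕ} {b : Fin m → Bool} {x : Fin m → ℂ} (hx : ∀ p, x p ≠ 0)
    (hr : ∀ p q, p < q → b p ≠ b q → ‖x q‖ < ‖x p‖) (N : ℤ) (v : Fock) :
    HasSum (fun k : Fin m → ℤ => (∏ p, x p ^ k p) * bra N (fieldProd b k v))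
      (orderedFactor b x (N - ∑ p, eps (b p)) *
        bra (N - ∑ p, eps (b p)) (gammaPlus (-∑ p, eps (b p) • invPow (x p)) v)) := by
  induction m generalizing N v with
  | zero =>
    have := hasSum_unique (fun k : Fin 0 → ℤ => (∏ p, x p ^ k p) * bra N (fieldProd b k v))
    refine hasSum_of_eq this (fun _ => rfl) ?_
    simp [orderedFactor, fieldProd, gammaPlus_zero]
  | succ m ih =>
    refine Fock.induction (p := fun v => HasSum
      (fun k : Fin (m + 1) → ℤ => (∏ p, x p ^ k p) * bra N (fieldProd b k v))
      (orderedFactor b x (N - ∑ p, eps (b p)) *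
        bra (N - ∑ p, eps (b p)) (gammaPlus (-∑ p, eps (b p) • invPow (x p)) v))) ?_ ?_ ?_ v
    · simp
    · intro u v hu hv
      simpa only [map_add, mul_add] using hu.add hv
    intro a S
    simp only [map_smul, smul_eq_mul, mul_left_comm _ a]
    refine HasSum.mul_left a ?_
    set s : ℕ+ → ℂ := -(eps (b 0) • invPow (x 0)) with hs
    have h1 : ∀ k' : Fin m → ℤ, HasSum (fun k₀ : ℤ => (∏ p : Fin m, x p.succ ^ k' p) *
        (x 0 ^ k₀ * bra N (field (b 0) k₀ (fieldProd (b ∘ Fin.succ) k' (ket S)))))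
        ((∏ p : Fin m, x p.succ ^ k' p) * (x 0 ^ (eps (b 0) * N - 1) *
          bra (N - eps (b 0)) (gammaPlus s (fieldProd (b ∘ Fin.succ) k' (ket S))))) := fun k' =>
      (hasSum_bra_field (b 0) N (hx 0) _).mul_left _
    -- for a fixed choice of the other modes at most one term is nonzero
    have h2 : ∀ k' : Fin m → ℤ, HasSum (fun k₀ : ℤ => ‖(∏ p : Fin m, x p.succ ^ k' p) *
        (x 0 ^ k₀ * bra N (field (b 0) k₀ (fieldProd (b ∘ Fin.succ) k' (ket S))))‖)
        ‖(∏ p : Fin m, x p.succ ^ k' p) * (x 0 ^ (eps (b 0) * N - 1) *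
          bra (N - eps (b 0)) (gammaPlus s (fieldProd (b ∘ Fin.succ) k' (ket S))))‖ := by
      intro k'
      refine hasSum_norm_of_subsingleton (fun k₀ k₁ h h' => ?_) (h1 k')
      obtain ⟨c, T, hT⟩ := fieldProd_ket (b ∘ Fin.succ) k' S
      rw [hT, map_smul, map_smul, smul_eq_mul] at h h'
      exact bra_field_ket_unique
        (right_ne_zero_of_mul (right_ne_zero_of_mul (right_ne_zero_of_mul h)))
        (right_ne_zero_of_mul (right_ne_zero_of_mul (right_ne_zero_of_mul h')))
    have h3 := ih (b := b ∘ Fin.succ) (x := x ∘ Fin.succ) (fun p => hx p.succ)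
      (fun p q hpq h => hr p.succ q.succ (Fin.succ_lt_succ_iff.2 hpq) h) (N - eps (b 0))
      (gammaPlus s (ket S))
    have h4 := (hasSum_fieldProd_gammaPlus (t := s) (fun p => hx p.succ)
      (fun p => hasSum_hSeries_contraction (hx 0) (hr 0 p.succ p.succ_pos)) h3).mul_left
      (x 0 ^ (eps (b 0) * N - 1))
    simp only [mul_left_comm (x 0 ^ (eps (b 0) * N - 1))] at h4
    have h5 : Summable fun q : (Fin m → ℤ) × ℤ => (∏ p : Fin m, x p.succ ^ q.1 p) *
        (x 0 ^ q.2 * bra N (field (b 0) q.2 (fieldProd (b ∘ Fin.succ) q.1 (ket S)))) := by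
      refine Summable.of_norm ?_
      rw [summable_prod_of_nonneg fun q => norm_nonneg _]
      refine ⟨fun k' => (h2 k').summable, ?_⟩
      simp only [fun k' => (h2 k').tsum_eq]
      exact h4.summable.norm
    have h6 := h5.hasSum
    rw [(h6.prod_fiberwise h1).unique h4] at h6
    have h7 := (((Fin.consEquiv fun _ : Fin (m + 1) => ℤ).symm.trans
      (Equiv.prodComm _ _)).hasSum_iff).2 h6
    refine hasSum_of_eq h7 (fun k => ?_) ?_
    · rw [Fin.prod_univ_succ, fieldProd_succ]
      simp only [Function.comp, Equiv.trans_apply, Fin.consEquiv_symm_apply, Equiv.prodComm_apply,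
        Prod.swap_prod_mk]
      change _ = (∏ p : Fin m, x p.succ ^ k p.succ) * (x 0 ^ k 0 *
        bra N (field (b 0) (k 0) (fieldProd (b ∘ Fin.succ) (k ∘ Fin.succ) (ket S))))
      ring
    · rw [orderedFactor_succ b (hx 0), ← gammaPlus_add, Fin.sum_univ_succ, Fin.sum_univ_succ]
      have h8 : -(eps (b 0) • invPow (x 0) + ∑ p : Fin m, eps (b p.succ) • invPow (x p.succ)) =
          -(∑ p : Fin m, eps ((b ∘ Fin.succ) p) • invPow ((x ∘ Fin.succ) p)) + s := by
        rw [hs, neg_add_rev]; rfl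
      rw [h8, ← sub_sub]
      simp only [Function.comp]
      ring

/-! ### The Cauchy determinant and interpolation -/

/-- The product of all differences `v_j - v_i`, `i < j`. -/
def vdm {n : ℕ} (v : Fin n → ℂ) : ℂ := ∏ i, ∏ j ∈ Finset.Ioi i, (v j - v i)

/-- The value of the Cauchy determinant `det (1 / (z_i - w_j))`. -/
def cauchyValue {n : ℕ} (z w : Fin n → ℂ) : ℂ :=
  (∏ i, ∏ j ∈ Finset.Ioi i, ((z i - z j) * (w j - w i))) * ∏ i, ∏ j, (z i - w j)⁻¹

theorem vdm_succAbove {n : ℕ} (v : Fin (n + 1) → ℂ) (j : Fin (n + 1)) :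
    vdm v = (-1) ^ (j : ℕ) * (∏ k : Fin n, (v (j.succAbove k) - v j)) * vdm (v ∘ j.succAbove) := by
  have h := Equiv.Perm.prod_Ioi_comp_eq_sign_mul_prod j.cycleRange.symm (f := fun a b => v b - v a)
    fun a b => (neg_sub _ _).symm
  rw [Equiv.Perm.sign_symm, Fin.sign_cycleRange, Fin.prod_univ_succ, Fin.prod_Ioi_zero] at h
  simp only [Fin.prod_Ioi_succ, Fin.cycleRange_symm_zero, Fin.cycleRange_symm_succ] at h
  have h2 : (((-1 : ℤˣ) ^ (j : ℕ) : ℤˣ) : ℤ) = (-1) ^ (j : ℕ) := by push_cast; rfl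
  rw [h2] at h
  push_cast at h
  change _ = (-1) ^ (j : ℕ) * vdm v at h
  rw [mul_assoc]
  change _ = (-1) ^ (j : ℕ) * (_ * ∏ i, ∏ k ∈ Finset.Ioi i, (v (j.succAbove k) - v (j.succAbove i)))
  rw [h, ← mul_assoc, ← pow_add, Even.neg_one_pow ⟨_, rfl⟩, one_mul]

theorem vdm_eq_zero {n : ℕ} {v : Fin n → ℂ} (h : ¬ Function.Injective v) : vdm v = 0 := by
  simp only [Function.Injective, not_forall] at h
  obtain ⟨i, j, hij, hne⟩ := h
  rcases lt_or_gt_of_ne hne with hlt | hlt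
  · exact Finset.prod_eq_zero (Finset.mem_univ i)
      (Finset.prod_eq_zero (Finset.mem_Ioi.2 hlt) (by rw [hij, sub_self]))
  · exact Finset.prod_eq_zero (Finset.mem_univ j)
      (Finset.prod_eq_zero (Finset.mem_Ioi.2 hlt) (by rw [hij, sub_self]))

theorem cauchyValue_eq {n : ℕ} (z w : Fin n → ℂ) :
    cauchyValue z w = vdm (fun i => -z i) * vdm w * ∏ i, ∏ j, (z i - w j)⁻¹ := by
  simp only [cauchyValue, vdm, ← Finset.prod_mul_distrib, neg_sub_neg]

/-- The residue of `∏_{i ≥ 1} (x - z_i) / ∏_k (x - w_k)` at `x = w_j`. -/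
def residue {n : ℕ} (z w : Fin (n + 1) → ℂ) (j : Fin (n + 1)) : ℂ :=
  (∏ i : Fin n, (w j - z i.succ)) / ∏ k : Fin n, (w j - w (j.succAbove k))

/-- The value of `∏_{i ≥ 1} (x - z_i) / ∏_k (x - w_k)` at `x = z_0`. -/
def valueAtZero {n : ℕ} (z w : Fin (n + 1) → ℂ) : ℂ :=
  (∏ i : Fin n, (z 0 - z i.succ)) / ∏ k, (z 0 - w k)

theorem valueAtZero_ne_zero {n : ℕ} {z w : Fin (n + 1) → ℂ} (hz : Function.Injective z)
    (h : ∀ i j, z i ≠ w j) : valueAtZero z w ≠ 0 :=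
  div_ne_zero (Finset.prod_ne_zero_iff.2 fun _ _ => sub_ne_zero.2
      fun he => (Fin.succ_ne_zero _).symm (hz he))
    (Finset.prod_ne_zero_iff.2 fun _ _ => sub_ne_zero.2 (h _ _))

theorem cauchyValue_mul_residue {n : ℕ} {z w : Fin (n + 1) → ℂ} (hw : Function.Injective w)
    (h : ∀ i j, z i ≠ w j) (j : Fin (n + 1)) :
    cauchyValue z w * residue z w j =
      valueAtZero z w * ((-1) ^ (j : ℕ) * cauchyValue (z ∘ Fin.succ) (w ∘ j.succAbove)) := by
  have e1 : ∏ k : Fin n, (w j - w (j.succAbove k)) =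
      (-1) ^ n * ∏ k : Fin n, (w (j.succAbove k) - w j) := by
    rw [← Fin.prod_const, ← Finset.prod_mul_distrib]
    exact Finset.prod_congr rfl fun _ _ => by ring
  have e2 : ∏ k : Fin n, (w j - z k.succ) = (-1) ^ n * ∏ k : Fin n, (z k.succ - w j) := by
    rw [← Fin.prod_const, ← Finset.prod_mul_distrib]
    exact Finset.prod_congr rfl fun _ _ => by ring
  have n1 : ∏ k : Fin n, (w (j.succAbove k) - w j) ≠ 0 := Finset.prod_ne_zero_iff.2 fun k _ =>
    sub_ne_zero.2 fun he => j.succAbove_ne k (hw he)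
  have n2 : ∏ k : Fin n, (z k.succ - w j) ≠ 0 := Finset.prod_ne_zero_iff.2 fun k _ =>
    sub_ne_zero.2 (h _ _)
  have n3 : ((-1 : ℂ) ^ n) ≠ 0 := pow_ne_zero _ (by norm_num)
  have n4 : ∏ k, (z 0 - w k) ≠ 0 := Finset.prod_ne_zero_iff.2 fun k _ => sub_ne_zero.2 (h _ _)
  have e3 : ∏ i, ∏ j, (z i - w j)⁻¹ = (∏ k, (z 0 - w k))⁻¹ * ((∏ k : Fin n, (z k.succ - w j))⁻¹ *
      ∏ i : Fin n, ∏ k : Fin n, (z i.succ - w (j.succAbove k))⁻¹) := by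
    rw [Fin.prod_univ_succ, Finset.prod_inv_distrib,
      ← Finset.prod_inv_distrib (fun k : Fin n => z k.succ - w j), ← Finset.prod_mul_distrib]
    congr 1
    exact Finset.prod_congr rfl fun i _ => Fin.prod_univ_succAbove _ j
  have e4 : vdm (fun i => -z i) = (∏ i : Fin n, (z 0 - z i.succ)) *
      vdm (fun i : Fin n => -(z ∘ Fin.succ) i) := by
    rw [vdm_succAbove _ 0]
    simp only [Fin.val_zero, pow_zero, one_mul, Fin.succAbove_zero, neg_sub_neg]
    rfl
  rw [cauchyValue_eq, cauchyValue_eq, vdm_succAbove w j, e3, e4, residue, valueAtZero, e1, e2]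
  simp only [Function.comp_apply]
  change (∏ i : Fin n, (z 0 - z i.succ)) * vdm (fun i : Fin n => -z i.succ) *
    ((-1) ^ (j : ℕ) * (∏ k : Fin n, (w (j.succAbove k) - w j)) * vdm (w ∘ j.succAbove)) * _ * _ = _
  field_simp

open Polynomial in
/-- Partial fractions: up to a constant factor, `x ∏_{i ≥ 1} (1 - x / z_i)` interpolates with the
nodes `z_0` and `w_j`. -/
theorem partial_fractions {n : ℕ} {z w : Fin (n + 1) → ℂ} (hw : Function.Injective w)
    (hz0 : ∀ i, z i ≠ 0) (hw0 : ∀ i, w i ≠ 0) (h : ∀ i j, z i ≠ w j) :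
    ∃ K : ℂ, C (valueAtZero z w) * ∏ k, (1 - C (w k)⁻¹ * X) -
      ∑ j, C (residue z w j / (z 0 - w j)) * ((1 - C (z 0)⁻¹ * X) *
        ∏ k : Fin n, (1 - C (w (j.succAbove k))⁻¹ * X)) =
      C K * (X * ∏ i : Fin n, (1 - C (z i.succ)⁻¹ * X)) := by
  have hsub : ∀ a b : ℂ, b ≠ 0 → 1 - b⁻¹ * a = -(b⁻¹ * (a - b)) := fun a b hb => by
    rw [mul_sub, inv_mul_cancel₀ hb]; ring
  have hprod : ∀ (m : ℕ) (u : Fin m → ℂ) (a : ℂ), (∀ k, u k ≠ 0) →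
      ∏ k, (1 - (u k)⁻¹ * a) = (-1) ^ m * ((∏ k, (u k))⁻¹ * ∏ k, (a - u k)) := by
    intro m u a hu
    rw [← Finset.prod_inv_distrib, ← Fin.prod_const, ← Finset.prod_mul_distrib,
      ← Finset.prod_mul_distrib]
    exact Finset.prod_congr rfl fun k _ => by rw [hsub _ _ (hu k)]; ring
  have dlin : ∀ c : ℂ, (1 - C c * X : ℂ[X]).natDegree ≤ 1 := fun c => by
    compute_degree
  have dprod : ∀ (m : ℕ) (u : Fin m → ℂ), (∏ k, (1 - C (u k)⁻¹ * X) : ℂ[X]).natDegree ≤ m := by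
    intro m u
    refine (natDegree_prod_le _ _).trans ((Finset.sum_le_card_nsmul _ _ 1 fun k _ => dlin _).trans ?_)
    simp
  have dpair : ∀ (p q : ℂ[X]) (c : ℂ), p.natDegree ≤ 1 → q.natDegree ≤ n →
      (C c * (p * q)).natDegree ≤ n + 1 := fun p q c hp hq =>
    (natDegree_C_mul_le _ _).trans (natDegree_mul_le.trans (by omega))
  refine ⟨-(∏ i : Fin n, z i.succ) / (z 0 * ∏ k, w k), ?_⟩
  have hcard : ((n + 1 : ℕ) : WithBot ℕ) < ((Finset.univ : Finset (Fin (n + 2))).card : ℕ) := by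
    rw [Finset.card_univ, Fintype.card_fin]
    exact_mod_cast Nat.lt_succ_self _
  refine eq_of_degrees_lt_of_eval_finset_eq (Finset.image (Fin.cons (z 0) w : Fin (n + 2) → ℂ)
    Finset.univ) ?_ ?_ ?_
  · rw [Finset.card_image_of_injective]
    · refine lt_of_le_of_lt (natDegree_le_iff_degree_le.1 (?_ : natDegree _ ≤ n + 1)) hcard
      refine (natDegree_sub_le _ _).trans (max_le ?_ ?_)
      · exact (natDegree_C_mul_le _ _).trans (dprod _ w)
      · refine natDegree_sum_le_of_forall_le _ _ fun j _ => dpair _ _ _ (dlin _) (dprod _ _)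
    · rw [Fin.cons_injective_iff]
      exact ⟨fun ⟨j, hj⟩ => h 0 j hj.symm, hw⟩
  · rw [Finset.card_image_of_injective]
    · refine lt_of_le_of_lt (natDegree_le_iff_degree_le.1 (?_ : natDegree _ ≤ n + 1)) hcard
      exact dpair _ _ _ natDegree_X_le (dprod _ _)
    · rw [Fin.cons_injective_iff]
      exact ⟨fun ⟨j, hj⟩ => h 0 j hj.symm, hw⟩
  have n4 : ∏ k, (z 0 - w k) ≠ 0 := Finset.prod_ne_zero_iff.2 fun k _ => sub_ne_zero.2 (h _ _)
  have n5 : ∏ k : Fin n, z k.succ ≠ 0 := Finset.prod_ne_zero_iff.2 fun k _ => hz0 _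
  have n6 : ∏ k, w k ≠ 0 := Finset.prod_ne_zero_iff.2 fun k _ => hw0 _
  intro x hx
  simp only [Finset.mem_image, Finset.mem_univ, true_and] at hx
  obtain ⟨a, rfl⟩ := hx
  simp only [eval_sub, eval_mul, eval_C, eval_finsetSum, eval_prod, eval_one, eval_X]
  refine Fin.cases ?_ (fun j => ?_) a
  · simp only [Fin.cons_zero, inv_mul_cancel₀ (hz0 0), sub_self, zero_mul, mul_zero,
      Finset.sum_const_zero, sub_zero]
    rw [hprod _ w _ hw0, hprod _ (fun i => z i.succ) _ fun i => hz0 _, valueAtZero]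
    have := hz0 0
    field_simp
    ring
  · simp only [Fin.cons_succ]
    rw [Finset.prod_eq_zero (Finset.mem_univ j) (by rw [inv_mul_cancel₀ (hw0 j), sub_self]),
      Finset.sum_eq_single j]
    · have n1 : ∏ k : Fin n, (w j - w (j.succAbove k)) ≠ 0 := Finset.prod_ne_zero_iff.2 fun k _ =>
        sub_ne_zero.2 fun he => j.succAbove_ne k (hw he.symm)
      have n7 : ∏ k : Fin n, w (j.succAbove k) ≠ 0 := Finset.prod_ne_zero_iff.2 fun k _ => hw0 _
      have n8 : z 0 - w j ≠ 0 := sub_ne_zero.2 (h _ _)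
      have := hz0 0
      have := hw0 j
      rw [hprod _ (fun k => w (j.succAbove k)) _ fun i => hw0 _,
        hprod _ (fun i => z i.succ) _ fun i => hz0 _, residue, hsub _ _ (hz0 0),
        Fin.prod_univ_succAbove w j]
      have n9 : w j - z 0 = -(z 0 - w j) := by ring
      rw [n9]
      field_simp
      ring
    · intro k _ hkj
      obtain ⟨i, hi⟩ := Fin.exists_succAbove_eq hkj.symm
      rw [Finset.prod_eq_zero (Finset.mem_univ i) (by rw [hi, inv_mul_cancel₀ (hw0 j), sub_self]),
        mul_zero, mul_zero]
    · simp

theorem valueAtZero_eq {n : ℕ} {z w : Fin (n + 1) → ℂ} (hw : Function.Injective w)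
    (hz0 : ∀ i, z i ≠ 0) (hw0 : ∀ i, w i ≠ 0) (h : ∀ i j, z i ≠ w j) :
    valueAtZero z w = ∑ j, residue z w j / (z 0 - w j) := by
  obtain ⟨K, hK⟩ := partial_fractions hw hz0 hw0 h
  have := congrArg (Polynomial.eval 0) hK
  simpa [Polynomial.eval_finsetSum, Polynomial.eval_prod, sub_eq_zero] using this

theorem cauchyValue_of_not_injective {n : ℕ} {z w : Fin n → ℂ}
    (h : ¬ (Function.Injective z ∧ Function.Injective w)) : cauchyValue z w = 0 := by
  rw [cauchyValue_eq]
  rw [not_and_or] at h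
  rcases h with h | h
  · rw [vdm_eq_zero (v := fun i => -z i), zero_mul, zero_mul]
    exact fun h' => h fun a b hab => h' (by simp only [hab])
  · rw [vdm_eq_zero h, mul_zero, zero_mul]

/-- A determinant whose entries are built from the rows `z_i` and columns `w_j` vanishes if two
of the `z_i`, or two of the `w_j`, coincide. -/
theorem det_of_not_injective {R : Type*} [CommRing R] {n : ℕ} {z w : Fin n → ℂ}
    (F : ℂ → ℂ → R) (h : ¬ (Function.Injective z ∧ Function.Injective w)) :
    (Matrix.of fun i j => F (z i) (w j)).det = 0 := by
  rw [not_and_or] at h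
  rcases h with h | h
  all_goals
    simp only [Function.Injective, not_forall] at h
    obtain ⟨i, j, hij, hne⟩ := h
  · exact Matrix.det_zero_of_row_eq hne (funext fun k => by simp only [Matrix.of_apply, hij])
  · exact Matrix.det_zero_of_column_eq hne fun k => by simp only [Matrix.of_apply, hij]

/-- Cauchy's determinant.  Expand along the first row, and use that the minors are proportional to
the residues whose partial fraction sum is `valueAtZero`. -/
theorem det_cauchyMatrix {n : ℕ} (z w : Fin n → ℂ) (hz0 : ∀ i, z i ≠ 0) (hw0 : ∀ i, w i ≠ 0)
    (h : ∀ i j, z i ≠ w j) : (cauchyMatrix z w).det = cauchyValue z w := by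
  by_cases hinj : Function.Injective z ∧ Function.Injective w
  swap
  · rw [cauchyValue_of_not_injective hinj]
    exact det_of_not_injective (fun a b => 1 / (a - b)) hinj
  induction n with
  | zero => simp [cauchyValue]
  | succ n ih =>
    refine mul_left_cancel₀ (valueAtZero_ne_zero hinj.1 h) ?_
    rw [Matrix.det_succ_row_zero, Finset.mul_sum]
    calc _ = ∑ j, residue z w j / (z 0 - w j) * cauchyValue z w := by
          refine Finset.sum_congr rfl fun j _ => ?_
          have h1 : (cauchyMatrix z w).submatrix Fin.succ j.succAbove =
            cauchyMatrix (z ∘ Fin.succ) (w ∘ j.succAbove) := rfl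
          rw [h1, ih (z ∘ Fin.succ) (w ∘ j.succAbove) (fun _ => hz0 _) (fun _ => hw0 _) (fun _ _ => h _ _)
            ⟨hinj.1.comp (Fin.succ_injective _), hinj.2.comp Fin.succAbove_right_injective⟩,
            div_mul_eq_mul_div, mul_comm (residue z w j), cauchyValue_mul_residue hinj.2 h,
            cauchyMatrix, Matrix.of_apply]
          ring
      _ = _ := by rw [← Finset.sum_mul, ← valueAtZero_eq hinj.2 hz0 hw0 h]

/-! ### Dependence of the flow operator on the times -/

theorem continuous_flowGen_pow (p : ℕ) (l : Module.Dual ℂ Fock) (v : Fock) :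
    Continuous fun t : ℕ+ → ℂ => l ((flowGen t ^ p) v) := by
  induction p generalizing v with
  | zero => simpa using continuous_const
  | succ p ih =>
    set F := (flowGen_support 1 v).toFinset with hF
    have h1 : ∀ t : ℕ+ → ℂ, flowGen t v = ∑ k ∈ F, t k • current k v := by
      intro t
      rw [flowGen_apply]
      refine finsum_eq_sum_of_support_subset _ fun k hk => ?_
      rw [hF, Set.Finite.coe_toFinset]
      intro h0
      refine hk ?_
      simp only [Pi.one_apply, one_smul] at h0
      simp only [h0, smul_zero]
    have h2 : (fun t : ℕ+ → ℂ => l ((flowGen t ^ (p + 1)) v)) =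
        fun t => ∑ k ∈ F, t k * l ((flowGen t ^ p) (current k v)) := by
      funext t
      rw [pow_succ, Module.End.mul_apply, h1, map_sum, map_sum]
      simp only [map_smul, smul_eq_mul]
    rw [h2]
    exact continuous_finsetSum _ fun k _ => (continuous_apply k).mul (ih _)

theorem continuous_gammaPlus (l : Module.Dual ℂ Fock) (v : Fock) :
    Continuous fun t : ℕ+ → ℂ => l (gammaPlus t v) := by
  obtain ⟨e, he⟩ := exists_mem_lowEnergy v
  have h : (fun t : ℕ+ → ℂ => l (gammaPlus t v)) =
      fun t => ∑ p ∈ Finset.range (e + 1), ((p ! : ℂ)⁻¹) * l ((flowGen t ^ p) v) := by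
    funext t
    rw [gammaPlus_eq_sum t he (Nat.lt_succ_self e), map_sum]
    simp only [map_smul, smul_eq_mul]
  rw [h]
  exact continuous_finsetSum _ fun p _ => continuous_const.mul (continuous_flowGen_pow p l v)

theorem hasSum_xi {t : ℕ+ → ℂ} {r : ℝ} (ht : Summable fun k : ℕ+ => ‖t k‖ * r ^ (k : ℕ)) {x : ℂ}
    (hx : ‖x‖ ≤ r) : HasSum (fun k : ℕ+ => t k * x ^ (k : ℕ)) (xi t x) := by
  refine Summable.hasSum (Summable.of_norm_bounded ht fun k => ?_)
  rw [norm_mul, norm_pow]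
  exact mul_le_mul_of_nonneg_left (pow_le_pow_left₀ (norm_nonneg _) hx _) (norm_nonneg _)

theorem continuousAt_xi {t : ℕ+ → ℂ} {r : ℝ} (ht : Summable fun k : ℕ+ => ‖t k‖ * r ^ (k : ℕ))
    {x : ℂ} (hx : ‖x‖ < r) : ContinuousAt (xi t) x := by
  have h : ContinuousOn (xi t) (Metric.ball 0 r) := by
    refine continuousOn_tsum (u := fun k : ℕ+ => ‖t k‖ * r ^ (k : ℕ)) (fun k => by fun_prop) ht
      fun k y hy => ?_
    rw [norm_mul, norm_pow]
    exact mul_le_mul_of_nonneg_left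
      (pow_le_pow_left₀ (norm_nonneg _) (mem_ball_zero_iff.1 hy).le _) (norm_nonneg _)
  exact h.continuousAt (Metric.isOpen_ball.mem_nhds (mem_ball_zero_iff.2 hx))

/-! ### Radially ordered products of pairs -/

theorem prod_pairs {M : Type*} [CommMonoid M] {n : ℕ} (f : Fin (n * 2) → M) :
    ∏ a, f a = ∏ i : Fin n, (f (finProdFinEquiv (i, 0)) * f (finProdFinEquiv (i, 1))) := by
  rw [← Equiv.prod_comp finProdFinEquiv, Fintype.prod_prod_type]
  simp only [Fin.prod_univ_two]

theorem sum_pairs {M : Type*} [AddCommMonoid M] {n : ℕ} (f : Fin (n * 2) → M) :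
    ∑ a, f a = ∑ i : Fin n, (f (finProdFinEquiv (i, 0)) + f (finProdFinEquiv (i, 1))) := by
  rw [← Equiv.sum_comp finProdFinEquiv, Fintype.sum_prod_type]
  simp only [Fin.sum_univ_two]

theorem modNat_pair {n : ℕ} (i : Fin n) (c : Fin 2) : (finProdFinEquiv (i, c)).modNat = c :=
  congrArg Prod.snd (finProdFinEquiv.symm_apply_apply (i, c))

theorem divNat_pair {n : ℕ} (i : Fin n) (c : Fin 2) : (finProdFinEquiv (i, c)).divNat = i :=
  congrArg Prod.fst (finProdFinEquiv.symm_apply_apply (i, c))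

theorem pair_lt_pair {n : ℕ} (i j : Fin n) (c d : Fin 2) :
    finProdFinEquiv (i, c) < finProdFinEquiv (j, d) ↔ i < j ∨ i = j ∧ c < d := by
  rw [Fin.lt_def, Fin.lt_def, Fin.lt_def, Fin.ext_iff, finProdFinEquiv_apply_val,
    finProdFinEquiv_apply_val]
  have := c.2
  have := d.2
  simp only
  omega

/-- The type of the factor number `a` in a product of pairs. -/
def pairType {n : ℕ} (a : Fin (n * 2)) : Bool := a.modNat ≠ 0

theorem pairType_zero {n : ℕ} (i : Fin n) : pairType (finProdFinEquiv (i, 0)) = false := by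
  simp [pairType, modNat_pair]

theorem pairType_one {n : ℕ} (i : Fin n) : pairType (finProdFinEquiv (i, 1)) = true := by
  simp [pairType, modNat_pair]

theorem fieldArg_zero {n : ℕ} (z w : Fin n → ℂ) (i : Fin n) :
    fieldArg z w (finProdFinEquiv (i, 0)) = z i := by
  rw [fieldArg, modNat_pair, divNat_pair, if_pos rfl]

theorem fieldArg_one {n : ℕ} (z w : Fin n → ℂ) (i : Fin n) :
    fieldArg z w (finProdFinEquiv (i, 1)) = w i := by
  rw [fieldArg, modNat_pair, divNat_pair, if_neg (by decide)]

/-- The exponent of the argument in the `k`-th mode of a field of type `b`. -/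
def modeExponent (b : Bool) : ℤ ≃ ℤ where
  toFun k := if b then -k - 1 else k
  invFun k := if b then -k - 1 else k
  left_inv k := by cases b <;> simp
  right_inv k := by cases b <;> simp

/-- The exponents of the arguments in a product of modes, listed in the order `σ`. -/
def exponentEquiv {n : ℕ} (σ : Equiv.Perm (Fin (n * 2))) :
    (Fin (n * 2) → ℤ) ≃ (Fin (n * 2) → ℤ) :=
  (Equiv.arrowCongr σ.symm (Equiv.refl ℤ)).trans
    (Equiv.piCongrRight fun p => modeExponent (pairType (σ p)))

theorem fieldMode_eq {n : ℕ} (a : Fin (n * 2)) (k : ℤ) :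
    fieldMode a k = field (pairType a) (modeExponent (pairType a) k) := by
  by_cases h : a.modNat = 0 <;> simp [fieldMode, pairType, h, field, modeExponent]

theorem fieldCoeff_eq {n : ℕ} (z w : Fin n → ℂ) (a : Fin (n * 2)) (k : ℤ) :
    fieldCoeff z w a k = fieldArg z w a ^ modeExponent (pairType a) k := by
  by_cases h : a.modNat = 0 <;> simp [fieldCoeff, fieldArg, pairType, h, modeExponent]

theorem productTerm_eq {n : ℕ} (l : Module.Dual ℂ Fock) (z w : Fin n → ℂ)
    (σ : Equiv.Perm (Fin (n * 2))) (S : Maya) (k : Fin (n * 2) → ℤ) :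
    productTerm l z w σ S k = ((Equiv.Perm.sign σ : ℤ) : ℂ) *
      ((∏ p, (fieldArg z w ∘ σ) p ^ exponentEquiv σ k p) *
        l (fieldProd (pairType ∘ σ) (exponentEquiv σ k) (ket S))) := by
  have h1 : ∏ a, fieldCoeff z w a (k a) = ∏ p, (fieldArg z w ∘ σ) p ^ exponentEquiv σ k p := by
    rw [← Equiv.prod_comp σ]
    exact Finset.prod_congr rfl fun p _ => fieldCoeff_eq _ _ _ _
  have h2 : (List.ofFn fun p => fieldMode (σ p) (k (σ p))).prod =
      fieldProd (pairType ∘ σ) (exponentEquiv σ k) := by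
    simp only [fieldProd, fieldMode_eq]
    rfl
  rw [productTerm, h1, h2, mul_assoc]

theorem sum_eps_pairType (n : ℕ) : ∑ a : Fin (n * 2), eps (pairType a) = 0 := by
  rw [sum_pairs]
  exact Finset.sum_eq_zero fun i _ => by rw [pairType_zero, pairType_one]; rfl

theorem prod_prod_Ioi {n : ℕ} (f : Fin n → Fin n → ℂ) :
    ∏ i, ∏ j ∈ Finset.Ioi i, f i j = ∏ i, ∏ j, if i < j then f i j else 1 := by
  refine Finset.prod_congr rfl fun i _ => ?_
  rw [← Finset.prod_filter]
  exact Finset.prod_congr (by ext; simp) fun _ _ => rfl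

/-- The scalar factor of the product in the order in which it is written is a Cauchy
determinant. -/
theorem orderedFactor_pairs {n : ℕ} (z w : Fin n → ℂ) :
    orderedFactor pairType (fieldArg z w) 0 = cauchyValue z w := by
  have h0 : ∏ p, fieldArg z w p ^ (eps (pairType p) * 0) = 1 :=
    Finset.prod_eq_one fun p _ => by rw [mul_zero, zpow_zero]
  rw [orderedFactor, h0, one_mul, prod_prod_Ioi, prod_pairs, cauchyValue, prod_prod_Ioi]
  simp only [prod_pairs (fun b => if _ < b then _ else _), pair_lt_pair, fieldArg_zero,
    fieldArg_one, pairType_zero, pairType_one, lt_irrefl, and_false, or_false]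
  have h1 : ∏ i, ∏ j, (z i - w j)⁻¹ = ∏ i, ∏ j, ((if i < j ∨ i = j then (z i - w j)⁻¹ else 1) *
      if i < j then (z j - w i)⁻¹ else 1) := by
    simp only [Finset.prod_mul_distrib]
    rw [Finset.prod_comm (f := fun i j => if i < j then (z j - w i)⁻¹ else 1)]
    simp only [← Finset.prod_mul_distrib]
    refine Finset.prod_congr rfl fun i _ => Finset.prod_congr rfl fun j _ => ?_
    rcases lt_trichotomy i j with h | h | h
    · rw [if_pos (Or.inl h), if_neg h.not_gt, mul_one]
    · rw [if_pos (Or.inr h), if_neg h.not_gt, mul_one]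
    · rw [if_neg (by rintro (h' | h'); exacts [h.not_gt h', h.ne' h']), if_pos h, one_mul]
  rw [h1, ← Finset.prod_mul_distrib]
  refine Finset.prod_congr rfl fun i _ => ?_
  rw [← Finset.prod_mul_distrib, ← Finset.prod_mul_distrib]
  refine Finset.prod_congr rfl fun j _ => ?_
  rcases lt_trichotomy i j with h | h | h
  · simp [h, eps]
    rw [← neg_sub (z j) (w i), ← neg_sub (w j) (w i), inv_neg]
    ring
  · subst h
    simp [eps]
  · simp [h.not_gt, h.ne']

theorem orderedFactor_comp {n : ℕ} (z w : Fin n → ℂ) (σ : Equiv.Perm (Fin (n * 2))) :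
    ((Equiv.Perm.sign σ : ℤ) : ℂ) * orderedFactor (pairType ∘ σ) (fieldArg z w ∘ σ) 0 =
      cauchyValue z w := by
  have h0 : ∏ p, (fieldArg z w ∘ σ) p ^ (eps ((pairType ∘ σ) p) * 0) = 1 :=
    Finset.prod_eq_one fun p _ => by rw [mul_zero, zpow_zero]
  have h1 : ∏ p, fieldArg z w p ^ (eps (pairType p) * 0) = 1 :=
    Finset.prod_eq_one fun p _ => by rw [mul_zero, zpow_zero]
  rw [← orderedFactor_pairs, orderedFactor, orderedFactor, h0, h1, one_mul, one_mul]
  have := σ.prod_Ioi_comp_eq_sign_mul_prod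
    (f := fun a b => (fieldArg z w a - fieldArg z w b) ^ (eps (pairType a) * eps (pairType b)))
    fun a b => by
      rw [← neg_sub, mul_comm]
      cases pairType a <;> cases pairType b <;> simp only [eps, zpow_one, if_true, mul_one, mul_neg,
        neg_neg, Bool.false_eq_true, if_false, zpow_neg, inv_neg]
  simp only [Function.comp]
  rw [this, ← mul_assoc]
  have h2 : ((Equiv.Perm.sign σ : ℤ) : ℂ) * ((Equiv.Perm.sign σ : ℤ) : ℂ) = 1 := by
    rcases Int.units_eq_one_or (Equiv.Perm.sign σ) with h | h <;> rw [h] <;> simp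
  rw [h2, one_mul]

/-- The closed form of the matrix element `⟨0| γ̂₊(t) ∏ ψ(z_i) ψ*(w_i) |S⟩`. -/
def pairValue {n : ℕ} (t : ℕ+ → ℂ) (S : Maya) (x : (Fin n → ℂ) × (Fin n → ℂ)) : ℂ :=
  (∏ j, Complex.exp (xi t (x.1 j) - xi t (x.2 j))) * (cauchyValue x.1 x.2 *
    bra0 (gammaPlus (t - invPowerSums x.1 + invPowerSums x.2) (ket S)))

theorem fieldArg_ne_zero {n : ℕ} {z w : Fin n → ℂ} (hz : ∀ i, z i ≠ 0) (hw : ∀ i, w i ≠ 0)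
    (a : Fin (n * 2)) : fieldArg z w a ≠ 0 := by
  rw [fieldArg]
  split_ifs
  exacts [hz _, hw _]

/-- In every radial order the multiple series converges to the closed form. -/
theorem hasSum_productTerm {n : ℕ} {t : ℕ+ → ℂ} {z w : Fin n → ℂ} (hz : ∀ i, z i ≠ 0)
    (hw : ∀ i, w i ≠ 0) (ht : FlowConverges t z w) {σ : Equiv.Perm (Fin (n * 2))}
    (hσ : IsRadial z w σ) (S : Maya) :
    HasSum (productTerm (flowBra t) z w σ S) (pairValue t S (z, w)) := by
  obtain ⟨r, hr, hs⟩ := ht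
  have hsum : ∑ p, eps ((pairType ∘ σ) p) = 0 := by
    rw [← sum_eps_pairType n]
    exact Equiv.sum_comp σ fun a => eps (pairType a)
  have h1 := hasSum_fieldProd (b := pairType ∘ σ) (x := fieldArg z w ∘ σ)
    (fun p => fieldArg_ne_zero hz hw _)
    (fun p q hpq hne => hσ p q hpq fun h => hne (by simp only [Function.comp, pairType, h]))
    0 (gammaPlus t (ket S))
  rw [hsum, sub_zero, bra_zero] at h1
  have hE : ∀ p, HasSum (fun j : ℕ => PowerSeries.coeff j (hSeries (eps ((pairType ∘ σ) p) • t)) *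
      (fieldArg z w ∘ σ) p ^ j)
      (Complex.exp (eps (pairType (σ p)) * xi t (fieldArg z w (σ p)))) := by
    intro p
    refine hasSum_hSeries ?_
    have hlt : ‖fieldArg z w (σ p)‖ ≤ r := by
      rw [fieldArg]
      split_ifs
      exacts [(hr _).1.le, (hr _).2.le]
    refine hasSum_of_eq ((hasSum_xi hs hlt).mul_left (eps (pairType (σ p)) : ℂ)) (fun k => ?_) rfl
    simp only [Pi.smul_apply, Function.comp, zsmul_eq_mul]
    ring
  have h2 := hasSum_fieldProd_gammaPlus (fun p => fieldArg_ne_zero hz hw _) hE h1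
  have h3 := ((exponentEquiv σ).hasSum_iff.2 h2).mul_left ((Equiv.Perm.sign σ : ℤ) : ℂ)
  refine hasSum_of_eq h3 (fun k => productTerm_eq _ _ _ _ _ _) ?_
  have h4 : ∏ p, Complex.exp (eps (pairType (σ p)) * xi t (fieldArg z w (σ p))) =
      ∏ j, Complex.exp (xi t (z j) - xi t (w j)) := by
    rw [Equiv.prod_comp σ fun a => Complex.exp (eps (pairType a) * xi t (fieldArg z w a)),
      prod_pairs]
    refine Finset.prod_congr rfl fun i _ => ?_
    rw [← Complex.exp_add, pairType_zero, pairType_one, fieldArg_zero, fieldArg_one]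
    congr 1
    simp [eps]
    ring
  have h5 : -∑ p, eps ((pairType ∘ σ) p) • invPow ((fieldArg z w ∘ σ) p) =
      -invPowerSums z + invPowerSums w := by
    have := Equiv.sum_comp σ fun a => eps (pairType a) • invPow (fieldArg z w a)
    simp only [Function.comp]
    rw [this, sum_pairs, invPowerSums_eq_sum, invPowerSums_eq_sum, ← Finset.sum_neg_distrib,
      ← Finset.sum_neg_distrib, ← Finset.sum_add_distrib]
    refine Finset.sum_congr rfl fun i _ => ?_
    rw [pairType_zero, pairType_one, fieldArg_zero, fieldArg_one]
    simp [eps, add_comm]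
  rw [h4, h5, pairValue, ← orderedFactor_comp z w σ, ← gammaPlus_add]
  simp only
  have h6 : -invPowerSums z + invPowerSums w + t = t - invPowerSums z + invPowerSums w := by ring
  rw [h6]
  ring

theorem isRadial_radialPerm {n : ℕ} {z w : Fin n → ℂ} (h : (z, w) ∈ radialDomain n) :
    IsRadial z w (radialPerm z w) := by
  intro p q hpq hne
  have h1 : -‖fieldArg z w (radialPerm z w p)‖ ≤ -‖fieldArg z w (radialPerm z w q)‖ :=
    Tuple.monotone_sort (fun a => -‖fieldArg z w a‖) hpq.le
  refine lt_of_le_of_ne (neg_le_neg_iff.1 h1) fun he => ?_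
  generalize radialPerm z w p = a at *
  generalize radialPerm z w q = b at *
  rw [fieldArg, fieldArg] at he
  split_ifs at he with h2 h3 h3
  · exact hne (h3.trans h2.symm)
  · exact h _ _ he
  · exact h _ _ he.symm
  · have h4 := a.modNat.2
    have h5 := b.modNat.2
    exact hne (Fin.ext (by have := Fin.val_ne_of_ne h2; have := Fin.val_ne_of_ne h3; simp at *; omega))

theorem mem_closure_radialDomain {n : ℕ} {z : Fin n → ℂ} (hz : ∀ i, z i ≠ 0) (w : Fin n → ℂ) :
    (z, w) ∈ closure (radialDomain n) := by
  -- all but finitely many dilations of `z` separate the moduli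
  have h1 : Tendsto (fun s : ℝ => ((s : ℂ) • z, w)) (𝓝[>] 1) (𝓝 (z, w)) := by
    have h2 : Continuous fun s : ℝ => ((s : ℂ) • z, w) := by fun_prop
    have h3 := h2.tendsto 1
    simp only [Complex.ofReal_one, one_smul] at h3
    exact h3.mono_left nhdsWithin_le_nhds
  refine mem_closure_of_tendsto h1 ?_
  have hfin : (Set.range fun p : Fin n × Fin n => ‖w p.2‖ / ‖z p.1‖).Finite := Set.finite_range _
  have h4 : ∀ᶠ s : ℝ in 𝓝[>] 1, s ∉ (Set.range fun p : Fin n × Fin n => ‖w p.2‖ / ‖z p.1‖) \ {1} :=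
    nhdsWithin_le_nhds ((hfin.subset Set.sdiff_subset).isClosed.isOpen_compl.mem_nhds (by simp))
  filter_upwards [h4, self_mem_nhdsWithin] with s hs hs1 i j he
  rw [Set.mem_Ioi] at hs1
  refine hs ⟨⟨(i, j), ?_⟩, hs1.ne'⟩
  simp only [Pi.smul_apply, smul_eq_mul, norm_mul, Complex.norm_real, Real.norm_eq_abs,
    abs_of_pos (one_pos.trans hs1)] at he
  change ‖w j‖ / ‖z i‖ = s
  rw [← he, mul_div_cancel_right₀ _ (norm_ne_zero_iff.2 (hz i))]

theorem continuousAt_invPowerSums {n : ℕ} {z : Fin n → ℂ} (hz : ∀ i, z i ≠ 0) :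
    ContinuousAt (invPowerSums : (Fin n → ℂ) → ℕ+ → ℂ) z := by
  refine continuousAt_pi.2 fun k => ?_
  refine continuousAt_const.mul (tendsto_finsetSum _ fun j _ => ?_)
  exact continuousAt_const.div ((continuous_apply j).continuousAt.pow _) (pow_ne_zero _ (hz j))

theorem continuousAt_cauchyValue {n : ℕ} {z w : Fin n → ℂ} (h : ∀ i j, z i ≠ w j) :
    ContinuousAt (fun x : (Fin n → ℂ) × (Fin n → ℂ) => cauchyValue x.1 x.2) (z, w) := by
  refine ContinuousAt.mul (Continuous.continuousAt (by fun_prop)) ?_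
  refine tendsto_finsetProd _ fun i _ => tendsto_finsetProd _ fun j _ => ?_
  refine ContinuousAt.inv₀ (Continuous.continuousAt (by fun_prop)) ?_
  exact sub_ne_zero.2 (h i j)

theorem continuousAt_pairValue {n : ℕ} {t : ℕ+ → ℂ} {z w : Fin n → ℂ} (hz : ∀ i, z i ≠ 0)
    (hw : ∀ i, w i ≠ 0) (h : ∀ i j, z i ≠ w j) (ht : FlowConverges t z w) (S : Maya) :
    ContinuousAt (pairValue t S) (z, w) := by
  obtain ⟨r, hr, hs⟩ := ht
  have h1 : ContinuousAt (fun x : (Fin n → ℂ) × (Fin n → ℂ) =>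
      ∏ j, Complex.exp (xi t (x.1 j) - xi t (x.2 j))) (z, w) := by
    refine tendsto_finsetProd _ fun j _ => ?_
    refine Complex.continuous_exp.continuousAt.comp (ContinuousAt.sub ?_ ?_)
    · exact ContinuousAt.comp (f := fun x : (Fin n → ℂ) × (Fin n → ℂ) => x.1 j)
        (continuousAt_xi hs (hr j).1) (by fun_prop)
    · exact ContinuousAt.comp (f := fun x : (Fin n → ℂ) × (Fin n → ℂ) => x.2 j)
        (continuousAt_xi hs (hr j).2) (by fun_prop)
  refine h1.mul ((continuousAt_cauchyValue h).mul ?_)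
  refine ContinuousAt.comp (f := fun x : (Fin n → ℂ) × (Fin n → ℂ) =>
    t - invPowerSums x.1 + invPowerSums x.2)
    (continuous_gammaPlus bra0 (ket S)).continuousAt ?_
  refine (continuousAt_const.sub ?_).add ?_
  · exact ContinuousAt.comp (f := Prod.fst) (continuousAt_invPowerSums hz) continuousAt_fst
  · exact ContinuousAt.comp (f := Prod.snd) (continuousAt_invPowerSums hw) continuousAt_snd

theorem tendsto_radialProduct {n : ℕ} {t : ℕ+ → ℂ} {z w : Fin n → ℂ} (hz : ∀ i, z i ≠ 0)
    (hw : ∀ i, w i ≠ 0) (h : ∀ i j, z i ≠ w j) (ht : FlowConverges t z w) (S : Maya) :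
    Tendsto (radialProduct (flowBra t) S) (𝓝[radialDomain n] (z, w))
      (𝓝 (pairValue t S (z, w))) := by
  refine ((continuousAt_pairValue hz hw h ht S).mono_left nhdsWithin_le_nhds).congr' ?_
  obtain ⟨r, hr, hs⟩ := ht
  have h1 : ∀ᶠ x : (Fin n → ℂ) × (Fin n → ℂ) in 𝓝 (z, w),
      ∀ i, (x.1 i ≠ 0 ∧ x.2 i ≠ 0) ∧ ‖x.1 i‖ < r ∧ ‖x.2 i‖ < r := by
    refine eventually_all.2 fun i => ?_
    have c1 : Continuous fun x : (Fin n → ℂ) × (Fin n → ℂ) => x.1 i := by fun_prop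
    have c2 : Continuous fun x : (Fin n → ℂ) × (Fin n → ℂ) => x.2 i := by fun_prop
    exact ((c1.continuousAt.eventually_ne (hz i)).and (c2.continuousAt.eventually_ne (hw i))).and
      ((c1.norm.continuousAt.eventually_lt continuousAt_const (hr i).1).and
        (c2.norm.continuousAt.eventually_lt continuousAt_const (hr i).2))
  filter_upwards [nhdsWithin_le_nhds h1, self_mem_nhdsWithin] with x hx hx'
  exact (hasSum_productTerm (fun i => (hx i).1.1) (fun i => (hx i).1.2)
    ⟨r, fun i => (hx i).2, hs⟩ (isRadial_radialPerm hx') S).tsum_eq.symm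

theorem pairCovector_eq {n : ℕ} {t : ℕ+ → ℂ} {z w : Fin n → ℂ} (hz : ∀ i, z i ≠ 0)
    (hw : ∀ i, w i ≠ 0) (h : ∀ i j, z i ≠ w j) (ht : FlowConverges t z w) (S : Maya) :
    pairCovector (flowBra t) z w S = pairValue t S (z, w) :=
  extendFrom_eq (mem_closure_radialDomain hz w) (tendsto_radialProduct hz hw h ht S)

theorem pairCovectorConverges {n : ℕ} {t : ℕ+ → ℂ} {z w : Fin n → ℂ} (hz : ∀ i, z i ≠ 0)
    (hw : ∀ i, w i ≠ 0) (h : ∀ i j, z i ≠ w j) (ht : FlowConverges t z w) :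
    PairCovectorConverges (flowBra t) z w := by
  intro S
  rw [pairCovector_eq hz hw h ht]
  exact ⟨tendsto_radialProduct hz hw h ht S, fun σ hσ => hasSum_productTerm hz hw ht hσ S⟩

theorem flowBra_zero : flowBra 0 = bra0 := by
  rw [flowBra, gammaPlus_zero]
  rfl

theorem flowConverges_zero {n : ℕ} (z w : Fin n → ℂ) : FlowConverges 0 z w := by
  refine ⟨1 + ∑ i, (‖z i‖ + ‖w i‖), fun i => ?_, by simp⟩
  have := Finset.single_le_sum (f := fun i => ‖z i‖ + ‖w i‖) (fun i _ => by positivity)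
    (Finset.mem_univ i)
  constructor <;> linarith [norm_nonneg (z i), norm_nonneg (w i)]

theorem xi_zero (x : ℂ) : xi 0 x = 0 := by simp [xi]

/-! ### The correlator in terms of the tau function -/

theorem correlatorTerm_eq {n : ℕ} (g : Fock →ₗ[ℂ] FockHat) {t : ℕ+ → ℂ} {z w : Fin n → ℂ}
    (hz : ∀ i, z i ≠ 0) (hw : ∀ i, w i ≠ 0) (h : ∀ i j, z i ≠ w j) (ht : FlowConverges t z w)
    (S : Maya) : correlatorTerm g t z w S =
      ((∏ j, Complex.exp (xi t (z j) - xi t (w j))) * (cauchyMatrix z w).det) *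
        tauTerm g (t - invPowerSums z + invPowerSums w) S := by
  rw [correlatorTerm, pairCovector_eq hz hw h ht, det_cauchyMatrix z w hz hw h, tauTerm, pairValue]
  ring

theorem summable_correlatorTerm {n : ℕ} {g : Fock →ₗ[ℂ] FockHat} {t : ℕ+ → ℂ} {z w : Fin n → ℂ}
    (hz : ∀ i, z i ≠ 0) (hw : ∀ i, w i ≠ 0) (h : ∀ i j, z i ≠ w j) (ht : FlowConverges t z w)
    (hg : Summable (tauTerm g (t - invPowerSums z + invPowerSums w))) :
    Summable (correlatorTerm g t z w) := by
  rw [funext fun S => correlatorTerm_eq g hz hw h ht S]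
  exact hg.mul_left _

theorem correlator_eq {n : ℕ} (g : Fock →ₗ[ℂ] FockHat) {t : ℕ+ → ℂ} {z w : Fin n → ℂ}
    (hz : ∀ i, z i ≠ 0) (hw : ∀ i, w i ≠ 0) (h : ∀ i j, z i ≠ w j) (ht : FlowConverges t z w) :
    correlator g t z w = (∏ j, Complex.exp (xi t (z j) - xi t (w j))) *
      tau g (t - invPowerSums z + invPowerSums w) * (cauchyMatrix z w).det := by
  rw [correlator, funext fun S => correlatorTerm_eq g hz hw h ht S, tsum_mul_left, tau]
  ring

/-! ### The bilinear form `∑ ψ_i ⊗ ψ*_i` between vacuum covectors -/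

theorem coeffInt_mul (f g : PowerSeries ℂ) {m c : ℤ} {J : Finset ℤ}
    (hJ : Finset.Icc m c ⊆ J) :
    ∑ i ∈ J, coeffInt f (i - m) * coeffInt g (c - i) = coeffInt (f * g) (c - m) := by
  rw [← Finset.sum_subset hJ fun i _ hi => ?_]
  · by_cases hmc : m ≤ c
    · obtain ⟨n, rfl⟩ := Int.le.dest hmc
      rw [coeffInt, if_pos (by omega), PowerSeries.coeff_mul, add_sub_cancel_left, Int.toNat_natCast,
        Finset.Nat.sum_antidiagonal_eq_sum_range_succ
          (fun i j => PowerSeries.coeff i f * PowerSeries.coeff j g)]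
      symm
      refine Finset.sum_nbij' (fun k => m + k) (fun i => (i - m).toNat) ?_ ?_ ?_ ?_ ?_
      · intro k hk
        rw [Finset.mem_range] at hk
        rw [Finset.mem_Icc]
        omega
      · intro i hi
        rw [Finset.mem_Icc] at hi
        rw [Finset.mem_range]
        omega
      · intro k _
        simp
      · intro i hi
        rw [Finset.mem_Icc] at hi
        rw [Int.toNat_of_nonneg (by omega)]
        ring
      · intro k hk
        rw [Finset.mem_range] at hk
        rw [coeffInt, if_pos (by omega), coeffInt, if_pos (by omega)]
        congr 3 <;> omega
    · rw [Finset.Icc_eq_empty hmc, Finset.sum_empty, coeffInt, if_neg (by omega)]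
  · rw [Finset.mem_Icc, not_and_or] at hi
    rcases hi with hi | hi
    · rw [coeffInt, if_neg (by omega), zero_mul]
    · have h0 : coeffInt g (c - i) = 0 := if_neg (by omega)
      rw [h0, mul_zero]

theorem sum_bra_field (b : Bool) (N : ℤ) {x : ℂ} (hx : x ≠ 0) (v : Fock) {I : Finset ℤ}
    (hI : ∀ m ∉ I, bra N (field b m v) = 0) :
    ∑ m ∈ I, x ^ m * bra N (field b m v) =
      x ^ (eps b * N - 1) * bra (N - eps b) (gammaPlus (-(eps b • invPow x)) v) :=
  (hasSum_sum_of_ne_finset_zero fun m hm => by rw [hI m hm, mul_zero]).unique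
    (hasSum_bra_field b N hx v)

/-- If a partial fraction decomposition with nodes `a_i` relates two sets of times, then the
pairing of two vacuum covectors through `∑ ψ_i ⊗ ψ*_i` is a combination of products of
tau-functions whose times are shifted by the nodes. -/
theorem finsum_bra_psi_mul_bra_psiStar {ι : Type*} [Fintype ι] {a c : ι → ℂ} {K : ℂ}
    {t₁ t₂ : ℕ+ → ℂ} (ha : ∀ i, a i ≠ 0)
    (h : PowerSeries.C K * (PowerSeries.X * hSeries (t₁ - t₂)) =
      ∑ i, PowerSeries.C (c i) * hSeries (invPow (a i))) (u v : Fock) :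
    K * ∑ᶠ i : ℤ, bra 1 (gammaPlus t₁ (psi i u)) * bra (-1) (gammaPlus t₂ (psiStar i v)) =
      ∑ i, c i * (bra0 (gammaPlus (t₁ - invPow (a i)) u) *
        bra0 (gammaPlus (t₂ + invPow (a i)) v)) := by
  set A : ℤ → ℂ := fun m => bra 1 (field false m (gammaPlus t₁ u)) with hA
  set B : ℤ → ℂ := fun m => bra (-1) (field true m (gammaPlus t₂ v)) with hB
  have hAf : (Function.support A).Finite := by
    simpa using bra_field_support false 1 1 (gammaPlus t₁ u)
  have hBf : (Function.support B).Finite := by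
    simpa using bra_field_support true (-1) 1 (gammaPlus t₂ v)
  set I : Finset ℤ := hAf.toFinset ∪ hBf.toFinset with hI
  have hAI : ∀ m ∉ I, A m = 0 := fun m hm => by
    by_contra h0
    exact hm (Finset.mem_union_left _ (hAf.mem_toFinset.2 h0))
  have hBI : ∀ m ∉ I, B m = 0 := fun m hm => by
    by_contra h0
    exact hm (Finset.mem_union_right _ (hBf.mem_toFinset.2 h0))
  have hneg : ∀ m ∈ I, m ≤ 0 := by
    intro m hm
    by_contra hpos
    rcases Finset.mem_union.1 hm with hm | hm
    · exact hAf.mem_toFinset.1 hm (bra_field false (by simp [eps]; omega) _)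
    · exact hBf.mem_toFinset.1 hm (bra_field true (by simp [eps]; omega) _)
  obtain ⟨L, hL⟩ : ∃ L : ℤ, ∀ m ∈ I, L ≤ m := I.bddBelow.imp fun L hL m hm => hL hm
  have e1 : ∀ i, bra 1 (gammaPlus t₁ (psi i u)) = ∑ m ∈ I, coeffInt (hSeries t₁) (i - m) * A m := by
    intro i
    have : psi i u = field false i u := rfl
    rw [this, gammaPlus_field, apply_smear_eq_sum (I := I) _ _ _ _ _ fun m _ hm => hAI m hm]
    simp [eps, hA]
  have e2 : ∀ i, bra (-1) (gammaPlus t₂ (psiStar i v)) =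
      ∑ m ∈ I, coeffInt (hSeries (-t₂)) (-1 - m - i) * B m := by
    intro i
    have : psiStar i v = field true (-1 - i) v := by
      simp only [field, if_true]
      congr 2
      ring
    rw [this, gammaPlus_field, apply_smear_eq_sum (I := I) _ _ _ _ _ fun m _ hm => hBI m hm]
    simp only [eps, if_true, neg_smul, one_smul, hB]
    exact Finset.sum_congr rfl fun m _ => by rw [sub_right_comm]
  have e3 : ∑ᶠ i : ℤ, bra 1 (gammaPlus t₁ (psi i u)) * bra (-1) (gammaPlus t₂ (psiStar i v)) =
      ∑ m ∈ I, ∑ m' ∈ I, A m * B m' * coeffInt (hSeries (t₁ - t₂)) (-1 - m' - m) := by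
    rw [finsum_eq_sum_of_support_subset (s := Finset.Icc L (-1 - L)) _ fun i hi => ?_]
    · simp only [e1, e2, Finset.sum_mul_sum]
      rw [Finset.sum_comm]
      refine Finset.sum_congr rfl fun m hm => ?_
      rw [Finset.sum_comm]
      refine Finset.sum_congr rfl fun m' hm' => ?_
      rw [sub_eq_add_neg t₁, hSeries_add, ← coeffInt_mul (J := Finset.Icc L (-1 - L)), Finset.mul_sum]
      · exact Finset.sum_congr rfl fun i _ => by ring
      · exact Finset.Icc_subset_Icc (hL m hm) (by have := hL m' hm'; omega)
    · by_contra h0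
      rw [Finset.coe_Icc, Set.mem_Icc, not_and_or] at h0
      refine hi ?_
      change bra 1 (gammaPlus t₁ (psi i u)) * bra (-1) (gammaPlus t₂ (psiStar i v)) = 0
      rw [e1, e2]
      rcases h0 with h0 | h0
      · rw [Finset.sum_eq_zero fun m hm => ?_, zero_mul]
        have := hL m hm
        rw [coeffInt, if_neg (by omega), zero_mul]
      · rw [mul_comm, Finset.sum_eq_zero fun m hm => ?_, zero_mul]
        have := hL m hm
        rw [coeffInt, if_neg (by omega), zero_mul]
  have e4 : ∀ m ∈ I, ∀ m' ∈ I, K * coeffInt (hSeries (t₁ - t₂)) (-1 - m' - m) =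
      ∑ i, c i * (a i ^ m * a i ^ m') := by
    intro m hm m' hm'
    obtain ⟨k, hk⟩ := Int.eq_ofNat_of_zero_le (a := -m - m')
      (by have := hneg m hm; have := hneg m' hm'; omega)
    have e5 := congrArg (PowerSeries.coeff k) h
    rw [PowerSeries.coeff_C_mul, map_sum] at e5
    have e6 : coeffInt (hSeries (t₁ - t₂)) (-1 - m' - m) =
        PowerSeries.coeff k (PowerSeries.X * hSeries (t₁ - t₂)) := by
      rcases k with _ | k
      · rw [coeffInt, if_neg (by push_cast at hk; omega), PowerSeries.coeff_zero_X_mul]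
      · rw [coeffInt, if_pos (by push_cast at hk; omega), PowerSeries.coeff_succ_X_mul]
        congr 2
        push_cast at hk
        omega
    rw [e6, e5]
    refine Finset.sum_congr rfl fun i _ => ?_
    rw [PowerSeries.coeff_C_mul, hSeries_invPow, PowerSeries.coeff_mk, ← zpow_add₀ (ha i),
      inv_pow, ← zpow_natCast, ← zpow_neg]
    congr 2
    omega
  have e7 : ∀ i, bra0 (gammaPlus (t₁ - invPow (a i)) u) = ∑ m ∈ I, a i ^ m * A m := by
    intro i
    rw [sum_bra_field false 1 (ha i) _ hAI, ← gammaPlus_add]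
    simp [eps, bra_zero, sub_eq_neg_add]
  have e8 : ∀ i, bra0 (gammaPlus (t₂ + invPow (a i)) v) = ∑ m ∈ I, a i ^ m * B m := by
    intro i
    rw [sum_bra_field true (-1) (ha i) _ hBI, ← gammaPlus_add]
    simp [eps, bra_zero, add_comm]
  have e9 : ∀ i, c i * (bra0 (gammaPlus (t₁ - invPow (a i)) u) *
      bra0 (gammaPlus (t₂ + invPow (a i)) v)) =
      ∑ m ∈ I, ∑ m' ∈ I, A m * B m' * (c i * (a i ^ m * a i ^ m')) := by
    intro i
    rw [e7, e8, Finset.sum_mul_sum, Finset.mul_sum]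
    refine Finset.sum_congr rfl fun m _ => ?_
    rw [Finset.mul_sum]
    exact Finset.sum_congr rfl fun m' _ => by ring
  simp only [e9]
  rw [e3, Finset.mul_sum]
  conv_rhs => rw [Finset.sum_comm]
  refine Finset.sum_congr rfl fun m hm => ?_
  rw [Finset.mul_sum]
  conv_rhs => rw [Finset.sum_comm]
  refine Finset.sum_congr rfl fun m' hm' => ?_
  rw [← Finset.mul_sum, ← e4 m hm m' hm']
  ring

/-! ### The tau-function graded by the energy -/

theorem hat_psi (i : ℤ) (v : FockHat) (T : Maya) :
    hat (psi i) v T = open Classical in if i ∈ T.1 then wedgeSign i T * v (T.erase i) else 0 := by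
  rw [hat]
  split_ifs with h
  · rw [finsum_eq_single _ (T.erase i)]
    · rw [psi_ket_of_notMem (by simp), Maya.insert_erase h, wedgeSign_erase_self]
      simp [ket]
    · intro S hS
      by_cases hi : i ∈ S.1
      · rw [psi_ket_of_mem hi, Finsupp.zero_apply, zero_mul]
      · have : S.insert i ≠ T := by
          rintro rfl
          exact hS (Maya.erase_insert hi).symm
        rw [psi_ket_of_notMem hi]
        simp [ket, this]
  · refine finsum_eq_zero_of_forall_eq_zero fun S => ?_
    by_cases hi : i ∈ S.1
    · rw [psi_ket_of_mem hi, Finsupp.zero_apply, zero_mul]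
    · have : S.insert i ≠ T := by
        rintro rfl
        exact h (by simp)
      rw [psi_ket_of_notMem hi]
      simp [ket, this]

theorem hat_psiStar (i : ℤ) (v : FockHat) (T : Maya) :
    hat (psiStar i) v T =
      open Classical in if i ∈ T.1 then 0 else wedgeSign i T * v (T.insert i) := by
  rw [hat]
  split_ifs with h
  · refine finsum_eq_zero_of_forall_eq_zero fun S => ?_
    by_cases hi : i ∈ S.1
    · have : S.erase i ≠ T := by
        rintro rfl
        exact h.2 rfl
      rw [psiStar_ket_of_mem hi]
      simp [ket, this]
    · rw [psiStar_ket_of_notMem hi, Finsupp.zero_apply, zero_mul]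
  · rw [finsum_eq_single _ (T.insert i)]
    · rw [psiStar_ket_of_mem (by simp), Maya.erase_insert h, wedgeSign_insert_self]
      simp [ket]
    · intro S hS
      by_cases hi : i ∈ S.1
      · have : S.erase i ≠ T := by
          rintro rfl
          exact hS (Maya.insert_erase hi).symm
        rw [psiStar_ket_of_mem hi]
        simp [ket, this]
      · rw [psiStar_ket_of_notMem hi, Finsupp.zero_apply, zero_mul]

/-- The basis states of a given energy. -/
def level (e : ℕ) : Finset Maya :=
  ((finite_energy_le e).subset (t := {S | energy S = e}) fun _ h => le_of_eq h).toFinset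

theorem mem_level {e : ℕ} {S : Maya} : S ∈ level e ↔ energy S = e := by
  simp [level]

theorem finite_pairLevel (e : ℕ) : {p : Maya × Maya | energy p.1 + energy p.2 = e}.Finite :=
  ((finite_energy_le e).prod (finite_energy_le e)).subset fun p (h : _ = _) => by
    have := energy_nonneg p.1
    have := energy_nonneg p.2
    simp only [Set.mem_prod, Set.mem_ofPred_eq]
    omega

/-- The pairs of basis states of a given total energy. -/
def pairLevel (e : ℕ) : Finset (Maya × Maya) := (finite_pairLevel e).toFinset

theorem mem_pairLevel {e : ℕ} {p : Maya × Maya} :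
    p ∈ pairLevel e ↔ energy p.1 + energy p.2 = e := by
  simp [pairLevel]

/-- The terms of the tau-function `τ_g(t)`, collected by the energy of the basis state. -/
def tauSeries (g : Fock →ₗ[ℂ] FockHat) (t : ℕ+ → ℂ) : PowerSeries ℂ :=
  PowerSeries.mk fun e => ∑ S ∈ level e, tauTerm g t S

theorem evalsTo_tauSeries {g : Fock →ₗ[ℂ] FockHat} {t : ℕ+ → ℂ} (h : Summable (tauTerm g t)) :
    EvalsTo (tauSeries g t) (tau g t) := by
  have h1 := h.hasSum.tsum_fiberwise fun S => (energy S).toNat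
  refine hasSum_of_eq h1 (fun e => ?_) rfl
  rw [tauSeries, PowerSeries.coeff_mk, ← Finset.tsum_subtype]
  have h2 : (fun S : Maya => (energy S).toNat) ⁻¹' {e} = {S | S ∈ level e} := by
    ext S
    have := energy_nonneg S
    simp only [Set.mem_preimage, Set.mem_singleton_iff, Set.mem_ofPred_eq, mem_level]
    omega
  rw [h2]
  rfl

theorem coeff_tauSeries_mul (g : Fock →ₗ[ℂ] FockHat) (s t : ℕ+ → ℂ) (e : ℕ) :
    PowerSeries.coeff e (tauSeries g s * tauSeries g t) =
      ∑ p ∈ pairLevel e, tauTerm g s p.1 * tauTerm g t p.2 := by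
  classical
  rw [PowerSeries.coeff_mul, ← Finset.sum_fiberwise_of_maps_to (t := Finset.HasAntidiagonal.antidiagonal e)
    (g := fun p : Maya × Maya => ((energy p.1).toNat, (energy p.2).toNat))]
  · refine Finset.sum_congr rfl fun k hk => ?_
    rw [Finset.HasAntidiagonal.mem_antidiagonal] at hk
    rw [tauSeries, tauSeries, PowerSeries.coeff_mk, PowerSeries.coeff_mk, Finset.sum_mul_sum,
      ← Finset.sum_product']
    refine Finset.sum_congr ?_ fun _ _ => rfl
    ext p
    have := energy_nonneg p.1
    have := energy_nonneg p.2
    simp only [Finset.mem_product, mem_level, Finset.mem_filter, mem_pairLevel, Prod.ext_iff]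
    omega
  · intro p hp
    have := energy_nonneg p.1
    have := energy_nonneg p.2
    rw [mem_pairLevel] at hp
    rw [Finset.HasAntidiagonal.mem_antidiagonal]
    omega

theorem finite_difference (S T : Maya) : {i | i ∈ S.1 ∧ i ∉ T.1}.Finite := by
  refine (S.2.1.union T.2.2).subset fun i hi => ?_
  by_cases h : 0 ≤ i
  · exact Or.inl ⟨hi.1, h⟩
  · exact Or.inr ⟨hi.2, not_le.1 h⟩

/-- The operator `∑ ψ_i ⊗ ψ*_i` preserves the total energy, and can be moved from the states to
the covectors within one energy level. -/
theorem sum_pairLevel (L₁ L₂ : Module.Dual ℂ Fock) (v : FockHat) (e : ℕ) :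
    ∑ p ∈ pairLevel e, v p.1 * v p.2 * ∑ᶠ i : ℤ, L₁ (psi i (ket p.1)) * L₂ (psiStar i (ket p.2)) =
      ∑ p ∈ pairLevel e, L₁ (ket p.1) * L₂ (ket p.2) *
        ∑ᶠ i : ℤ, hat (psi i) v p.1 * hat (psiStar i) v p.2 := by
  classical
  have hfin : (⋃ p ∈ pairLevel e,
      ({i | i ∈ p.1.1 ∧ i ∉ p.2.1} ∪ {i | i ∈ p.2.1 ∧ i ∉ p.1.1})).Finite :=
    (pairLevel e).finite_toSet.biUnion fun p _ =>
      (finite_difference p.1 p.2).union (finite_difference p.2 p.1)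
  set I := hfin.toFinset with hI
  have key1 : ∀ (p : Maya × Maya) (i : ℤ),
      L₁ (psi i (ket p.1)) * L₂ (psiStar i (ket p.2)) ≠ 0 → i ∈ p.2.1 ∧ i ∉ p.1.1 := by
    intro p i h
    constructor
    · by_contra hi
      exact h (by rw [psiStar_ket_of_notMem hi, map_zero, mul_zero])
    · intro hi
      exact h (by rw [psi_ket_of_mem hi, map_zero, zero_mul])
  have key2 : ∀ (p : Maya × Maya) (i : ℤ),
      hat (psi i) v p.1 * hat (psiStar i) v p.2 ≠ 0 → i ∈ p.1.1 ∧ i ∉ p.2.1 := by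
    intro p i h
    constructor
    · by_contra hi
      exact h (by rw [hat_psi, if_neg hi, zero_mul])
    · intro hi
      exact h (by rw [hat_psiStar, if_pos hi, mul_zero])
  have e1 : ∀ p ∈ pairLevel e,
      v p.1 * v p.2 * ∑ᶠ i : ℤ, L₁ (psi i (ket p.1)) * L₂ (psiStar i (ket p.2)) =
        ∑ i ∈ I, v p.1 * v p.2 * (L₁ (psi i (ket p.1)) * L₂ (psiStar i (ket p.2))) := by
    intro p hp
    rw [← Finset.mul_sum]
    congr 1
    exact finsum_eq_sum_of_support_subset _ fun i hi => by
      rw [hI, Set.Finite.coe_toFinset]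
      exact Set.mem_biUnion (show p ∈ (pairLevel e : Set _) from hp) (Or.inr (key1 p i hi))
  have e2 : ∀ p ∈ pairLevel e,
      L₁ (ket p.1) * L₂ (ket p.2) * ∑ᶠ i : ℤ, hat (psi i) v p.1 * hat (psiStar i) v p.2 =
        ∑ i ∈ I, L₁ (ket p.1) * L₂ (ket p.2) * (hat (psi i) v p.1 * hat (psiStar i) v p.2) := by
    intro p hp
    rw [← Finset.mul_sum]
    congr 1
    exact finsum_eq_sum_of_support_subset _ fun i hi => by
      rw [hI, Set.Finite.coe_toFinset]
      exact Set.mem_biUnion (show p ∈ (pairLevel e : Set _) from hp) (Or.inl (key2 p i hi))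
  rw [Finset.sum_congr rfl e1, Finset.sum_congr rfl e2, ← Finset.sum_product', ← Finset.sum_product']
  refine Finset.sum_bij_ne_zero (fun q _ _ => ((q.1.1.insert q.2, q.1.2.erase q.2), q.2))
    ?_ ?_ ?_ ?_
  · rintro ⟨p, i⟩ hq h0
    obtain ⟨h2, h1⟩ := key1 p i (right_ne_zero_of_mul h0)
    rw [Finset.mem_product, mem_pairLevel] at hq ⊢
    refine ⟨?_, hq.2⟩
    simp only
    rw [energy_insert h1, energy_erase h2]
    linarith [hq.1]
  · rintro ⟨p, i⟩ _ h0 ⟨q, j⟩ _ h0' h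
    obtain ⟨h2, h1⟩ := key1 p i (right_ne_zero_of_mul h0)
    obtain ⟨h2', h1'⟩ := key1 q j (right_ne_zero_of_mul h0')
    simp only [Prod.mk.injEq] at h
    obtain ⟨⟨h3, h4⟩, rfl⟩ := h
    have h5 := congrArg (fun S => S.erase i) h3
    have h6 := congrArg (fun S => S.insert i) h4
    simp only [Maya.erase_insert h1, Maya.erase_insert h1', Maya.insert_erase h2,
      Maya.insert_erase h2'] at h5 h6
    exact Prod.ext (Prod.ext h5 h6) rfl
  · rintro ⟨p, i⟩ hq h0
    obtain ⟨h1, h2⟩ := key2 p i (right_ne_zero_of_mul h0)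
    rw [Finset.mem_product, mem_pairLevel] at hq
    refine ⟨((p.1.erase i, p.2.insert i), i), ?_, ?_, ?_⟩
    · rw [Finset.mem_product, mem_pairLevel]
      refine ⟨?_, hq.2⟩
      simp only
      rw [energy_erase h1, energy_insert h2]
      linarith [hq.1]
    · simp only [hat_psi, hat_psiStar, if_pos h1, if_neg h2] at h0
      simp only
      rw [psi_ket_of_notMem (by simp), psiStar_ket_of_mem (by simp), Maya.insert_erase h1,
        Maya.erase_insert h2, map_smul, map_smul, wedgeSign_erase_self, wedgeSign_insert_self,
        smul_eq_mul, smul_eq_mul]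
      intro h3
      apply h0
      rw [← h3]
      ring
    · simp only [Maya.insert_erase h1, Maya.erase_insert h2]
  · rintro ⟨p, i⟩ _ h0
    obtain ⟨h2, h1⟩ := key1 p i (right_ne_zero_of_mul h0)
    simp only
    rw [hat_psi, hat_psiStar, if_pos (by simp), if_neg (by simp), psi_ket_of_notMem h1,
      psiStar_ket_of_mem h2, Maya.insert_erase h2, Maya.erase_insert h1, map_smul, map_smul,
      wedgeSign_erase_self, wedgeSign_insert_self, smul_eq_mul, smul_eq_mul]
    ring

/-- The Plücker relations: `∑ ψ_i ⊗ ψ*_i` annihilates `ĝ|0⟩ ⊗ ĝ|0⟩`. -/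
theorem IsGroupLike.plucker {g : Fock →ₗ[ℂ] FockHat} (hg : IsGroupLike g) (T₁ T₂ : Maya) :
    ∑ᶠ i : ℤ, hat (psi i) (g (ket vac)) T₁ * hat (psiStar i) (g (ket vac)) T₂ = 0 := by
  rw [hg]
  refine finsum_eq_zero_of_forall_eq_zero fun i => ?_
  by_cases h : i ∈ vac.1
  · rw [psi_ket_of_mem h, map_zero, Pi.zero_apply, zero_mul]
  · rw [psiStar_ket_of_notMem h, map_zero, Pi.zero_apply, mul_zero]

/-- The bilinear identity for the graded tau-functions of a group-like element. -/
theorem IsGroupLike.sum_tauSeries_mul {g : Fock →ₗ[ℂ] FockHat} (hg : IsGroupLike g) {ι : Type*}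
    [Fintype ι] {a c : ι → ℂ} {K : ℂ} {t₁ t₂ : ℕ+ → ℂ} (ha : ∀ i, a i ≠ 0)
    (h : PowerSeries.C K * (PowerSeries.X * hSeries (t₁ - t₂)) =
      ∑ i, PowerSeries.C (c i) * hSeries (invPow (a i))) :
    ∑ i, PowerSeries.C (c i) *
      (tauSeries g (t₁ - invPow (a i)) * tauSeries g (t₂ + invPow (a i))) = 0 := by
  ext e
  rw [map_sum, map_zero]
  simp only [PowerSeries.coeff_C_mul, coeff_tauSeries_mul, Finset.mul_sum]
  rw [Finset.sum_comm]
  have h1 := sum_pairLevel (bra 1 ∘ₗ gammaPlus t₁) (bra (-1) ∘ₗ gammaPlus t₂) (g (ket vac)) e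
  simp only [hg.plucker, mul_zero, Finset.sum_const_zero, LinearMap.comp_apply] at h1
  rw [← mul_zero K, ← h1, Finset.mul_sum]
  refine Finset.sum_congr rfl fun p _ => ?_
  rw [mul_left_comm, finsum_bra_psi_mul_bra_psiStar ha h, Finset.mul_sum]
  refine Finset.sum_congr rfl fun i _ => ?_
  rw [tauTerm, tauTerm]
  ring

/-! ### The determinant formula for graded tau-functions -/

theorem hSeries_neg_sum {ι : Type*} (s : Finset ι) (u : ι → ℂ) :
    hSeries (-∑ k ∈ s, invPow (u k)) =
      ∏ k ∈ s, (1 - PowerSeries.C (u k)⁻¹ * PowerSeries.X) := by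
  classical
  induction s using Finset.induction_on with
  | empty => rw [Finset.sum_empty, Finset.prod_empty, neg_zero, hSeries_zero]
  | insert a s ha ih =>
    rw [Finset.sum_insert ha, Finset.prod_insert ha, neg_add, hSeries_add, ih, hSeries_neg_invPow]

/-- The partial fraction decomposition as an identity between generating series. -/
theorem partial_fractions_hSeries {n : ℕ} {z w : Fin (n + 1) → ℂ} (hw : Function.Injective w)
    (hz0 : ∀ i, z i ≠ 0) (hw0 : ∀ i, w i ≠ 0) (h : ∀ i j, z i ≠ w j) :
    ∃ K : ℂ, PowerSeries.C K * (PowerSeries.X * hSeries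
        (invPow (z 0) + ∑ k, invPow (w k) - ∑ i : Fin n, invPow (z i.succ))) =
      PowerSeries.C (valueAtZero z w) * hSeries (invPow (z 0)) -
        ∑ j, PowerSeries.C (residue z w j / (z 0 - w j)) * hSeries (invPow (w j)) := by
  obtain ⟨K, hK⟩ := partial_fractions hw hz0 hw0 h
  refine ⟨K, ?_⟩
  have h1 := congrArg (Polynomial.coeToPowerSeries.ringHom (R := ℂ)) hK
  simp only [map_sub, map_mul, map_sum, map_prod, map_one,
    Polynomial.coeToPowerSeries.ringHom_apply, Polynomial.coe_C, Polynomial.coe_X] at h1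
  rw [← hSeries_neg_sum, ← hSeries_neg_sum] at h1
  have h5 : ∀ j : Fin (n + 1), ∏ k : Fin n, (1 - PowerSeries.C (w (j.succAbove k))⁻¹ *
      PowerSeries.X) = hSeries (-∑ k : Fin n, invPow (w (j.succAbove k))) :=
    fun j => (hSeries_neg_sum _ _).symm
  simp only [h5] at h1
  simp only [← hSeries_neg_invPow, ← hSeries_add] at h1
  have h2 := congrArg (fun f => hSeries (invPow (z 0) + ∑ k, invPow (w k)) * f) h1
  simp only [mul_sub, Finset.mul_sum] at h2
  have h3 : ∀ (c : ℂ) (a b : ℕ+ → ℂ),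
      hSeries a * (PowerSeries.C c * hSeries b) = PowerSeries.C c * hSeries (a + b) := by
    intro c a b
    rw [hSeries_add]
    ring
  have h4 : ∀ (c : ℂ) (a b : ℕ+ → ℂ), hSeries a * (PowerSeries.C c * (PowerSeries.X * hSeries b)) =
      PowerSeries.C c * (PowerSeries.X * hSeries (a + b)) := by
    intro c a b
    rw [hSeries_add]
    ring
  simp only [h3, h4] at h2
  rw [add_neg_cancel_right, ← sub_eq_add_neg] at h2
  have h6 : ∀ j : Fin (n + 1), invPow (z 0) + ∑ k, invPow (w k) +
      (-invPow (z 0) + -∑ k : Fin n, invPow (w (j.succAbove k))) = invPow (w j) := by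
    intro j
    rw [Fin.sum_univ_succAbove (fun k => invPow (w k)) j]
    abel
  simp only [h6] at h2
  exact h2.symm

/-- The Fay identity for several points, with graded tau-functions: the bilinear identity for times
whose difference has the generating series `∏ (1 - X / z_i) / ((1 - X / z_0) ∏ (1 - X / w_j))`, the
numerator running over `i ≥ 1`. -/
theorem IsGroupLike.fay {g : Fock →ₗ[ℂ] FockHat} (hg : IsGroupLike g) (t : ℕ+ → ℂ) {n : ℕ}
    {z w : Fin (n + 1) → ℂ} (hw : Function.Injective w)
    (hz0 : ∀ i, z i ≠ 0) (hw0 : ∀ i, w i ≠ 0) (h : ∀ i j, z i ≠ w j) :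
    PowerSeries.C (valueAtZero z w) *
        (tauSeries g t * tauSeries g (t - invPowerSums z + invPowerSums w)) =
      ∑ j, PowerSeries.C (residue z w j / (z 0 - w j)) *
        (tauSeries g (t - invPow (z 0) + invPow (w j)) *
          tauSeries g (t - invPowerSums (z ∘ Fin.succ) + invPowerSums (w ∘ j.succAbove))) := by
  obtain ⟨K, hK⟩ := partial_fractions_hSeries hw hz0 hw0 h
  have h1 := hg.sum_tauSeries_mul (ι := Option (Fin (n + 1)))
    (a := fun i => i.elim (z 0) w)
    (c := fun i => i.elim (valueAtZero z w) fun j => -(residue z w j / (z 0 - w j))) (K := K)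
    (t₁ := t + ∑ k, invPow (w k) - ∑ i : Fin n, invPow (z i.succ)) (t₂ := t - invPow (z 0))
    (fun i => by cases i; exacts [hz0 0, hw0 _]) (by
      rw [Fintype.sum_option]
      simp only [Option.elim, map_neg, neg_mul, Finset.sum_neg_distrib]
      rw [← sub_eq_add_neg, ← hK]
      congr 3
      abel)
  rw [Fintype.sum_option] at h1
  simp only [Option.elim, map_neg, neg_mul, Finset.sum_neg_distrib] at h1
  rw [← sub_eq_add_neg, sub_eq_zero] at h1
  have h2 : t + ∑ k, invPow (w k) - ∑ i : Fin n, invPow (z i.succ) - invPow (z 0) =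
      t - invPowerSums z + invPowerSums w := by
    rw [invPowerSums_eq_sum, invPowerSums_eq_sum, Fin.sum_univ_succ (fun i => invPow (z i))]
    abel
  rw [h2, sub_add_cancel, mul_comm (tauSeries g _) (tauSeries g t)] at h1
  rw [h1]
  refine Finset.sum_congr rfl fun j _ => ?_
  have h3 : t + ∑ k, invPow (w k) - ∑ i : Fin n, invPow (z i.succ) - invPow (w j) =
      t - invPowerSums (z ∘ Fin.succ) + invPowerSums (w ∘ j.succAbove) := by
    rw [invPowerSums_eq_sum, invPowerSums_eq_sum, Fin.sum_univ_succAbove (fun k => invPow (w k)) j]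
    simp only [Function.comp]
    abel
  rw [h3]
  ring

/-- The determinant formula for graded tau-functions of a group-like element: the expansion of the
determinant along its first row is the identity `IsGroupLike.fay`. -/
theorem IsGroupLike.tauSeries_pow_mul {g : Fock →ₗ[ℂ] FockHat} (hg : IsGroupLike g)
    (t : ℕ+ → ℂ) {n : ℕ} (z w : Fin (n + 1) → ℂ)
    (hz0 : ∀ i, z i ≠ 0) (hw0 : ∀ i, w i ≠ 0) (h : ∀ i j, z i ≠ w j) :
    tauSeries g t ^ n * (tauSeries g (t - invPowerSums z + invPowerSums w) *
        PowerSeries.C (cauchyValue z w)) =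
      (Matrix.of fun i j => PowerSeries.C (1 / (z i - w j)) *
        tauSeries g (t - invPow (z i) + invPow (w j))).det := by
  by_cases hinj : Function.Injective z ∧ Function.Injective w
  swap
  · rw [cauchyValue_of_not_injective hinj, map_zero, mul_zero, mul_zero]
    exact (det_of_not_injective (fun a b => PowerSeries.C (1 / (a - b)) *
      tauSeries g (t - invPow a + invPow b)) hinj).symm
  induction n with
  | zero => simp [cauchyValue, invPowerSums_eq_sum, mul_comm]
  | succ n ih =>
    have hne : (PowerSeries.C (valueAtZero z w) : PowerSeries ℂ) ≠ 0 := by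
      rw [Ne, map_eq_zero_iff _ PowerSeries.C_injective]
      exact valueAtZero_ne_zero hinj.1 h
    refine mul_left_cancel₀ hne ?_
    rw [Matrix.det_succ_row_zero, Finset.mul_sum]
    calc _ = tauSeries g t ^ n * PowerSeries.C (cauchyValue z w) *
          (PowerSeries.C (valueAtZero z w) *
            (tauSeries g t * tauSeries g (t - invPowerSums z + invPowerSums w))) := by
          rw [pow_succ]
          ring
      _ = _ := by
          rw [hg.fay t hinj.2 hz0 hw0 h, Finset.mul_sum]
          refine Finset.sum_congr rfl fun j _ => ?_
          have h1 : (Matrix.of fun i j => PowerSeries.C (1 / (z i - w j)) *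
              tauSeries g (t - invPow (z i) + invPow (w j))).submatrix Fin.succ j.succAbove =
            Matrix.of fun i k => PowerSeries.C (1 / ((z ∘ Fin.succ) i - (w ∘ j.succAbove) k)) *
              tauSeries g (t - invPow ((z ∘ Fin.succ) i) + invPow ((w ∘ j.succAbove) k)) := rfl
          rw [h1, ← ih (z ∘ Fin.succ) (w ∘ j.succAbove) (fun _ => hz0 _) (fun _ => hw0 _)
            (fun _ _ => h _ _)
            ⟨hinj.1.comp (Fin.succ_injective _), hinj.2.comp Fin.succAbove_right_injective⟩,
            Matrix.of_apply]
          have h2 := congrArg (PowerSeries.C (R := ℂ)) (cauchyValue_mul_residue hinj.2 h j)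
          simp only [map_mul, map_pow, map_neg, map_one] at h2
          rw [div_eq_mul_one_div, map_mul]
          linear_combination (tauSeries g t ^ n * PowerSeries.C (1 / (z 0 - w j)) *
            tauSeries g (t - invPow (z 0) + invPow (w j)) * tauSeries g
              (t - invPowerSums (z ∘ Fin.succ) + invPowerSums (w ∘ j.succAbove))) * h2

/-! ### The determinant formula for tau-functions -/

theorem EvalsTo.const (c : ℂ) : EvalsTo (PowerSeries.C c) c := by
  have := hasSum_single (f := fun n => PowerSeries.coeff n (PowerSeries.C c : PowerSeries ℂ)) 0
    fun n hn => by simp [PowerSeries.coeff_C, hn]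
  simpa [EvalsTo] using this

theorem EvalsTo.prod {ι : Type*} (s : Finset ι) {f : ι → PowerSeries ℂ} {a : ι → ℂ}
    (h : ∀ i ∈ s, EvalsTo (f i) (a i)) : EvalsTo (∏ i ∈ s, f i) (∏ i ∈ s, a i) := by
  classical
  induction s using Finset.induction_on with
  | empty => simpa using EvalsTo.one
  | insert i s hi ih =>
    rw [Finset.prod_insert hi, Finset.prod_insert hi]
    exact (h i (Finset.mem_insert_self _ _)).mul
      (ih fun j hj => h j (Finset.mem_insert_of_mem hj))

theorem EvalsTo.det {n : ℕ} {M : Matrix (Fin n) (Fin n) (PowerSeries ℂ)}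
    {A : Matrix (Fin n) (Fin n) ℂ} (h : ∀ i j, EvalsTo (M i j) (A i j)) :
    EvalsTo M.det A.det := by
  rw [Matrix.det_apply', Matrix.det_apply', EvalsTo]
  simp only [map_sum]
  refine hasSum_sum fun σ _ => ?_
  have h1 := (EvalsTo.const ((Equiv.Perm.sign σ : ℤ) : ℂ)).mul
    (EvalsTo.prod Finset.univ fun i _ => h (σ i) i)
  rwa [map_intCast] at h1

theorem IsGroupLike.tau_pow_mul {g : Fock →ₗ[ℂ] FockHat} (hg : IsGroupLike g)
    {t : ℕ+ → ℂ} {n : ℕ} {z w : Fin n → ℂ} (hn : 1 ≤ n)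
    (hz0 : ∀ i, z i ≠ 0) (hw0 : ∀ i, w i ≠ 0) (h : ∀ i j, z i ≠ w j)
    (h1 : Summable (tauTerm g t))
    (h2 : Summable (tauTerm g (t - invPowerSums z + invPowerSums w)))
    (h3 : ∀ i j, Summable (tauTerm g (t - invPow (z i) + invPow (w j)))) :
    tau g t ^ (n - 1) * (tau g (t - invPowerSums z + invPowerSums w) * cauchyValue z w) =
      (Matrix.of fun i j => 1 / (z i - w j) * tau g (t - invPow (z i) + invPow (w j))).det := by
  obtain ⟨n, rfl⟩ := Nat.exists_eq_add_of_le' hn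
  rw [Nat.add_sub_cancel]
  have e1 := ((evalsTo_tauSeries h1).pow n).mul ((evalsTo_tauSeries h2).mul
    (EvalsTo.const (cauchyValue z w)))
  rw [hg.tauSeries_pow_mul t z w hz0 hw0 h] at e1
  exact e1.unique (EvalsTo.det fun i j => (EvalsTo.const _).mul (evalsTo_tauSeries (h3 i j)))

theorem invPowerSums_single (x : ℂ) : invPowerSums ![x] = invPow x := by
  simp [invPowerSums_eq_sum]

theorem FlowConverges.single {n : ℕ} {t : ℕ+ → ℂ} {z w : Fin n → ℂ} (ht : FlowConverges t z w)
    (i j : Fin n) : FlowConverges t ![z i] ![w j] := by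
  obtain ⟨r, hr, hs⟩ := ht
  exact ⟨r, fun k => by simpa using ⟨(hr i).1, (hr j).2⟩, hs⟩

theorem correlator_single (g : Fock →ₗ[ℂ] FockHat) {t : ℕ+ → ℂ} {x y : ℂ}
    (hx : x ≠ 0) (hy : y ≠ 0) (h : x ≠ y) (ht : FlowConverges t ![x] ![y]) :
    correlator g t ![x] ![y] = Complex.exp (xi t x - xi t y) *
      tau g (t - invPowerSums ![x] + invPowerSums ![y]) / (x - y) := by
  rw [correlator_eq g (by simpa) (by simpa) (by simpa) ht]
  simp [cauchyMatrix]
  ring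

theorem IsGroupLike.tau_pow_mul_correlator {g : Fock →ₗ[ℂ] FockHat} (hg : IsGroupLike g)
    {t : ℕ+ → ℂ} {n : ℕ} {z w : Fin n → ℂ} (hn : 1 ≤ n)
    (hz : ∀ i, z i ≠ 0) (hw : ∀ i, w i ≠ 0) (h : ∀ i j, z i ≠ w j) (ht : FlowConverges t z w)
    (h1 : Summable (tauTerm g t))
    (h2 : Summable (tauTerm g (t - invPowerSums z + invPowerSums w)))
    (h3 : ∀ i j, Summable (tauTerm g (t - invPowerSums ![z i] + invPowerSums ![w j]))) :
    tau g t ^ (n - 1) * correlator g t z w = (Matrix.of fun i j =>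
      Complex.exp (xi t (z i) - xi t (w j)) *
        tau g (t - invPowerSums ![z i] + invPowerSums ![w j]) / (z i - w j)).det := by
  simp only [invPowerSums_single] at h3 ⊢
  have e1 : (Matrix.of fun i j => Complex.exp (xi t (z i) - xi t (w j)) *
        tau g (t - invPow (z i) + invPow (w j)) / (z i - w j)) =
      Matrix.of fun i j => Complex.exp (xi t (z i)) * (Matrix.of fun i j =>
        Complex.exp (-xi t (w j)) * (Matrix.of fun i j =>
          1 / (z i - w j) * tau g (t - invPow (z i) + invPow (w j))) i j) i j := by
    ext i j
    simp only [Matrix.of_apply]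
    rw [sub_eq_add_neg, Complex.exp_add]
    ring
  rw [e1, Matrix.det_mul_column, Matrix.det_mul_row,
    ← hg.tau_pow_mul hn hz hw h h1 h2 h3, correlator_eq g hz hw h ht, det_cauchyMatrix z w hz hw h]
  simp only [sub_eq_add_neg (xi t _), Complex.exp_add, Finset.prod_mul_distrib]
  ring

/-! ### Exponentials of matrices -/

section

open scoped Matrix.Norms.Operator

theorem hasSum_matrix_exp {ι : Type*} [Fintype ι] [DecidableEq ι] (G : Matrix ι ι ℂ) (a b : ι) :
    HasSum (fun m : ℕ => ((m ! : ℂ)⁻¹) * (G ^ m) a b) (NormedSpace.exp G a b) := by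
  have h := NormedSpace.exp_series_hasSum_exp' (𝕂 := ℂ) G
  have h1 := h.map (Matrix.entryLinearMap ℂ ℂ a b)
    (LinearMap.continuous_of_finiteDimensional _)
  exact hasSum_of_eq h1 (fun _ => rfl) rfl

open scoped Kronecker in
theorem exp_kronecker_exp {ι : Type*} [Fintype ι] [DecidableEq ι] (G H : Matrix ι ι ℂ) :
    NormedSpace.exp (G ⊗ₖ 1 + 1 ⊗ₖ H) = NormedSpace.exp G ⊗ₖ NormedSpace.exp H := by
  let f : Matrix ι ι ℂ →+* Matrix (ι × ι) (ι × ι) ℂ :=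
    { toFun := fun X => X ⊗ₖ 1
      map_one' := Matrix.one_kronecker_one
      map_mul' := fun X Y => by rw [← Matrix.mul_kronecker_mul, one_mul]
      map_zero' := Matrix.zero_kronecker _
      map_add' := fun X Y => Matrix.add_kronecker _ _ _ }
  let g : Matrix ι ι ℂ →+* Matrix (ι × ι) (ι × ι) ℂ :=
    { toFun := fun X => 1 ⊗ₖ X
      map_one' := Matrix.one_kronecker_one
      map_mul' := fun X Y => by rw [← Matrix.mul_kronecker_mul, one_mul]
      map_zero' := Matrix.kronecker_zero _
      map_add' := fun X Y => Matrix.kronecker_add _ _ _ }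
  have hf : Continuous f := by
    let f' : Matrix ι ι ℂ →ₗ[ℂ] Matrix (ι × ι) (ι × ι) ℂ :=
      { toFun := f
        map_add' := f.map_add
        map_smul' := fun c X => Matrix.smul_kronecker _ _ _ }
    exact f'.continuous_of_finiteDimensional
  have hg : Continuous g := by
    let g' : Matrix ι ι ℂ →ₗ[ℂ] Matrix (ι × ι) (ι × ι) ℂ :=
      { toFun := g
        map_add' := g.map_add
        map_smul' := fun c X => Matrix.kronecker_smul _ _ _ }
    exact g'.continuous_of_finiteDimensional
  have h1 : f (NormedSpace.exp G) = NormedSpace.exp (f G) := NormedSpace.map_exp f hf G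
  have h2 : g (NormedSpace.exp H) = NormedSpace.exp (g H) := NormedSpace.map_exp g hg H
  have hc : Commute (f G) (g H) := by
    change (G ⊗ₖ 1) * (1 ⊗ₖ H) = (1 ⊗ₖ H) * (G ⊗ₖ 1)
    rw [← Matrix.mul_kronecker_mul, ← Matrix.mul_kronecker_mul, one_mul, mul_one, one_mul, mul_one]
  change NormedSpace.exp (f G + g H) = _
  rw [Matrix.exp_add_of_commute _ _ hc, ← h1, ← h2]
  change (NormedSpace.exp G ⊗ₖ 1) * (1 ⊗ₖ NormedSpace.exp H) = _
  rw [← Matrix.mul_kronecker_mul, one_mul, mul_one]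

open scoped Kronecker in
/-- If `[G, P_k] = ∑ A_{ik} P_i` and `[G, Q_k] = -∑ A_{kj} Q_j`, then `G ⊗ 1 + 1 ⊗ G` commutes with
`∑ P_k ⊗ Q_k`, hence so does its exponential `e^G ⊗ e^G`. -/
theorem sum_mul_exp_kronecker {ι κ : Type*} [Fintype ι] [DecidableEq ι] (s : Finset κ)
    {A : κ → κ → ℂ} {G : Matrix ι ι ℂ} {P Q : κ → Matrix ι ι ℂ}
    (hP : ∀ k ∈ s, G * P k = P k * G + ∑ i ∈ s, A i k • P i)
    (hQ : ∀ k ∈ s, G * Q k = Q k * G - ∑ j ∈ s, A k j • Q j) :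
    ∑ k ∈ s, (P k * NormedSpace.exp G) ⊗ₖ (Q k * NormedSpace.exp G) =
      ∑ k ∈ s, (NormedSpace.exp G * P k) ⊗ₖ (NormedSpace.exp G * Q k) := by
  have h1 : Commute (∑ k ∈ s, P k ⊗ₖ Q k) (G ⊗ₖ 1 + 1 ⊗ₖ G) := by
    have e1 : ∀ k ∈ s, (G ⊗ₖ 1 + 1 ⊗ₖ G) * (P k ⊗ₖ Q k) = (P k ⊗ₖ Q k) * (G ⊗ₖ 1 + 1 ⊗ₖ G) +
        (∑ i ∈ s, A i k • (P i ⊗ₖ Q k) - ∑ j ∈ s, A k j • (P k ⊗ₖ Q j)) := by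
      intro k hk
      have e2 : ∀ X : Matrix ι ι ℂ, (∑ i ∈ s, A i k • P i) ⊗ₖ X = ∑ i ∈ s, A i k • (P i ⊗ₖ X) := by
        intro X
        simp only [← Matrix.smul_kronecker]
        exact map_sum (AddMonoidHom.mk' (fun Y : Matrix ι ι ℂ => Y ⊗ₖ X)
          fun Y Z => Matrix.add_kronecker _ _ _) _ _
      have e3 : ∀ X : Matrix ι ι ℂ, X ⊗ₖ (∑ j ∈ s, A k j • Q j) = ∑ j ∈ s, A k j • (X ⊗ₖ Q j) := by
        intro X
        simp only [← Matrix.kronecker_smul]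
        exact map_sum (AddMonoidHom.mk' (fun Y : Matrix ι ι ℂ => X ⊗ₖ Y)
          fun Y Z => Matrix.kronecker_add _ _ _) _ _
      have e4 : P k ⊗ₖ (Q k * G) = P k ⊗ₖ (G * Q k) + ∑ j ∈ s, A k j • (P k ⊗ₖ Q j) := by
        rw [← e3, ← Matrix.kronecker_add, hQ k hk, sub_add_cancel]
      rw [add_mul, mul_add, ← Matrix.mul_kronecker_mul, ← Matrix.mul_kronecker_mul,
        ← Matrix.mul_kronecker_mul, ← Matrix.mul_kronecker_mul, one_mul, one_mul, mul_one, mul_one,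
        hP k hk, Matrix.add_kronecker, e2, e4]
      abel
    rw [commute_iff_eq, Finset.mul_sum, Finset.sum_mul, Finset.sum_congr rfl e1,
      Finset.sum_add_distrib, Finset.sum_sub_distrib,
      Finset.sum_comm (f := fun k i => A i k • (P i ⊗ₖ Q k)), sub_self, add_zero]
  have h2 := h1.exp_right
  rw [exp_kronecker_exp, commute_iff_eq, Finset.mul_sum, Finset.sum_mul] at h2
  simpa only [Matrix.mul_kronecker_mul] using h2

end

/-! ### Finite blocks of the Fock space -/

/-- In the state `S` all sites `i < a` are occupied and all sites `i ≥ b` are empty. -/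
def InBlock (a b : ℤ) (S : Maya) : Prop := (∀ i, i < a → i ∈ S.1) ∧ ∀ i, b ≤ i → i ∉ S.1

/-- The basis states in which only the sites `a ≤ i < b` are free. -/
def Block (a b : ℤ) : Type := {S : Maya // InBlock a b S}

instance (a b : ℤ) : Finite (Block a b) := (finite_between a b).to_subtype

instance (a b : ℤ) : Fintype (Block a b) := Fintype.ofFinite _

instance (a b : ℤ) : DecidableEq (Block a b) := Classical.decEq _

theorem exists_inBlock (S : Maya) : ∃ a b : ℤ, ∀ a' ≤ a, ∀ b' ≥ b, InBlock a' b' S := by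
  obtain ⟨b, hb⟩ := S.2.1.bddAbove
  obtain ⟨a, ha⟩ := S.2.2.bddBelow
  refine ⟨min a 0, max b 0 + 1, fun a' ha' b' hb' => ⟨fun i hi => ?_, fun i hi h => ?_⟩⟩
  · by_contra h
    have := ha ⟨h, by omega⟩
    omega
  · have := hb ⟨h, by omega⟩
    omega

/-- The operator `X` does not connect the block to its complement. -/
def PreservesBlock (a b : ℤ) (X : Module.End ℂ Fock) : Prop :=
  ∀ S T, X (ket S) T ≠ 0 → (InBlock a b S ↔ InBlock a b T)

/-- The matrix of an operator between the states of a block. -/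
def blockMatrix (a b : ℤ) : Module.End ℂ Fock →ₗ[ℂ] Matrix (Block a b) (Block a b) ℂ where
  toFun X := Matrix.of fun T S => X (ket S.1) T.1
  map_add' _ _ := rfl
  map_smul' _ _ := rfl

theorem blockMatrix_apply {a b : ℤ} (X : Module.End ℂ Fock) (T S : Block a b) :
    blockMatrix a b X T S = X (ket S.1) T.1 := rfl

theorem apply_eq_sum (v : Fock) {M : Type*} [AddCommMonoid M] [Module ℂ M] (X : Fock →ₗ[ℂ] M) :
    X v = ∑ U ∈ v.support, v U • X (ket U) := by
  conv_lhs => rw [← Finsupp.sum_single v]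
  rw [Finsupp.sum, map_sum]
  exact Finset.sum_congr rfl fun U _ => by rw [single_eq_smul_ket, map_smul]

/-- Sums over the states of a block. -/
theorem apply_eq_sum_block {a b : ℤ} {v : Fock} (hv : ∀ U, v U ≠ 0 → InBlock a b U)
    {M : Type*} [AddCommMonoid M] [Module ℂ M] (X : Fock →ₗ[ℂ] M) :
    X v = ∑ U : Block a b, v U.1 • X (ket U.1) := by
  rw [apply_eq_sum v X]
  refine Finset.sum_bij_ne_zero (fun U hU _ => ⟨U, hv U (Finsupp.mem_support_iff.1 hU)⟩)
    (fun _ _ _ => Finset.mem_univ _) ?_ ?_ ?_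
  · exact fun U _ _ V _ _ h => congrArg Subtype.val h
  · intro U _ hU
    exact ⟨U.1, Finsupp.mem_support_iff.2 (left_ne_zero_of_smul hU), hU, rfl⟩
  · exact fun _ _ _ => rfl

theorem PreservesBlock.mul {a b : ℤ} {X Y : Module.End ℂ Fock} (hX : PreservesBlock a b X)
    (hY : PreservesBlock a b Y) : PreservesBlock a b (X * Y) := by
  intro S T h
  rw [Module.End.mul_apply, apply_eq_sum (Y (ket S)) X, Finsupp.finsetSum_apply] at h
  obtain ⟨U, _, hU⟩ := Finset.exists_ne_zero_of_sum_ne_zero h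
  rw [Finsupp.smul_apply] at hU
  exact (hY S U (left_ne_zero_of_smul hU)).trans (hX U T (right_ne_zero_of_smul hU))

theorem PreservesBlock.neg {a b : ℤ} {X : Module.End ℂ Fock} (hX : PreservesBlock a b X) :
    PreservesBlock a b (-X) := fun S T h => hX S T fun h0 => h (by simp [h0])

theorem blockMatrix_mul {a b : ℤ} (X : Module.End ℂ Fock) {Y : Module.End ℂ Fock}
    (hY : PreservesBlock a b Y) :
    blockMatrix a b (X * Y) = blockMatrix a b X * blockMatrix a b Y := by
  ext T S
  rw [Matrix.mul_apply, blockMatrix_apply, Module.End.mul_apply,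
    apply_eq_sum_block (fun U hU => (hY _ U hU).1 S.2) X, Finsupp.finsetSum_apply]
  exact Finset.sum_congr rfl fun U _ => by
    rw [Finsupp.smul_apply, smul_eq_mul, mul_comm, blockMatrix_apply, blockMatrix_apply]

theorem hat_eq_sum_block {a b : ℤ} {X : Module.End ℂ Fock} (hX : PreservesBlock a b X)
    (v : FockHat) (T : Block a b) :
    hat X v T.1 = ∑ U : Block a b, blockMatrix a b X T U * v U.1 := by
  have h : ∀ S, X (ket S) T.1 * v S ≠ 0 → InBlock a b S := fun S hS =>
    (hX S T.1 (left_ne_zero_of_mul hS)).2 T.2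
  classical
  rw [hat, finsum_eq_sum_of_support_subset
    (s := Finset.univ.image fun U : Block a b => U.1) _ fun S hS => ?_]
  · exact Finset.sum_image fun U _ V _ h => Subtype.ext h
  · rw [Finset.coe_image, Finset.coe_univ]
    exact ⟨⟨S, h S hS⟩, Set.mem_univ _, rfl⟩

theorem inBlock_insert {a b i : ℤ} (ha : a ≤ i) (hb : i < b) (S : Maya) :
    InBlock a b (S.insert i) ↔ InBlock a b S := by
  simp only [InBlock, Maya.mem_insert_iff, not_or]
  constructor
  · rintro ⟨h1, h2⟩
    exact ⟨fun k hk => (h1 k hk).resolve_left (by omega), fun k hk => (h2 k hk).2⟩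
  · rintro ⟨h1, h2⟩
    exact ⟨fun k hk => Or.inr (h1 k hk), fun k hk => ⟨by omega, h2 k hk⟩⟩

theorem inBlock_erase {a b i : ℤ} (ha : a ≤ i) (hb : i < b) (S : Maya) :
    InBlock a b (S.erase i) ↔ InBlock a b S := by
  simp only [InBlock, Maya.mem_erase_iff, not_and]
  constructor
  · rintro ⟨h1, h2⟩
    exact ⟨fun k hk => (h1 k hk).1, fun k hk h => h2 k hk h (by omega)⟩
  · rintro ⟨h1, h2⟩
    exact ⟨fun k hk => ⟨h1 k hk, by omega⟩, fun k hk h => absurd h (h2 k hk)⟩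

theorem preservesBlock_psi {a b i : ℤ} (ha : a ≤ i) (hb : i < b) :
    PreservesBlock a b (psi i) := by
  intro S T h
  by_cases hi : i ∈ S.1
  · simp [psi_ket_of_mem hi] at h
  · rw [psi_ket_of_notMem hi, Finsupp.smul_apply] at h
    have h1 : S.insert i = T := by
      by_contra hne
      exact right_ne_zero_of_smul h (Finsupp.single_eq_of_ne (Ne.symm hne))
    rw [← h1, inBlock_insert ha hb]

theorem preservesBlock_psiStar {a b i : ℤ} (ha : a ≤ i) (hb : i < b) :
    PreservesBlock a b (psiStar i) := by
  intro S T h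
  by_cases hi : i ∈ S.1
  · rw [psiStar_ket_of_mem hi, Finsupp.smul_apply] at h
    have h1 : S.erase i = T := by
      by_contra hne
      exact right_ne_zero_of_smul h (Finsupp.single_eq_of_ne (Ne.symm hne))
    rw [← h1, inBlock_erase ha hb]
  · simp [psiStar_ket_of_notMem hi] at h

theorem preservesBlock_normalOrd {a b i j : ℤ} (hai : a ≤ i) (hib : i < b) (haj : a ≤ j)
    (hjb : j < b) : PreservesBlock a b (normalOrd i j) := by
  rw [normalOrd]
  split_ifs
  · exact (preservesBlock_psi hai hib).mul (preservesBlock_psiStar haj hjb)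
  · exact ((preservesBlock_psiStar haj hjb).mul (preservesBlock_psi hai hib)).neg

/-! ### The exponential of a lower triangular matrix is group-like -/

theorem psi_psi (i j : ℤ) (v : Fock) : psi i (psi j v) = -psi j (psi i v) :=
  eq_neg_of_add_eq_zero_left (LinearMap.congr_fun (psi_anticomm i j) v)

theorem psiStar_psiStar (i j : ℤ) (v : Fock) :
    psiStar i (psiStar j v) = -psiStar j (psiStar i v) :=
  eq_neg_of_add_eq_zero_left (LinearMap.congr_fun (psiStar_anticomm i j) v)

theorem psi_psiStar (i j : ℤ) (v : Fock) :
    psi i (psiStar j v) = (if i = j then v else 0) - psiStar j (psi i v) := by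
  have h : psi i (psiStar j v) + psiStar j (psi i v) = _ :=
    LinearMap.congr_fun (psi_psiStar_anticomm i j) v
  rw [eq_sub_iff_add_eq, h]
  split_ifs <;> rfl

theorem normalOrd_eq_sub (i j : ℤ) :
    ∃ c : ℂ, ∀ v, normalOrd i j v = psi i (psiStar j v) - c • v := by
  rw [normalOrd]
  split_ifs with h
  · exact ⟨0, fun v => by rw [zero_smul, sub_zero]; rfl⟩
  · refine ⟨if i = j then 1 else 0, fun v => ?_⟩
    rw [psi_psiStar, LinearMap.neg_apply, Module.End.mul_apply]
    split_ifs <;> simp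

theorem normalOrd_psi (i j k : ℤ) (v : Fock) :
    normalOrd i j (psi k v) = psi k (normalOrd i j v) + if j = k then psi i v else 0 := by
  obtain ⟨c, hc⟩ := normalOrd_eq_sub i j
  have h1 : psiStar j (psi k v) = (if j = k then v else 0) - psi k (psiStar j v) := by
    rw [psi_psiStar k j]
    by_cases h : j = k
    · rw [if_pos h, if_pos h.symm, sub_sub_cancel]
    · rw [if_neg h, if_neg (Ne.symm h), zero_sub, neg_sub, sub_zero]
  rw [hc, hc, h1, map_sub, map_sub, psi_psi i k, map_smul]
  split_ifs
  · abel
  · rw [map_zero]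
    abel

theorem normalOrd_psiStar (i j k : ℤ) (v : Fock) :
    normalOrd i j (psiStar k v) + (if i = k then psiStar j v else 0) =
      psiStar k (normalOrd i j v) := by
  obtain ⟨c, hc⟩ := normalOrd_eq_sub i j
  rw [hc, hc, psiStar_psiStar j k, map_neg, psi_psiStar i k, map_sub, map_smul]
  split_ifs <;> abel

/-- The part of `∑ A_{ij} :ψ_i ψ*_j:` with indices in `[a, b)`. -/
def blockGen (A : ℤ → ℤ → ℂ) (a b : ℤ) : Module.End ℂ Fock :=
  ∑ p ∈ Finset.Ico a b ×ˢ Finset.Ico a b, A p.1 p.2 • normalOrd p.1 p.2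

theorem blockGen_mul_psi (A : ℤ → ℤ → ℂ) {a b k : ℤ} (hk : k ∈ Finset.Ico a b) :
    blockGen A a b * psi k = psi k * blockGen A a b + ∑ i ∈ Finset.Ico a b, A i k • psi i := by
  have h : ∑ i ∈ Finset.Ico a b, A i k • psi i = ∑ p ∈ Finset.Ico a b ×ˢ Finset.Ico a b,
      A p.1 p.2 • if p.2 = k then psi p.1 else 0 := by
    rw [Finset.sum_product]
    refine Finset.sum_congr rfl fun i _ => ?_
    simp only [smul_ite, smul_zero]
    rw [Finset.sum_ite_eq', if_pos hk]
  rw [h]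
  refine LinearMap.ext fun v => ?_
  simp only [blockGen, Module.End.mul_apply, LinearMap.add_apply, LinearMap.sum_apply,
    LinearMap.smul_apply, map_sum, map_smul]
  rw [← Finset.sum_add_distrib]
  refine Finset.sum_congr rfl fun p _ => ?_
  rw [normalOrd_psi, smul_add]
  split_ifs <;> rfl

theorem blockGen_mul_psiStar (A : ℤ → ℤ → ℂ) {a b k : ℤ} (hk : k ∈ Finset.Ico a b) :
    blockGen A a b * psiStar k + ∑ j ∈ Finset.Ico a b, A k j • psiStar j =
      psiStar k * blockGen A a b := by
  have h : ∑ j ∈ Finset.Ico a b, A k j • psiStar j = ∑ p ∈ Finset.Ico a b ×ˢ Finset.Ico a b,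
      A p.1 p.2 • if p.1 = k then psiStar p.2 else 0 := by
    rw [Finset.sum_product_right]
    refine Finset.sum_congr rfl fun i _ => ?_
    simp only [smul_ite, smul_zero]
    rw [Finset.sum_ite_eq', if_pos hk]
  rw [h]
  refine LinearMap.ext fun v => ?_
  simp only [blockGen, Module.End.mul_apply, LinearMap.add_apply, LinearMap.sum_apply,
    LinearMap.smul_apply, map_sum, map_smul]
  rw [← Finset.sum_add_distrib]
  refine Finset.sum_congr rfl fun p _ => ?_
  rw [← normalOrd_psiStar, smul_add]
  split_ifs <;> rfl

theorem psi_apply_of_notMem {i : ℤ} {T : Maya} (hT : i ∉ T.1) (v : Fock) : psi i v T = 0 := by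
  have h : Finsupp.lapply T ∘ₗ psi i = 0 := ket_ext fun S => by
    rw [LinearMap.comp_apply, Finsupp.lapply_apply, LinearMap.zero_apply]
    by_cases hi : i ∈ S.1
    · rw [psi_ket_of_mem hi, Finsupp.zero_apply]
    · have hne : S.insert i ≠ T := by
        rintro rfl
        exact hT (by simp)
      rw [psi_ket_of_notMem hi]
      simp [ket, hne]
  exact LinearMap.congr_fun h v

theorem psiStar_apply_of_mem {i : ℤ} {T : Maya} (hT : i ∈ T.1) (v : Fock) :
    psiStar i v T = 0 := by
  have h : Finsupp.lapply T ∘ₗ psiStar i = 0 := ket_ext fun S => by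
    rw [LinearMap.comp_apply, Finsupp.lapply_apply, LinearMap.zero_apply]
    by_cases hi : i ∈ S.1
    · have hne : S.erase i ≠ T := by
        rintro rfl
        exact hT.2 rfl
      rw [psiStar_ket_of_mem hi]
      simp [ket, hne]
    · rw [psiStar_ket_of_notMem hi, Finsupp.zero_apply]
  exact LinearMap.congr_fun h v

theorem hat_eq_zero {X : Module.End ℂ Fock} {T : Maya} (h : ∀ S, X (ket S) T = 0) (v : FockHat) :
    hat X v T = 0 :=
  finsum_eq_zero_of_forall_eq_zero fun S => by rw [h, zero_mul]

/-- For `j ≤ i`, the operator `:ψ_i ψ*_j:` reaches a state of the block only if both indices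
belong to `[a, b)`. -/
theorem hat_normalOrd_eq_zero {a b i j : ℤ} (ha : a ≤ 0) (hb : 0 ≤ b) (hji : j ≤ i) {T : Maya}
    (hT : InBlock a b T) (hij : ¬ ((a ≤ i ∧ i < b) ∧ a ≤ j ∧ j < b)) (v : FockHat) :
    hat (normalOrd i j) v T = 0 := by
  refine hat_eq_zero (fun S => ?_) v
  rw [normalOrd]
  split_ifs with hj
  · rw [Module.End.mul_apply]
    exact psi_apply_of_notMem (hT.2 i (by omega)) _
  · by_cases haj : a ≤ j
    · have h1 := psi_psiStar i j (ket S)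
      rw [if_neg (by omega), zero_sub] at h1
      rw [LinearMap.neg_apply, Module.End.mul_apply, ← h1]
      exact psi_apply_of_notMem (hT.2 i (by omega)) _
    · rw [LinearMap.neg_apply, Module.End.mul_apply, Finsupp.neg_apply,
        psiStar_apply_of_mem (hT.1 j (by omega)), neg_zero]

theorem cliffordGen_eq_sum_block {A : ℤ → ℤ → ℂ} (hA : ∀ i j, i < j → A i j = 0) {a b : ℤ}
    (ha : a ≤ 0) (hb : 0 ≤ b) (v : FockHat) (T : Block a b) :
    cliffordGen A v T.1 = ∑ U : Block a b, blockMatrix a b (blockGen A a b) T U * v U.1 := by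
  rw [cliffordGen, finsum_eq_sum_of_support_subset (s := Finset.Ico a b ×ˢ Finset.Ico a b)]
  · simp only [blockGen, map_sum, map_smul, Matrix.sum_apply, Matrix.smul_apply, Finset.sum_mul]
    rw [Finset.sum_comm]
    refine Finset.sum_congr rfl fun p hp => ?_
    simp only [Finset.mem_product, Finset.mem_Ico] at hp
    rw [hat_eq_sum_block (preservesBlock_normalOrd hp.1.1 hp.1.2 hp.2.1 hp.2.2), Finset.mul_sum]
    exact Finset.sum_congr rfl fun U _ => by rw [smul_eq_mul, mul_assoc]
  · intro p hp
    by_contra h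
    simp only [Finset.coe_product, Finset.coe_Ico, Set.mem_prod, Set.mem_Ico] at h
    refine hp ?_
    change A p.1 p.2 * hat (normalOrd p.1 p.2) v T.1 = 0
    rcases lt_or_ge p.1 p.2 with h1 | h1
    · rw [hA _ _ h1, zero_mul]
    · rw [hat_normalOrd_eq_zero ha hb h1 T.2 h, mul_zero]

theorem iterate_cliffordGen {A : ℤ → ℤ → ℂ} (hA : ∀ i j, i < j → A i j = 0) {a b : ℤ}
    (ha : a ≤ 0) (hb : 0 ≤ b) (m : ℕ) (S T : Block a b) :
    (cliffordGen A)^[m] (ket S.1 : Maya → ℂ) T.1 =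
      (blockMatrix a b (blockGen A a b) ^ m) T S := by
  classical
  induction m generalizing T with
  | zero =>
    rw [Function.iterate_zero, id, pow_zero, Matrix.one_apply, ket, Finsupp.single_apply]
    exact if_congr ⟨fun h => (Subtype.ext h).symm, fun h => congrArg Subtype.val h.symm⟩ rfl rfl
  | succ m ih =>
    rw [Function.iterate_succ_apply', cliffordGen_eq_sum_block hA ha hb, pow_succ',
      Matrix.mul_apply]
    exact Finset.sum_congr rfl fun U _ => by rw [ih]

theorem cliffordExp_ket_apply (A : ℤ → ℤ → ℂ) (S T : Maya) :
    cliffordExp A (ket S) T =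
      ∑' m : ℕ, ((m ! : ℂ)⁻¹) * ((cliffordGen A)^[m] (ket S : Maya → ℂ)) T := by
  have h := congrFun (Finsupp.linearCombination_single ℂ (1 : ℂ) S (v := fun S : Maya =>
    (fun T : Maya => ∑' m : ℕ, ((m ! : ℂ)⁻¹) * ((cliffordGen A)^[m] (ket S : Maya → ℂ)) T :
      FockHat))) T
  rwa [one_smul] at h

/-- Between the states of a block the Clifford exponential is a matrix exponential. -/
theorem cliffordExp_apply_block {A : ℤ → ℤ → ℂ} (hA : ∀ i j, i < j → A i j = 0) {a b : ℤ}
    (ha : a ≤ 0) (hb : 0 ≤ b) (S T : Block a b) :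
    cliffordExp A (ket S.1) T.1 = NormedSpace.exp (blockMatrix a b (blockGen A a b)) T S := by
  rw [cliffordExp_ket_apply, ← (hasSum_matrix_exp _ T S).tsum_eq]
  exact tsum_congr fun m => by rw [iterate_cliffordGen hA ha hb]

theorem cliffordExp_vac {A : ℤ → ℤ → ℂ} (hA : ∀ i j, i < j → A i j = 0) :
    cliffordExp A (ket vac) vac = 1 := by
  have h0 : InBlock 0 0 vac := ⟨fun i hi => hi, fun i hi h => absurd h (not_lt.2 hi)⟩
  have h1 := cliffordExp_apply_block hA le_rfl le_rfl ⟨vac, h0⟩ ⟨vac, h0⟩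
  have h2 : blockGen A 0 0 = 0 := by simp [blockGen]
  rw [h1, h2, map_zero, NormedSpace.exp_zero]
  exact Matrix.one_apply_eq (n := Block 0 0) (α := ℂ) ⟨vac, h0⟩

theorem isGroupLike_cliffordExp {A : ℤ → ℤ → ℂ} (hA : ∀ i j, i < j → A i j = 0) :
    IsGroupLike (cliffordExp A) := by
  intro S₁ S₂ T₁ T₂
  -- all four states belong to one block
  obtain ⟨a, b, ha, hb, hS₁, hS₂, hT₁, hT₂⟩ : ∃ a b : ℤ, a ≤ 0 ∧ 0 ≤ b ∧ InBlock a b S₁ ∧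
      InBlock a b S₂ ∧ InBlock a b T₁ ∧ InBlock a b T₂ := by
    obtain ⟨a₁, b₁, h₁⟩ := exists_inBlock S₁
    obtain ⟨a₂, b₂, h₂⟩ := exists_inBlock S₂
    obtain ⟨a₃, b₃, h₃⟩ := exists_inBlock T₁
    obtain ⟨a₄, b₄, h₄⟩ := exists_inBlock T₂
    refine ⟨min 0 (min (min a₁ a₂) (min a₃ a₄)), max 0 (max (max b₁ b₂) (max b₃ b₄)), ?_, ?_,
      h₁ _ ?_ _ ?_, h₂ _ ?_ _ ?_, h₃ _ ?_ _ ?_, h₄ _ ?_ _ ?_⟩ <;> simp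
  set G := blockMatrix a b (blockGen A a b) with hG
  have hP : ∀ k ∈ Finset.Ico a b, PreservesBlock a b (psi k) := fun k hk =>
    preservesBlock_psi (Finset.mem_Ico.1 hk).1 (Finset.mem_Ico.1 hk).2
  have hQ : ∀ k ∈ Finset.Ico a b, PreservesBlock a b (psiStar k) := fun k hk =>
    preservesBlock_psiStar (Finset.mem_Ico.1 hk).1 (Finset.mem_Ico.1 hk).2
  have hGen : PreservesBlock a b (blockGen A a b) := by
    intro S T h
    rw [blockGen, LinearMap.sum_apply, Finsupp.finsetSum_apply] at h
    obtain ⟨p, hp, hp'⟩ := Finset.exists_ne_zero_of_sum_ne_zero h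
    simp only [Finset.mem_product, Finset.mem_Ico] at hp
    rw [LinearMap.smul_apply, Finsupp.smul_apply] at hp'
    exact preservesBlock_normalOrd hp.1.1 hp.1.2 hp.2.1 hp.2.2 S T (right_ne_zero_of_smul hp')
  have key := sum_mul_exp_kronecker (Finset.Ico a b) (A := A) (G := G)
    (P := fun k => blockMatrix a b (psi k)) (Q := fun k => blockMatrix a b (psiStar k))
    (fun k hk => by
      rw [hG, ← blockMatrix_mul _ (hP k hk), blockGen_mul_psi A hk, map_add,
        blockMatrix_mul _ hGen, map_sum]
      simp only [map_smul])
    (fun k hk => by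
      rw [hG, ← blockMatrix_mul _ (hQ k hk), eq_sub_iff_add_eq, ← blockMatrix_mul _ hGen,
        ← blockGen_mul_psiStar A hk, map_add, map_sum]
      simp only [map_smul])
  have key' := congrFun (congrFun key (⟨T₁, hT₁⟩, ⟨T₂, hT₂⟩)) (⟨S₁, hS₁⟩, ⟨S₂, hS₂⟩)
  simp only [Matrix.sum_apply] at key'
  have hleft : ∀ (X : Module.End ℂ Fock), PreservesBlock a b X → ∀ (S T : Block a b),
      hat X (cliffordExp A (ket S.1)) T.1 = (blockMatrix a b X * NormedSpace.exp G) T S := by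
    intro X hX S T
    rw [hat_eq_sum_block hX, Matrix.mul_apply]
    exact Finset.sum_congr rfl fun U _ => by rw [cliffordExp_apply_block hA ha hb]
  have hright : ∀ (X : Module.End ℂ Fock), PreservesBlock a b X → ∀ (S T : Block a b),
      cliffordExp A (X (ket S.1)) T.1 = (NormedSpace.exp G * blockMatrix a b X) T S := by
    intro X hX S T
    rw [apply_eq_sum_block (fun U hU => (hX _ U hU).1 S.2) (cliffordExp A), Finset.sum_apply,
      Matrix.mul_apply]
    exact Finset.sum_congr rfl fun U _ => by
      rw [Pi.smul_apply, cliffordExp_apply_block hA ha hb, smul_eq_mul, mul_comm,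
        blockMatrix_apply]
  rw [finsum_eq_sum_of_support_subset (s := Finset.Ico a b) _ fun i hi => ?_,
    finsum_eq_sum_of_support_subset (s := Finset.Ico a b) _ fun i hi => ?_]
  · refine Eq.trans (Finset.sum_congr rfl fun i hi => ?_) (key'.trans
      (Finset.sum_congr rfl fun i hi => ?_))
    · rw [hleft _ (hP i hi) ⟨S₁, hS₁⟩ ⟨T₁, hT₁⟩, hleft _ (hQ i hi) ⟨S₂, hS₂⟩ ⟨T₂, hT₂⟩]
      rfl
    · rw [hright _ (hP i hi) ⟨S₁, hS₁⟩ ⟨T₁, hT₁⟩, hright _ (hQ i hi) ⟨S₂, hS₂⟩ ⟨T₂, hT₂⟩]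
      rfl
  · rw [Finset.coe_Ico]
    constructor
    · by_contra h
      exact hi (by simp only [psi_ket_of_mem (hS₁.1 i (not_le.1 h)), map_zero, Pi.zero_apply,
        zero_mul])
    · by_contra h
      exact hi (by simp only [psiStar_ket_of_notMem (hS₂.2 i (not_lt.1 h)), map_zero,
        Pi.zero_apply, mul_zero])
  · rw [Finset.coe_Ico]
    constructor
    · by_contra h
      exact hi (by simp only [hat_psiStar, if_pos (hT₂.1 i (not_le.1 h)), mul_zero])
    · by_contra h
      exact hi (by simp only [hat_psi, if_neg (hT₁.2 i (not_lt.1 h)), zero_mul])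

end

end FermionicFock

theorem mainTheorem2 :
    -- the Clifford representation of a lower triangular group element `g = e^A` is group-like
    (∀ A : ℤ → ℤ → ℂ, (∀ i j, i < j → A i j = 0) →
      IsGroupLike (cliffordExp A) ∧ cliffordExp A (ket vac) vac = 1) ∧
    ∀ (n : ℕ) (z w : Fin n → ℂ), (∀ i, z i ≠ 0) → (∀ i, w i ≠ 0) → (∀ i j, z i ≠ w j) →
      -- `⟨0| ∏ ψ(z_i) ψ*(w_i) = det (1 / (z_i - w_j)) ⟨0| γ̂₊([w⁻¹] - [z⁻¹])`
      (PairCovectorConverges bra0 z w ∧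
        ∀ S : Maya, pairCovector bra0 z w S =
          (cauchyMatrix z w).det *
            bra0 (gammaPlus (invPowerSums w - invPowerSums z) (ket S))) ∧
      ∀ t : ℕ+ → ℂ, FlowConverges t z w →
        PairCovectorConverges (flowBra t) z w ∧
        -- the `n`-pair correlator in terms of the `τ`-function
        (∀ g : Fock →ₗ[ℂ] FockHat,
          Summable (tauTerm g (t - invPowerSums z + invPowerSums w)) →
            Summable (correlatorTerm g t z w) ∧
            correlator g t z w =
              (∏ j, Complex.exp (xi t (z j) - xi t (w j))) *
                tau g (t - invPowerSums z + invPowerSums w) * (cauchyMatrix z w).det) ∧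
        -- the `n`-pair correlator in terms of the single-pair correlators
        (∀ g : Fock →ₗ[ℂ] FockHat, IsGroupLike g → 1 ≤ n →
          Summable (tauTerm g t) →
          Summable (tauTerm g (t - invPowerSums z + invPowerSums w)) →
          (∀ i j, Summable (tauTerm g (t - invPowerSums ![z i] + invPowerSums ![w j]))) →
            tau g t ^ (n - 1) * correlator g t z w =
                (Matrix.of fun i j => correlator g t ![z i] ![w j]).det ∧
            tau g t ^ (n - 1) * correlator g t z w =
                (Matrix.of fun i j =>
                  Complex.exp (xi t (z i) - xi t (w j)) *
                    tau g (t - invPowerSums ![z i] + invPowerSums ![w j]) /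
                      (z i - w j)).det) := by
  refine ⟨fun A hA => ⟨isGroupLike_cliffordExp hA, cliffordExp_vac hA⟩, fun n z w hz hw h => ?_⟩
  refine ⟨?_, fun t ht => ⟨pairCovectorConverges hz hw h ht, fun g hg =>
    ⟨summable_correlatorTerm hz hw h ht hg, correlator_eq g hz hw h ht⟩,
    fun g hg hn h1 h2 h3 => ?_⟩⟩
  · -- the case `t = 0` of the covectors with a flow operator
    have h0 := flowConverges_zero z w
    rw [← flowBra_zero]
    refine ⟨pairCovectorConverges hz hw h h0, fun S => ?_⟩
    rw [pairCovector_eq hz hw h h0, pairValue, det_cauchyMatrix z w hz hw h]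
    simp only [xi_zero, sub_self, Complex.exp_zero, Finset.prod_const_one, one_mul, zero_sub,
      flowBra_zero]
    rw [neg_add_eq_sub]
  · have h4 := hg.tau_pow_mul_correlator hn hz hw h ht h1 h2 h3
    refine ⟨h4.trans (congrArg Matrix.det (Matrix.ext fun i j => ?_)), h4⟩
    exact (correlator_single g (hz i) (hw j) (h i j) (ht.single i j)).symm
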